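/- Let $\nu\in[0,1)$, $w=\tfrac12$, $\mu=w(1-\nu)$. For $L\ge 2$ consider diffusion-limited pair annihilation and deposition on the torus $\mathbb T_L=\mathbb Z/L\mathbb Z$: the Markov chain on $\{0,1\}^{\mathbb T_L}$ in which, for each $k\in\mathbb T_L$, the pair of occupation numbers $(\eta_k,\eta_{k+1})$ is flipped to $(1-\eta_k,1-\eta_{k+1})$ by a deposition event at rate $\mu$ and by a jump event at rate $w(\eta_k+\eta_{k+1})$. Let the activity $A(t)$ be the number of jump events up to time $t$. For every $s\in\mathbb R$ and every initial configuration $\eta$ with an even number of particles the limit $$K_L(s)=\lim_{t\to\infty}\frac1{Lt}\ln \mathbb E_{\eta}\big[e^{sA(t)}\big]$$ exists and does not depend on $\eta$, and $K_L$ is a smooth function of $s$. Let $\kappa^c_n(L)=\frac{d^n}{ds^n}K_L(s)\big|_{s=s_c}$, $n\ge1$, be the cumulants of the activity in the even sector at the critical point $s_c=\ln(1-\mu/w)=\ln\nu$ (for $\nu=0$, where $s_c=-\infty$, $\kappa^c_n(L)$ is the limit of $K_L^{(n)}(s)$ as $s\to-\infty$, which exists). Then, as $L\to\infty$, $$\kappa^c_1(L)\sim\kappa^*_1,\qquad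 \kappa^c_2(L)\sim\kappa^*_2\ln L,\qquad \kappa^c_3(L)\sim\kappa^*_3\ln L,$$ $$\kappa^c_{2n}(L)\sim\kappa^*_{2n}L^{2n-2},\qquad \kappa^c_{2n+1}(L)\sim\kappa^*_{2n+1}L^{2n-2}\qquad(n\ge2),$$ where $$\kappa^*_1=\frac1\pi\Big(\sqrt{1-\nu^2}-\frac{1-\nu}{\nu}\arcsin\nu\Big)$$ (with its limiting value $0$ for $\nu=0$), and for $n\ge1$ $$\kappa^*_{2n}=2\,(2n)!\,\alpha_n\beta_{2n}(\nu),\qquad \kappa^*_{2n+1}=2\,(2n+1)!\,\alpha_n\beta_{2n+1}(\nu),$$ $$\alpha_1=\frac1{2\pi},\qquad \alpha_n=\frac{1-2^{1-2n}}{\pi^{2n-1}}\,\zeta(2n-1)\quad(n>1),$$ $$\beta_{2n}(\nu)=\frac{\nu^{2n}\binom{1/2}{n}}{2(1-\nu^2)^{n-1/2}},\qquad \beta_{2n+1}(\nu)=\frac{\nu^{2n}\Big[\nu(1-2\nu)\binom{-1/2}{n}+(1-\nu^2)\binom{-1/2}{n-1}\Big]}{4(1-\nu^2)^{n+1/2}}.$$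 Here $\zeta$ is the Riemann zeta function, and $a(L)\sim b(L)$ means $a(L)-b(L)=o(b(L))$ (for $\nu=0$ all $\kappa^c_n(L)$ and $\kappa^*_n$ vanish). -/

import Mathlib

open Filter Topology Asymptotics

noncomputable section

namespace DLPAD

/-- Configurations on the integer torus with `L` sites, at most one particle per site. -/
abbrev Config (L : ℕ) : Type := ZMod L → Bool

/-- The occupation number of site `k`, equal to `0` or `1`. -/
def occ {L : ℕ} (η : Config L) (k : ZMod L) : ℕ := (η k).toNat

/-- The configuration in which the occupations of the sites `k` and `k + 1` are flipped. -/
def flipPair {L : ℕ} (η : Config L) (k : ZMod L) : Config L :=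
  fun j => if j = k ∨ j = k + 1 then !(η j) else η j

/-- The total number of particles. -/
def particleNumber {L : ℕ} (η : Config L) : ℕ :=
  ∑ k ∈ Finset.range L, occ η (k : ZMod L)

/-- The generator of the joint process `(η(t), A(t))`, where `A(t)` is the activity. On each bond
`(k, k + 1)` the pair of occupations is flipped by a deposition event at rate `μ`, which leaves the
activity unchanged, and by a jump event at rate `w (η_k + η_{k+1})`, which increments it by `1`. -/
def jointGenerator (w μ : ℝ) (L : ℕ) (f : Config L × ℕ → ℝ) : Config L × ℕ → ℝ :=
  fun x => ∑ k ∈ Finset.range L,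
    (μ * f (flipPair x.1 k, x.2)
      + w * ((occ x.1 k : ℝ) + (occ x.1 (k + 1) : ℝ)) * f (flipPair x.1 k, x.2 + 1)
      - (μ + w * ((occ x.1 k : ℝ) + (occ x.1 (k + 1) : ℝ))) * f x)

/-- The probability that the joint process started in `x` is in state `y` at time `t`, that is, the
`(x, y)` entry of the exponential of `t` times the (bounded, row-finite) intensity matrix. -/
def transitionProb (w μ : ℝ) (L : ℕ) (t : ℝ) (x y : Config L × ℕ) : ℝ :=
  ∑' n : ℕ, t ^ n / (n.factorial : ℝ) *
    ((jointGenerator w μ L)^[n] (Set.indicator {y} (fun _ => (1 : ℝ)))) x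

/-- The moment generating function `E[exp (s A(t))]` of the activity at time `t`, for the process
started in the configuration `η` with `A(0) = 0`. -/
def activityMGF (w μ : ℝ) (L : ℕ) (η : Config L) (s t : ℝ) : ℝ :=
  ∑' y : Config L × ℕ, transitionProb w μ L t (η, 0) y * Real.exp (s * (y.2 : ℝ))

/-- The logarithm of the moment generating function of the activity per unit of time and length. -/
def scaledLogMGF (w μ : ℝ) (L : ℕ) (η : Config L) (s t : ℝ) : ℝ :=
  Real.log (activityMGF w μ L η s t) / ((L : ℝ) * t)

/-- The long-time cumulant generating function of the activity in the even sector: the limit of the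
scaled logarithm of the moment generating function, started in the empty configuration. -/
def evenCGF (w μ : ℝ) (L : ℕ) (s : ℝ) : ℝ :=
  limUnder atTop (fun t : ℝ => scaledLogMGF w μ L (fun _ => false) s t)

/-- The `n`-th cumulant of the activity in the even sector at the Legendre parameter `s`. -/
def cumulant (w μ : ℝ) (L n : ℕ) (s : ℝ) : ℝ :=
  iteratedDeriv n (evenCGF w μ L) s

/-- The deposition rate `μ = w (1 - ν)` for the jump rate `w = 1 / 2`. -/
def depositionRate (ν : ℝ) : ℝ := (1 / 2) * (1 - ν)

/-- The cumulant generating function in the even sector, in the units `w = 1 / 2`. -/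
def K (ν : ℝ) (L : ℕ) (s : ℝ) : ℝ := evenCGF (1 / 2) (depositionRate ν) L s

/-- The critical point `ln (1 - μ / w)`, for `μ < w`. -/
def criticalPoint (w μ : ℝ) : ℝ := Real.log (1 - μ / w)

/-- The `n`-th cumulant at the critical point `s_c = ln ν`; for `ν = 0`, where `s_c = -∞`, it is
the limit for `s → -∞` of the `n`-th cumulant at `s`. -/
def criticalCumulant (ν : ℝ) (n L : ℕ) : ℝ :=
  if ν = 0 then limUnder atBot (cumulant (1 / 2) (depositionRate ν) L n)
  else cumulant (1 / 2) (depositionRate ν) L n (criticalPoint (1 / 2) (depositionRate ν))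

/-- The limiting mean; for `ν = 0` the value is the limit for `ν → 0`. -/
def kappaStarOne (ν : ℝ) : ℝ :=
  if ν = 0 then 0
  else (1 / Real.pi) * (Real.sqrt (1 - ν ^ 2) - (1 - ν) / ν * Real.arcsin ν)

/-- The coefficients `α_n`, for `n ≥ 1`. -/
def alpha (n : ℕ) : ℝ :=
  if n = 1 then 1 / (2 * Real.pi)
  else (1 - (2 : ℝ) ^ (1 - 2 * (n : ℤ))) / Real.pi ^ (2 * n - 1)
    * (riemannZeta (2 * (n : ℂ) - 1)).re

/-- The coefficients `β_{2n}(ν)`, for `n ≥ 1`. -/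
def betaEven (n : ℕ) (ν : ℝ) : ℝ :=
  ν ^ (2 * n) * Ring.choose (1 / 2 : ℝ) n / (2 * (1 - ν ^ 2) ^ ((n : ℝ) - 1 / 2))

/-- The coefficients `β_{2n+1}(ν)`, for `n ≥ 1`. -/
def betaOdd (n : ℕ) (ν : ℝ) : ℝ :=
  ν ^ (2 * n) * (ν * (1 - 2 * ν) * Ring.choose (-1 / 2 : ℝ) n
      + (1 - ν ^ 2) * Ring.choose (-1 / 2 : ℝ) (n - 1))
    / (4 * (1 - ν ^ 2) ^ ((n : ℝ) + 1 / 2))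

/-- The rescaled cumulants `κ*_{2n}`, for `n ≥ 1`. -/
def kappaStarEven (n : ℕ) (ν : ℝ) : ℝ :=
  2 * ((2 * n).factorial : ℝ) * alpha n * betaEven n ν

/-- The rescaled cumulants `κ*_{2n+1}`, for `n ≥ 1`. -/
def kappaStarOdd (n : ℕ) (ν : ℝ) : ℝ :=
  2 * ((2 * n + 1).factorial : ℝ) * alpha n * betaOdd n ν

end DLPAD

end

/-! The moment generating function of the activity is a Feynman-Kac semigroup: `E[exp (s A(t))]` is
`exp (t T)` applied to the constant `1`, where `T` is the generator with jumps weighted by `u = exp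
s`. Its exponential growth rate on the irreducible even sector is the Perron eigenvalue of `T`, that
is, the eigenvalue with a positive eigenfunction (`tendsto_log_exp_smul_div`).

This eigenvalue is computable because the three flip weights of a bond with 0, 1 or 2 particles,
`μ`, `μ + w u`, `μ + 2 w u`, form an arithmetic progression. After a Jordan-Wigner transformation
the tilted generator is therefore a quadratic form in fermions, with antiperiodic boundary
conditions on the even sector (`complexTiltedGenerator_eq`). Quadratic forms have Gaussian
eigenstates `exp Q |0>`, with `Q` a pair creation operator; the eigenvalue equation decouples into
one Riccati equation for each momentum `k = (2 m + 1) π / L`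
(`complexTiltedGenerator_gaussianState`). Solving it with the positive square root gives the
eigenvalue `(1/2) ∑ √D(k) - L (μ + 1/2)`.

That this is the Perron eigenvalue is not read off from the Gaussian state but follows by continuity
in `s`. At `s = 0` the eigenvalue is `0`, so the eigenfunction is constant by the maximum principle.
A nonnegative eigenfunction with a zero vanishes identically, so along a continuous family
normalized at the empty configuration nonnegativity is both an open and a closed condition
(`eigenfamily_pos`).

The rest is asymptotic analysis of a sum over modes. Put `y = sin (k/2)` and `x = (s - s_c) / y`. At
the critical point `D = y² ∑ d_n(y) x^n` with polynomials `d_n`, so `√D = y ∑ F_n(y) x^n` with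
smooth `F_n`, and the `n`-th cumulant is `n! / (2 L)` times the sum of `y^(1-n) F_n(y)` over the
modes (`criticalCumulant_eq`). At `y = 0` the series under the root is `4 (1 - ν²) + ν² x²`. Hence
`F_(2n)(0)` is a binomial coefficient of exponent `1/2`, whereas `F_(2n+1)(0) = 0` and the
derivative of `F_(2n+1)` at `0` enters. Both orders `2n` and `2n+1` thus reduce to the sum of
`y^(-(2n-1))`, which explains their common growth. For `n ≥ 2` this sum is carried by finitely many
lowest modes up to a small error and yields the odd part of a zeta series; for `n = 1` it diverges
logarithmically (`tendsto_gapSum_growthScale`). The mean has no singular weight and is a Riemann sum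
with an elementary primitive.

For `ν = 0` the critical value is `u = 0`, and every `s`-derivative carries a factor `exp s`, so all
critical cumulants vanish. -/

noncomputable section

namespace DLPAD

/-! ### The tilted generator and the Feynman-Kac formula -/

/-- The tilted generator: jump events are weighted by `u = e^s`. -/
def tiltedGenerator (w μ u : ℝ) (L : ℕ) : (Config L → ℝ) →ₗ[ℝ] (Config L → ℝ) where
  toFun f := fun η => ∑ k ∈ Finset.range L,
    ((μ + w * u * ((occ η k : ℝ) + (occ η (k + 1) : ℝ))) * f (flipPair η k)
      - (μ + w * ((occ η k : ℝ) + (occ η (k + 1) : ℝ))) * f η)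
  map_add' f g := by
    ext η
    simp only [Pi.add_apply, ← Finset.sum_add_distrib]
    exact Finset.sum_congr rfl fun k _ => by ring
  map_smul' c f := by
    ext η
    simp only [Pi.smul_apply, smul_eq_mul, RingHom.id_apply, Finset.mul_sum]
    exact Finset.sum_congr rfl fun k _ => by ring

lemma tiltedGenerator_apply (w μ u : ℝ) (L : ℕ) (f : Config L → ℝ) (η : Config L) :
    tiltedGenerator w μ u L f η = ∑ k ∈ Finset.range L,
    ((μ + w * u * ((occ η k : ℝ) + (occ η (k + 1) : ℝ))) * f (flipPair η k)
      - (μ + w * ((occ η k : ℝ) + (occ η (k + 1) : ℝ))) * f η) := rfl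

lemma jointGenerator_apply (w μ : ℝ) (L : ℕ) (f : Config L × ℕ → ℝ) (x : Config L × ℕ) :
    jointGenerator w μ L f x = ∑ k ∈ Finset.range L,
    (μ * f (flipPair x.1 k, x.2)
      + w * ((occ x.1 k : ℝ) + (occ x.1 (k + 1) : ℝ)) * f (flipPair x.1 k, x.2 + 1)
      - (μ + w * ((occ x.1 k : ℝ) + (occ x.1 (k + 1) : ℝ))) * f x) := rfl

lemma occ_le_one {L : ℕ} (η : Config L) (k : ZMod L) : (occ η k : ℝ) ≤ 1 := by
  unfold occ; cases η k <;> simp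

/-- The entries of the powers of the intensity matrix. -/
def generatorPower (w μ : ℝ) (L n : ℕ) (x y : Config L × ℕ) : ℝ :=
  ((jointGenerator w μ L)^[n] (Set.indicator {y} (fun _ => (1 : ℝ)))) x

lemma generatorPower_succ (w μ : ℝ) (L n : ℕ) (x y : Config L × ℕ) :
    generatorPower w μ L (n + 1) x y = ∑ k ∈ Finset.range L,
    (μ * generatorPower w μ L n (flipPair x.1 k, x.2) y
      + w * ((occ x.1 k : ℝ) + (occ x.1 (k + 1) : ℝ))
          * generatorPower w μ L n (flipPair x.1 k, x.2 + 1) y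
      - (μ + w * ((occ x.1 k : ℝ) + (occ x.1 (k + 1) : ℝ))) * generatorPower w μ L n x y) := by
  unfold generatorPower
  rw [Function.iterate_succ_apply']
  rfl

/-- Induction on the first step of the chain: a row of the next power is a finite combination of
rows of the previous one, so no growth condition on `F` is needed. -/
lemma hasSum_generatorPower (w μ : ℝ) (L n : ℕ) (F : Config L × ℕ → ℝ) (x : Config L × ℕ) :
    HasSum (fun y => generatorPower w μ L n x y * F y) (((jointGenerator w μ L)^[n] F) x) := by
  classical
  induction n generalizing x with
  | zero =>
    have : (fun y => generatorPower w μ L 0 x y * F y) = fun y => if y = x then F x else 0 := by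
      ext y
      by_cases h : y = x
      · subst h; simp [generatorPower]
      · have h' : x ≠ y := fun e => h e.symm
        simp [generatorPower, h, h']
    rw [this]
    exact hasSum_ite_eq x (F x)
  | succ n ih =>
    rw [Function.iterate_succ_apply']
    simp only [generatorPower_succ, Finset.sum_mul]
    rw [jointGenerator_apply]
    apply hasSum_sum
    intro k _
    have h := (((ih (flipPair x.1 k, x.2)).mul_left μ).add
      ((ih (flipPair x.1 k, x.2 + 1)).mul_left
        (w * ((occ x.1 k : ℝ) + (occ x.1 (k + 1) : ℝ))))).sub
      ((ih x).mul_left (μ + w * ((occ x.1 k : ℝ) + (occ x.1 (k + 1) : ℝ))))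
    exact Eq.subst (motive := fun g => HasSum g _) (funext fun y => by ring) h

/-- In the norm weighted by `exp (s a)`, one application of the intensity matrix costs at most `2 μ
+ 2 w (1 + exp s)` per bond: gain and loss terms of the deposition, loss of the jumps, and their
gain, which raises the counter by one. This is the domination needed to exchange the sum over states
with the exponential series. -/
lemma sum_abs_generatorPower_le {w μ : ℝ} (hw : 0 ≤ w) (hμ : 0 ≤ μ) (L n : ℕ) (s : ℝ)
    (x : Config L × ℕ) (A : Finset (Config L × ℕ)) :
    ∑ y ∈ A, |generatorPower w μ L n x y| * Real.exp (s * y.2)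
      ≤ (L * (2 * μ + 2 * w * (1 + Real.exp s))) ^ n * Real.exp (s * x.2) := by
  classical
  induction n generalizing x with
  | zero =>
    have h : ∀ y ∈ A, |generatorPower w μ L 0 x y| * Real.exp (s * y.2)
        = if y = x then Real.exp (s * x.2) else 0 := by
      intro y _
      by_cases h : y = x
      · subst h; simp [generatorPower]
      · have h' : x ≠ y := fun e => h e.symm
        simp [generatorPower, h, h']
    rw [Finset.sum_congr rfl h, Finset.sum_ite_eq']
    split_ifs <;> simp [Real.exp_nonneg]
  | succ n ih =>
    set C : ℝ := L * (2 * μ + 2 * w * (1 + Real.exp s)) with hC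
    have hr : ∀ k : ℕ, 0 ≤ w * ((occ x.1 k : ℝ) + (occ x.1 (k + 1) : ℝ)) := fun k => by positivity
    have hr2 : ∀ k : ℕ, w * ((occ x.1 k : ℝ) + (occ x.1 (k + 1) : ℝ)) ≤ 2 * w := fun k => by
      nlinarith [occ_le_one x.1 k, occ_le_one x.1 (k + 1)]
    calc ∑ y ∈ A, |generatorPower w μ L (n + 1) x y| * Real.exp (s * y.2)
        ≤ ∑ y ∈ A, ∑ k ∈ Finset.range L,
          (μ * (|generatorPower w μ L n (flipPair x.1 k, x.2) y| * Real.exp (s * y.2))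
          + w * ((occ x.1 k : ℝ) + (occ x.1 (k + 1) : ℝ))
            * (|generatorPower w μ L n (flipPair x.1 k, x.2 + 1) y| * Real.exp (s * y.2))
          + (μ + w * ((occ x.1 k : ℝ) + (occ x.1 (k + 1) : ℝ)))
            * (|generatorPower w μ L n x y| * Real.exp (s * y.2))) := by
          refine Finset.sum_le_sum fun y _ => ?_
          rw [generatorPower_succ]
          refine (mul_le_mul_of_nonneg_right (Finset.abs_sum_le_sum_abs _ _)
            (Real.exp_nonneg _)).trans ?_
          rw [Finset.sum_mul]
          refine Finset.sum_le_sum fun k _ => ?_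
          have h1 := hr k
          refine (mul_le_mul_of_nonneg_right ((abs_sub _ _).trans
            (add_le_add_left (abs_add_le _ _) _)) (Real.exp_nonneg _)).trans (le_of_eq ?_)
          rw [abs_mul μ, abs_mul (w * _), abs_mul (μ + _), abs_of_nonneg hμ, abs_of_nonneg h1,
            abs_of_nonneg (add_nonneg hμ h1)]
          ring
      _ = ∑ k ∈ Finset.range L,
          (μ * ∑ y ∈ A, |generatorPower w μ L n (flipPair x.1 k, x.2) y| * Real.exp (s * y.2)
          + w * ((occ x.1 k : ℝ) + (occ x.1 (k + 1) : ℝ))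
            * ∑ y ∈ A, |generatorPower w μ L n (flipPair x.1 k, x.2 + 1) y| * Real.exp (s * y.2)
          + (μ + w * ((occ x.1 k : ℝ) + (occ x.1 (k + 1) : ℝ)))
            * ∑ y ∈ A, |generatorPower w μ L n x y| * Real.exp (s * y.2)) := by
          rw [Finset.sum_comm]
          simp only [Finset.sum_add_distrib, Finset.mul_sum]
      _ ≤ ∑ k ∈ Finset.range L, (2 * μ + 2 * w * (1 + Real.exp s)) *
            (C ^ n * Real.exp (s * x.2)) := by
          refine Finset.sum_le_sum fun k _ => ?_
          have h1 := ih (flipPair x.1 k, x.2)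
          have h2 := ih (flipPair x.1 k, x.2 + 1)
          have h3 := ih x
          have e2 : Real.exp (s * ((x.2 + 1 : ℕ) : ℝ)) = Real.exp s * Real.exp (s * x.2) := by
            rw [← Real.exp_add]; congr 1; push_cast; ring
          simp only [e2] at h2
          have hE : 0 ≤ C ^ n * Real.exp (s * x.2) := by positivity
          have h4 := hr k
          have h5 := hr2 k
          have k1 := mul_le_mul_of_nonneg_left h1 hμ
          have k2 := mul_le_mul_of_nonneg_left h2 h4
          have k3 := mul_le_mul_of_nonneg_left h3 (add_nonneg hμ h4)
          have k4 := mul_le_mul_of_nonneg_right h5 hE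
          have k5 := mul_le_mul_of_nonneg_right k4 (Real.exp_nonneg s)
          linarith
      _ = C ^ (n + 1) * Real.exp (s * x.2) := by
          rw [Finset.sum_const, Finset.card_range, nsmul_eq_mul, pow_succ, hC]; ring

/-- A jump multiplies `exp (s a)` by `exp s`, so functions of this product form are preserved and
the counter is absorbed into the weight of the jumps. -/
lemma iterate_jointGenerator_exp (w μ : ℝ) (L n : ℕ) (s : ℝ) (g : Config L → ℝ) :
    (jointGenerator w μ L)^[n] (fun y => Real.exp (s * y.2) * g y.1)
      = fun x => Real.exp (s * x.2) * ((tiltedGenerator w μ (Real.exp s) L)^[n] g) x.1 := by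
  induction n with
  | zero => rfl
  | succ n ih =>
    rw [Function.iterate_succ_apply', ih, Function.iterate_succ_apply']
    ext x
    rw [tiltedGenerator_apply, Finset.mul_sum]
    unfold jointGenerator
    refine Finset.sum_congr rfl fun k _ => ?_
    have e2 : Real.exp (s * ((x.2 + 1 : ℕ) : ℝ)) = Real.exp s * Real.exp (s * x.2) := by
      rw [← Real.exp_add]; congr 1; push_cast; ring
    simp only [e2]
    ring

lemma activityMGF_eq_tsum {w μ : ℝ} (hw : 0 ≤ w) (hμ : 0 ≤ μ) (L : ℕ) (η : Config L) (s t : ℝ) :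
    activityMGF w μ L η s t = ∑' n : ℕ, t ^ n / (n.factorial : ℝ) *
      ((tiltedGenerator w μ (Real.exp s) L)^[n] (fun _ => 1)) η := by
  set C : ℝ := L * (2 * μ + 2 * w * (1 + Real.exp s)) with hC
  have hCn : 0 ≤ C := by positivity
  let h : ℕ → Config L × ℕ → ℝ := fun n y =>
    t ^ n / (n.factorial : ℝ) * generatorPower w μ L n (η, 0) y * Real.exp (s * y.2)
  have habs : ∀ n (A : Finset (Config L × ℕ)), ∑ y ∈ A, ‖h n y‖
      ≤ (|t| * C) ^ n / (n.factorial : ℝ) := by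
    intro n A
    have := sum_abs_generatorPower_le hw hμ L n s (η, 0) A
    simp only [Nat.cast_zero, mul_zero, Real.exp_zero, mul_one, ← hC] at this
    have e : ∀ y, ‖h n y‖ = |t| ^ n / (n.factorial : ℝ) *
        (|generatorPower w μ L n (η, 0) y| * Real.exp (s * y.2)) := by
      intro y
      simp only [h, Real.norm_eq_abs, abs_mul, abs_div, abs_pow, Nat.abs_cast, Real.abs_exp]
      ring
    simp only [e, ← Finset.mul_sum]
    refine (mul_le_mul_of_nonneg_left this (by positivity)).trans (le_of_eq ?_)
    rw [mul_pow |t| C]; ring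
  have hs1 : ∀ n, Summable fun y => ‖h n y‖ := fun n =>
    summable_of_sum_le (fun _ => norm_nonneg _) (habs n)
  -- Fubini applies: the absolute sums over the states are bounded by the terms of the series of
  -- `exp (|t| C)`.
  have hs : Summable (Function.uncurry h) := by
    apply Summable.of_norm
    rw [summable_prod_of_nonneg (fun _ => norm_nonneg _)]
    refine ⟨hs1, ?_⟩
    refine Summable.of_nonneg_of_le (fun n => tsum_nonneg fun _ => norm_nonneg _)
      (fun n => ?_) (Real.summable_pow_div_factorial (|t| * C))
    exact (hs1 n).tsum_le_of_sum_le (habs n)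
  have hcomm := hs.tsum_comm
  unfold activityMGF transitionProb
  calc _ = ∑' y, ∑' n, h n y := by
        refine tsum_congr fun y => ?_
        rw [← tsum_mul_right]; rfl
    _ = ∑' n, ∑' y, h n y := hcomm
    _ = _ := by
        refine tsum_congr fun n => ?_
        have h1 := (hasSum_generatorPower w μ L n (fun y => Real.exp (s * y.2) * 1) (η, 0))
        rw [iterate_jointGenerator_exp w μ L n s (fun _ => 1)] at h1
        simp only [Nat.cast_zero, mul_zero, Real.exp_zero, one_mul, mul_one] at h1
        rw [← h1.tsum_eq, ← tsum_mul_left]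
        refine tsum_congr fun y => ?_
        simp only [h]; ring

/-! ### Growth rate of a positive semigroup -/

lemma hasSum_exp_apply {𝕜 V : Type*} [RCLike 𝕜] [NormedAddCommGroup V] [NormedSpace 𝕜 V]
    [CompleteSpace V] (T : V →L[𝕜] V) (f : V) :
    HasSum (fun n : ℕ => ((n.factorial : 𝕜)⁻¹) • (T ^ n) f) (NormedSpace.exp T f) :=
  (NormedSpace.exp_series_hasSum_exp' (𝕂 := 𝕜) T).mapL (ContinuousLinearMap.apply 𝕜 V f)

section Growth

variable {X : Type*}

lemma hasSum_exp_smul_apply [Fintype X] (T : (X → ℝ) →L[ℝ] (X → ℝ)) (t : ℝ) (f : X → ℝ) (x : X) :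
    HasSum (fun n : ℕ => t ^ n / (n.factorial : ℝ) * (T^[n] f) x)
      (NormedSpace.exp (t • T) f x) := by
  have h := (hasSum_exp_apply (t • T) f).mapL (ContinuousLinearMap.proj (R := ℝ) x)
  refine Eq.subst (motive := fun g => HasSum g _) (funext fun n => ?_) h
  simp only [ContinuousLinearMap.proj_apply, Pi.smul_apply, smul_pow, smul_eq_mul,
    smul_apply, ← FunLike.coe_pow_eq_iterate]
  ring

/-- The hypothesis says that `T + C` preserves the cone of functions that are nonnegative on `S`.
Since `exp (t T) = exp (-t C) exp (t (T + C))`, and the last factor is a series with terms in the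
cone, the semigroup preserves it as well. -/
lemma exp_smul_apply_nonneg [Fintype X] {T : (X → ℝ) →L[ℝ] (X → ℝ)} {S : Set X} {C : ℝ}
    (hT : ∀ f : X → ℝ, (∀ x ∈ S, 0 ≤ f x) → ∀ x ∈ S, 0 ≤ T f x + C * f x)
    {t : ℝ} (ht : 0 ≤ t) {f : X → ℝ} (hf : ∀ x ∈ S, 0 ≤ f x) {x : X} (hx : x ∈ S) :
    0 ≤ NormedSpace.exp (t • T) f x := by
  set B : (X → ℝ) →L[ℝ] (X → ℝ) := T + C • 1 with hB
  have hpow : ∀ n : ℕ, ∀ x ∈ S, 0 ≤ (B^[n] f) x := by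
    intro n
    induction n with
    | zero => exact hf
    | succ n ih =>
      intro x hx
      rw [Function.iterate_succ_apply']
      simpa [hB] using hT _ ih x hx
  have h1 : 0 ≤ NormedSpace.exp (t • B) f x :=
    (hasSum_exp_smul_apply B t f x).nonneg fun n =>
      mul_nonneg (by positivity) (hpow n x hx)
  have h2 : NormedSpace.exp (t • T) = Real.exp (-(t * C)) • NormedSpace.exp (t • B) := by
    have e : t • T = algebraMap ℝ ((X → ℝ) →L[ℝ] (X → ℝ)) (-(t * C)) + t • B := by
      rw [hB, Algebra.algebraMap_eq_smul_one, smul_add, smul_smul]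
      module
    let _ : NormedAlgebra ℚ ((X → ℝ) →L[ℝ] (X → ℝ)) := NormedAlgebra.restrictScalars ℚ ℝ _
    rw [e, NormedSpace.exp_add_of_commute (Algebra.commutes _ _),
      ← NormedSpace.algebraMap_exp_comm, Algebra.algebraMap_eq_smul_one, smul_mul_assoc, one_mul,
      ← Real.exp_eq_exp_ℝ]
  rw [h2]
  exact mul_nonneg (Real.exp_nonneg _) h1

/-- The eigenvalue equation holds only on `S`, so it can be iterated only if `T f` on `S` depends on
`f` on `S` alone. The cone condition implies this: apply it to `f` and `-f` for `f` vanishing on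
`S`. -/
lemma iterate_apply_of_eigen {T : (X → ℝ) →L[ℝ] (X → ℝ)} {S : Set X} {C : ℝ}
    (hT : ∀ f : X → ℝ, (∀ x ∈ S, 0 ≤ f x) → ∀ x ∈ S, 0 ≤ T f x + C * f x)
    {φ : X → ℝ} {l : ℝ} (hφ : ∀ x ∈ S, T φ x = l * φ x) (n : ℕ) :
    ∀ x ∈ S, (T^[n] φ) x = l ^ n * φ x := by
  have hzero : ∀ f : X → ℝ, (∀ x ∈ S, f x = 0) → ∀ x ∈ S, T f x = 0 := by
    intro f hf x hx
    have h1 := hT f (fun y hy => (hf y hy).ge) x hx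
    have h2 := hT (-f) (fun y hy => by simp [hf y hy]) x hx
    simp [hf x hx] at h1 h2
    exact le_antisymm h2 h1
  induction n with
  | zero => simp
  | succ n ih =>
    intro x hx
    rw [Function.iterate_succ_apply']
    have := hzero (T^[n] φ - l ^ n • φ) (fun y hy => by simp [ih y hy]) x hx
    rw [map_sub, map_smul, Pi.sub_apply, Pi.smul_apply, hφ x hx, smul_eq_mul] at this
    rw [sub_eq_zero.mp this]; ring

lemma exp_smul_apply_of_eigen [Fintype X] {T : (X → ℝ) →L[ℝ] (X → ℝ)} {S : Set X} {C : ℝ}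
    (hT : ∀ f : X → ℝ, (∀ x ∈ S, 0 ≤ f x) → ∀ x ∈ S, 0 ≤ T f x + C * f x)
    {φ : X → ℝ} {l : ℝ} (hφ : ∀ x ∈ S, T φ x = l * φ x) (t : ℝ) {x : X} (hx : x ∈ S) :
    NormedSpace.exp (t • T) φ x = Real.exp (t * l) * φ x := by
  have h1 := hasSum_exp_smul_apply T t φ x
  have h2 : HasSum (fun n : ℕ => (t * l) ^ n / (n.factorial : ℝ) * φ x)
      (Real.exp (t * l) * φ x) := by
    rw [Real.exp_eq_exp_ℝ]
    exact (NormedSpace.expSeries_div_hasSum_exp (t * l)).mul_right _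
  refine h1.unique (Eq.subst (motive := fun g => HasSum g _) (funext fun n => ?_) h2)
  rw [iterate_apply_of_eigen hT hφ n x hx, mul_pow]; ring

/-- Long-time growth rate of a positive semigroup with a positive eigenfunction. -/
lemma tendsto_log_exp_smul_div [Fintype X] {T : (X → ℝ) →L[ℝ] (X → ℝ)} {S : Set X} {C : ℝ}
    (hT : ∀ f : X → ℝ, (∀ x ∈ S, 0 ≤ f x) → ∀ x ∈ S, 0 ≤ T f x + C * f x)
    {φ : X → ℝ} {l : ℝ} (hφ : ∀ x ∈ S, T φ x = l * φ x) (hpos : ∀ x ∈ S, 0 < φ x)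
    {x : X} (hx : x ∈ S) {N : ℝ} (hN : 0 < N) :
    Tendsto (fun t : ℝ => Real.log (NormedSpace.exp (t • T) (fun _ => 1) x) / (N * t))
      atTop (𝓝 (l / N)) := by
  -- By finiteness of `X`, the constant `1` lies between two positive multiples of `φ` on `S`.
  -- Positivity of the semigroup then places its value at `x` between two multiples of `exp (t l) *
  -- φ x`, whose constants disappear after dividing the logarithm by `t`.
  obtain ⟨a, ha, hax⟩ : ∃ a > 0, ∀ y ∈ S, a * φ y ≤ 1 := by
    have hne : 0 < ∑ y, |φ y| :=
      lt_of_lt_of_le (abs_pos.mpr (hpos x hx).ne')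
        (Finset.single_le_sum (f := fun y => |φ y|) (fun _ _ => abs_nonneg _) (Finset.mem_univ x))
    refine ⟨(∑ y, |φ y|)⁻¹, inv_pos.mpr hne, fun y _ => ?_⟩
    rw [inv_mul_le_iff₀ hne, mul_one]
    exact (le_abs_self _).trans
      (Finset.single_le_sum (f := fun y => |φ y|) (fun _ _ => abs_nonneg _) (Finset.mem_univ y))
  obtain ⟨b, hb, hbx⟩ : ∃ b > 0, ∀ y ∈ S, 1 ≤ b * φ y := by
    have hle : ∀ y : X, |φ y|⁻¹ ≤ ∑ y, |φ y|⁻¹ := fun y =>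
      Finset.single_le_sum (f := fun y => |φ y|⁻¹) (fun _ _ => by positivity) (Finset.mem_univ y)
    refine ⟨∑ y, |φ y|⁻¹, lt_of_lt_of_le (inv_pos.mpr (abs_pos.mpr (hpos x hx).ne')) (hle x),
      fun y hy => ?_⟩
    have h1 := mul_le_mul_of_nonneg_right (hle y) (hpos y hy).le
    rwa [abs_of_pos (hpos y hy), inv_mul_cancel₀ (hpos y hy).ne'] at h1
  have hlow : ∀ t : ℝ, 0 ≤ t →
      Real.exp (t * l) * (a * φ x) ≤ NormedSpace.exp (t • T) (fun _ => 1) x := by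
    intro t ht
    have h := exp_smul_apply_nonneg hT ht (f := (fun _ => 1) - a • φ)
      (fun y hy => by simpa using hax y hy) hx
    rw [map_sub, map_smul, Pi.sub_apply, Pi.smul_apply, exp_smul_apply_of_eigen hT hφ t hx,
      smul_eq_mul] at h
    linarith
  have hup : ∀ t : ℝ, 0 ≤ t →
      NormedSpace.exp (t • T) (fun _ => 1) x ≤ Real.exp (t * l) * (b * φ x) := by
    intro t ht
    have h := exp_smul_apply_nonneg hT ht (f := b • φ - (fun _ => 1))
      (fun y hy => by simpa using hbx y hy) hx
    rw [map_sub, map_smul, Pi.sub_apply, Pi.smul_apply, exp_smul_apply_of_eigen hT hφ t hx,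
      smul_eq_mul] at h
    linarith
  have hlim : ∀ c : ℝ, Tendsto (fun t : ℝ => (t * l + c) / (N * t)) atTop (𝓝 (l / N)) := by
    intro c
    have h1 : Tendsto (fun t : ℝ => l / N + c / N * t⁻¹) atTop (𝓝 (l / N + c / N * 0)) :=
      (tendsto_const_nhds).add (tendsto_inv_atTop_zero.const_mul _)
    rw [mul_zero, add_zero] at h1
    refine h1.congr' ?_
    filter_upwards [eventually_gt_atTop 0] with t ht
    field_simp
  have hφx := hpos x hx
  refine tendsto_of_tendsto_of_tendsto_of_le_of_le' (hlim (Real.log (a * φ x)))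
    (hlim (Real.log (b * φ x))) ?_ ?_
  · filter_upwards [eventually_gt_atTop 0] with t ht
    have h0 : 0 < Real.exp (t * l) * (a * φ x) := by positivity
    refine div_le_div_of_nonneg_right ?_ (by positivity)
    have := Real.log_le_log h0 (hlow t ht.le)
    rwa [Real.log_mul (Real.exp_pos _).ne' (by positivity), Real.log_exp] at this
  · filter_upwards [eventually_gt_atTop 0] with t ht
    have h0 : 0 < Real.exp (t * l) * (a * φ x) := by positivity
    refine div_le_div_of_nonneg_right ?_ (by positivity)
    have := Real.log_le_log (h0.trans_le (hlow t ht.le)) (hup t ht.le)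
    rwa [Real.log_mul (Real.exp_pos _).ne' (by positivity), Real.log_exp] at this

end Growth

/-! ### Parity strings and irreducibility of the even sector -/

/-- The Jordan-Wigner string: the parity of the number of particles on the first `m` sites. -/
def parityString {L : ℕ} (η : Config L) (m : ℕ) : ℂ :=
  ∏ i ∈ Finset.range m, if η (i : ZMod L) then -1 else 1

/-- The configuration with one flipped occupation. -/
def flipSite {L : ℕ} (η : Config L) (j : ZMod L) : Config L := Function.update η j (!η j)

lemma natCast_zmod_inj {L i j : ℕ} (hi : i < L) (hj : j < L) :
    ((i : ZMod L) = (j : ZMod L)) ↔ i = j := by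
  rw [ZMod.natCast_eq_natCast_iff', Nat.mod_eq_of_lt hi, Nat.mod_eq_of_lt hj]

lemma flipSite_same {L : ℕ} (η : Config L) (j : ZMod L) : flipSite η j j = !η j := by
  simp [flipSite]

lemma flipSite_of_ne {L : ℕ} (η : Config L) {i j : ZMod L} (h : i ≠ j) :
    flipSite η j i = η i := by
  simp [flipSite, h]

lemma flipSite_flipSite_same {L : ℕ} (η : Config L) (j : ZMod L) :
    flipSite (flipSite η j) j = η := by
  ext i
  by_cases h : i = j
  · subst h; simp [flipSite_same]
  · simp [flipSite_of_ne _ h]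

lemma flipSite_comm {L : ℕ} (η : Config L) (i j : ZMod L) :
    flipSite (flipSite η i) j = flipSite (flipSite η j) i := by
  by_cases hij : i = j
  · rw [hij]
  · ext k
    by_cases hi : k = i
    · subst hi; simp [flipSite_same, flipSite_of_ne _ hij]
    · by_cases hj : k = j
      · subst hj; simp [flipSite_same, flipSite_of_ne _ hi]
      · simp [flipSite_of_ne _ hi, flipSite_of_ne _ hj]

lemma zmod_add_one_ne {L : ℕ} (hL : 2 ≤ L) (k : ZMod L) : k + 1 ≠ k := by
  have : Fact (1 < L) := ⟨hL⟩
  simp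

lemma flipPair_eq {L : ℕ} (hL : 2 ≤ L) (η : Config L) (k : ZMod L) :
    flipPair η k = flipSite (flipSite η k) (k + 1) := by
  have h1 := zmod_add_one_ne hL k
  ext j
  unfold flipPair
  by_cases hk : j = k
  · subst hk; simp [flipSite_of_ne _ h1.symm, flipSite_same]
  · by_cases hk' : j = k + 1
    · subst hk'; simp [flipSite_same, flipSite_of_ne _ h1]
    · simp [hk, hk', flipSite_of_ne _ hk, flipSite_of_ne _ hk']

lemma parityString_succ {L : ℕ} (η : Config L) (m : ℕ) :
    parityString η (m + 1) = parityString η m * if η (m : ZMod L) then -1 else 1 :=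
  Finset.prod_range_succ _ _

lemma parityString_mul_self {L : ℕ} (η : Config L) (m : ℕ) :
    parityString η m * parityString η m = 1 := by
  unfold parityString
  rw [← Finset.prod_mul_distrib]
  exact Finset.prod_eq_one fun i _ => by split_ifs <;> simp

lemma parityString_flipSite {L : ℕ} (η : Config L) {j m : ℕ} (hj : j < L) (hm : m ≤ L) :
    parityString (flipSite η j) m = (if j < m then -1 else 1) * parityString η m := by
  induction m with
  | zero => simp [parityString]
  | succ m ih =>
    rw [parityString_succ, parityString_succ, ih (by omega)]
    rcases lt_trichotomy j m with h | h | h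
    · have hne : (m : ZMod L) ≠ j := by rw [Ne, natCast_zmod_inj hm hj]; omega
      rw [flipSite_of_ne _ hne, if_pos h, if_pos (show j < m + 1 by omega)]; ring
    · subst h
      rw [flipSite_same, if_neg (lt_irrefl j), if_pos (Nat.lt_succ_self j)]
      cases η (j : ZMod L) <;> simp
    · have hne : (m : ZMod L) ≠ j := by rw [Ne, natCast_zmod_inj hm hj]; omega
      rw [flipSite_of_ne _ hne, if_neg (show ¬ j < m by omega), if_neg (show ¬ j < m + 1 by omega)]
      ring

lemma even_particleNumber_iff {L : ℕ} (η : Config L) :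
    Even (particleNumber η) ↔ parityString η L = 1 := by
  have h : parityString η L = (-1) ^ particleNumber η := by
    unfold parityString particleNumber
    rw [← Finset.prod_pow_eq_pow_sum]
    refine Finset.prod_congr rfl fun i _ => ?_
    unfold occ
    cases η (i : ZMod L) <;> simp
  rw [h, neg_one_pow_eq_one_iff_even (by norm_num)]

lemma parityString_flipPair {L : ℕ} (hL : 2 ≤ L) (η : Config L) {k : ℕ} (hk : k < L) :
    parityString (flipPair η k) L = parityString η L := by
  rw [flipPair_eq hL]
  rcases Nat.lt_or_ge (k + 1) L with h | h
  · have : ((k : ZMod L) + 1) = ((k + 1 : ℕ) : ZMod L) := by push_cast; rfl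
    rw [this, parityString_flipSite _ h le_rfl, parityString_flipSite _ hk le_rfl]
    simp [h, hk]
  · have : ((k : ZMod L) + 1) = ((0 : ℕ) : ZMod L) := by
      have e : k + 1 = L := by omega
      rw [← Nat.cast_add_one, e]; simp
    rw [this, parityString_flipSite _ (by omega) le_rfl, parityString_flipSite _ hk le_rfl]
    simp [hk, show 0 < L by omega]

/-- The even sector. -/
def evenSector (L : ℕ) : Set (Config L) := {η | parityString η L = 1}

lemma flipPair_mem_evenSector {L : ℕ} (hL : 2 ≤ L) {η : Config L} (hη : η ∈ evenSector L) {k : ℕ}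
    (hk : k < L) : flipPair η k ∈ evenSector L := by
  unfold evenSector at *
  exact (parityString_flipPair hL η hk).trans hη

lemma empty_mem_evenSector (L : ℕ) : (fun _ => false : Config L) ∈ evenSector L := by
  simp [evenSector, parityString]

/-- A sweep from left to right: if site `m` is occupied, flipping the pair `(m, m + 1)` empties it
without touching earlier sites. Once the first `L - 1` sites are empty, evenness empties the last
one. -/
lemma empty_of_closed {L : ℕ} (hL : 2 ≤ L) (P : Config L → Prop)
    (hP : ∀ η ∈ evenSector L, P η → ∀ k < L, P (flipPair η (k : ℕ)))
    {η : Config L} (hη : η ∈ evenSector L) (h : P η) : P (fun _ => false) := by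
  have key : ∀ m, m + 1 ≤ L → ∃ η' ∈ evenSector L, P η' ∧ ∀ i < m, η' (i : ZMod L) = false := by
    intro m
    induction m with
    | zero => exact fun _ => ⟨η, hη, h, by simp⟩
    | succ m ih =>
      intro hm
      obtain ⟨η', h1, h2, h3⟩ := ih (by omega)
      by_cases hz : η' (m : ZMod L) = false
      · refine ⟨η', h1, h2, fun i hi => ?_⟩
        rcases Nat.lt_succ_iff_lt_or_eq.mp hi with h | h
        · exact h3 i h
        · rw [h, hz]
      · refine ⟨flipPair η' m, flipPair_mem_evenSector hL h1 (by omega), hP η' h1 h2 m (by omega),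
          fun i hi => ?_⟩
        have hm1 : ((m : ZMod L) + 1) = ((m + 1 : ℕ) : ZMod L) := by push_cast; rfl
        rw [flipPair_eq hL, hm1, flipSite_of_ne _ (by
          rw [Ne, natCast_zmod_inj (by omega) (by omega)]; omega)]
        rcases Nat.lt_succ_iff_lt_or_eq.mp hi with h | h
        · rw [flipSite_of_ne _ (by rw [Ne, natCast_zmod_inj (by omega) (by omega)]; omega), h3 i h]
        · rw [h, flipSite_same]; simpa using hz
  obtain ⟨η', h1, h2, h3⟩ := key (L - 1) (by omega)
  have hall : ∀ i < L, η' (i : ZMod L) = false := by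
    intro i hi
    rcases Nat.lt_or_ge i (L - 1) with h | h
    · exact h3 i h
    · have hi' : i = L - 1 := by omega
      have e : parityString η' L = 1 := h1
      have hLs : L = (L - 1) + 1 := by omega
      have e2 : parityString η' (L - 1) = 1 :=
        Finset.prod_eq_one fun j hj => by simp [h3 j (Finset.mem_range.mp hj)]
      have e3 : parityString η' ((L - 1) + 1) = 1 := by rw [← hLs]; exact e
      rw [parityString_succ, e2, one_mul] at e3
      rw [hi']
      by_contra hc
      rw [Bool.not_eq_false] at hc
      rw [if_pos hc] at e3
      norm_num at e3
  have : NeZero L := ⟨by omega⟩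
  have heq : η' = fun _ => false := by
    ext j
    have := hall j.val j.val_lt
    rw [ZMod.natCast_zmod_val] at this
    rw [this]
  rwa [← heq]

lemma flipPair_flipPair {L : ℕ} (η : Config L) (k : ZMod L) : flipPair (flipPair η k) k = η := by
  ext j
  unfold flipPair
  split_ifs <;> simp

/-- Irreducibility of the even sector. Flips are involutions, so the negation of `P` is closed under
them too, and both `P` and its negation would propagate to the empty configuration. -/
lemma of_closed {L : ℕ} (hL : 2 ≤ L) (P : Config L → Prop)
    (hP : ∀ η ∈ evenSector L, P η → ∀ k < L, P (flipPair η (k : ℕ)))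
    {η η' : Config L} (hη : η ∈ evenSector L) (h : P η) (hη' : η' ∈ evenSector L) : P η' := by
  have h0 := empty_of_closed hL P hP hη h
  by_contra hn
  refine empty_of_closed hL (fun η => ¬ P η) (fun ζ hζ hnot k hk hp => hnot ?_) hη' hn h0
  have := hP _ (flipPair_mem_evenSector hL hζ hk) hp k hk
  rwa [flipPair_flipPair] at this

/-! ### Perron-Frobenius arguments on the even sector -/

/-- At a zero of a nonnegative eigenfunction the diagonal terms drop out and a sum of nonnegative
terms equals zero. All its weights are positive because `μ > 0`, so every neighbour is a zero too,
and irreducibility spreads the zeros over the sector. -/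
lemma eigenfunction_eq_zero {w μ u : ℝ} (hw : 0 ≤ w) (hμ : 0 < μ) (hu : 0 ≤ u) {L : ℕ} (hL : 2 ≤ L)
    {f : Config L → ℝ} {l : ℝ} (hf : ∀ η ∈ evenSector L, 0 ≤ f η)
    (heig : ∀ η ∈ evenSector L, tiltedGenerator w μ u L f η = l * f η)
    {η₀ : Config L} (h₀ : η₀ ∈ evenSector L) (hz : f η₀ = 0) {η : Config L}
    (hη : η ∈ evenSector L) : f η = 0 := by
  refine of_closed hL (fun η => f η = 0) (fun ζ hζ hfζ k hk => ?_) h₀ hz hη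
  have h := heig ζ hζ
  rw [tiltedGenerator_apply, hfζ, mul_zero] at h
  simp only [mul_zero, sub_zero] at h
  have hr : ∀ j : ℕ, 0 < μ + w * u * ((occ ζ j : ℝ) + (occ ζ (j + 1) : ℝ)) :=
    fun j => by positivity
  rw [Finset.sum_eq_zero_iff_of_nonneg (fun j hj => mul_nonneg (hr j).le
    (hf _ (flipPair_mem_evenSector hL hζ (Finset.mem_range.mp hj))))] at h
  exact (mul_eq_zero.mp (h k (Finset.mem_range.mpr hk))).resolve_left (hr k).ne'

/-- The escape rate through each bond is at most `μ + 2 w`; adding it back leaves only nonnegative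
coefficients. This is the cone condition of the growth lemmas. -/
lemma tiltedGenerator_add_nonneg {w μ u : ℝ} (hw : 0 ≤ w) (hμ : 0 < μ) (hu : 0 ≤ u) {L : ℕ}
    (hL : 2 ≤ L) (f : Config L → ℝ) (hf : ∀ η ∈ evenSector L, 0 ≤ f η) (η : Config L)
    (hη : η ∈ evenSector L) :
    0 ≤ tiltedGenerator w μ u L f η + (L * (μ + 2 * w)) * f η := by
  have e : tiltedGenerator w μ u L f η + (L * (μ + 2 * w)) * f η
      = ∑ k ∈ Finset.range L,
        ((μ + w * u * ((occ η k : ℝ) + (occ η (k + 1) : ℝ))) * f (flipPair η k)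
        + (w * (1 - (occ η k : ℝ)) + w * (1 - (occ η (k + 1) : ℝ))) * f η) := by
    have : (L * (μ + 2 * w)) * f η = ∑ k ∈ Finset.range L, (μ + 2 * w) * f η := by
      rw [Finset.sum_const, Finset.card_range, nsmul_eq_mul, mul_assoc]
    rw [tiltedGenerator_apply, this, ← Finset.sum_add_distrib]
    exact Finset.sum_congr rfl fun k _ => by ring
  rw [e]
  refine Finset.sum_nonneg fun k hk => add_nonneg (mul_nonneg (by positivity)
    (hf _ (flipPair_mem_evenSector hL hη (Finset.mem_range.mp hk))))
    (mul_nonneg (add_nonneg (mul_nonneg hw ?_) (mul_nonneg hw ?_)) (hf η hη))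
  · linarith [occ_le_one η k]
  · linarith [occ_le_one η (k + 1)]

lemma eigenfunction_pos {w μ u : ℝ} (hw : 0 ≤ w) (hμ : 0 < μ) (hu : 0 ≤ u) {L : ℕ} (hL : 2 ≤ L)
    {f : Config L → ℝ} {l : ℝ} (hf : ∀ η ∈ evenSector L, 0 ≤ f η)
    (heig : ∀ η ∈ evenSector L, tiltedGenerator w μ u L f η = l * f η)
    (h1 : f (fun _ => false) = 1) {η : Config L} (hη : η ∈ evenSector L) : 0 < f η := by
  refine lt_of_le_of_ne (hf η hη) fun h => ?_
  have := eigenfunction_eq_zero hw hμ hu hL hf heig hη h.symm (empty_mem_evenSector L)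
  rw [h1] at this
  exact one_ne_zero this

/-- Maximum principle: without tilt constants are harmonic, so the maximum minus `f` is a
nonnegative eigenfunction for the eigenvalue `0` with a zero, hence vanishes on the sector. -/
lemma harmonic_eq_one {w μ : ℝ} (hw : 0 ≤ w) (hμ : 0 < μ) {L : ℕ} (hL : 2 ≤ L)
    {f : Config L → ℝ}
    (heig : ∀ η ∈ evenSector L, tiltedGenerator w μ 1 L f η = 0)
    (h1 : f (fun _ => false) = 1) {η : Config L} (hη : η ∈ evenSector L) : f η = 1 := by
  have : NeZero L := ⟨by omega⟩
  obtain ⟨η₁, hη₁, hmax⟩ := Set.exists_max_image (evenSector L) f (Set.toFinite _)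
    ⟨_, empty_mem_evenSector L⟩
  have hz : ∀ ζ ∈ evenSector L, f η₁ - f ζ = 0 := fun ζ hζ => by
    refine eigenfunction_eq_zero hw hμ zero_le_one hL (f := fun ζ => f η₁ - f ζ) (l := 0)
      (fun ζ hζ => sub_nonneg.mpr (hmax ζ hζ)) (fun ξ hξ => ?_) hη₁ (sub_self _) hζ
    have h2 := heig ξ hξ
    rw [tiltedGenerator_apply] at h2 ⊢
    rw [zero_mul, ← neg_eq_zero, ← h2, ← Finset.sum_neg_distrib]
    exact Finset.sum_congr rfl fun k _ => by ring
  have h2 := hz η hη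
  have h3 := hz _ (empty_mem_evenSector L)
  linarith

/-- A continuous family of eigenfunctions, normalized at the empty configuration, is positive on
the even sector, because it is so without tilt. -/
lemma eigenfamily_pos {w μ : ℝ} (hw : 0 ≤ w) (hμ : 0 < μ) {L : ℕ} (hL : 2 ≤ L)
    {φ : ℝ → Config L → ℝ} {Λ : ℝ → ℝ} (hc : ∀ η, Continuous fun s => φ s η)
    (h1 : ∀ s, φ s (fun _ => false) = 1)
    (heig : ∀ s, ∀ η ∈ evenSector L,
      tiltedGenerator w μ (Real.exp s) L (φ s) η = Λ s * φ s η) (h0 : Λ 0 = 0)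
    (s : ℝ) {η : Config L} (hη : η ∈ evenSector L) : 0 < φ s η := by
  have : NeZero L := ⟨by omega⟩
  set A : Set ℝ := {s | ∀ η ∈ evenSector L, 0 ≤ φ s η} with hA
  -- By `eigenfunction_pos` weak and strict positivity coincide along the family. The weak form is
  -- closed in `s`, the strict form is open, and `ℝ` is connected.
  have hA' : A = {s | ∀ η ∈ evenSector L, 0 < φ s η} := by
    ext s
    exact ⟨fun h η hη => eigenfunction_pos hw hμ (Real.exp_nonneg s) hL h (heig s) (h1 s) hη,
      fun h η hη => (h η hη).le⟩
  have hcl : IsClosed A := by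
    have : A = ⋂ η ∈ evenSector L, {s | 0 ≤ φ s η} := by ext; simp [hA]
    rw [this]
    exact isClosed_biInter fun η _ => isClosed_le continuous_const (hc η)
  have hop : IsOpen A := by
    have : A = ⋂ η ∈ evenSector L, {s | 0 < φ s η} := by rw [hA']; ext; simp
    rw [this]
    exact (Set.toFinite _).isOpen_biInter fun η _ => isOpen_lt continuous_const (hc η)
  have hne : A.Nonempty := by
    refine ⟨0, fun η hη => ?_⟩
    rw [harmonic_eq_one hw hμ hL (fun ζ hζ => ?_) (h1 0) hη]
    · exact zero_le_one
    · have := heig 0 ζ hζ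
      rwa [Real.exp_zero, h0, zero_mul] at this
  have huniv : A = Set.univ := IsClopen.eq_univ ⟨hcl, hop⟩ hne
  have : s ∈ A := huniv ▸ Set.mem_univ s
  rw [hA'] at this
  exact this η hη

/-- Positivity of the eigenfunctions is supplied by the continuity argument, so only a continuous
normalized family with `Λ 0 = 0` has to be exhibited. -/
lemma tendsto_scaledLogMGF {w μ : ℝ} (hw : 0 ≤ w) (hμ : 0 < μ) {L : ℕ} (hL : 2 ≤ L)
    {φ : ℝ → Config L → ℝ} {Λ : ℝ → ℝ} (hc : ∀ η, Continuous fun s => φ s η)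
    (h1 : ∀ s, φ s (fun _ => false) = 1)
    (heig : ∀ s, ∀ η ∈ evenSector L,
      tiltedGenerator w μ (Real.exp s) L (φ s) η = Λ s * φ s η) (h0 : Λ 0 = 0)
    (s : ℝ) {η : Config L} (hη : η ∈ evenSector L) :
    Tendsto (fun t => scaledLogMGF w μ L η s t) atTop (𝓝 (Λ s / L)) := by
  have : NeZero L := ⟨by omega⟩
  have h := tendsto_log_exp_smul_div
    (T := LinearMap.toContinuousLinearMap (tiltedGenerator w μ (Real.exp s) L))
    (S := evenSector L) (C := L * (μ + 2 * w))
    (tiltedGenerator_add_nonneg hw hμ (Real.exp_nonneg s) hL) (heig s)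
    (fun η hη => eigenfamily_pos hw hμ hL hc h1 heig h0 s hη) hη
    (N := L) (by exact_mod_cast (by omega : 0 < L))
  refine h.congr fun t => ?_
  unfold scaledLogMGF
  rw [activityMGF_eq_tsum hw hμ.le, ← (hasSum_exp_smul_apply _ t _ η).tsum_eq]
  rfl

/-! ### Jordan-Wigner fermions and the quadratic form of the generator -/

section Fermions

variable {L : ℕ} [NeZero L]

/-- The Jordan-Wigner fermion operators on site `j`: `fermi false j` annihilates and `fermi true j`
creates a particle. -/
def fermi (L : ℕ) [NeZero L] (b : Bool) (j : ℕ) : (Config L → ℂ) →L[ℂ] (Config L → ℂ) :=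
  LinearMap.toContinuousLinearMap
    { toFun := fun f η => if η (j : ZMod L) = b then parityString η j * f (flipSite η j) else 0
      map_add' := fun f g => by ext η; simp only [Pi.add_apply]; split_ifs <;> ring
      map_smul' := fun c f => by
        ext η; simp only [Pi.smul_apply, smul_eq_mul, RingHom.id_apply]; split_ifs <;> ring }

lemma fermi_apply (b : Bool) (j : ℕ) (f : Config L → ℂ) (η : Config L) :
    fermi L b j f η = if η (j : ZMod L) = b then parityString η j * f (flipSite η j) else 0 := rfl

/-- The string of the later site runs over the earlier one, so flipping site `i` reverses its sign,
whereas flipping site `j` does not affect the string of `i`. -/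
lemma fermi_anticomm_of_lt (b b' : Bool) {i j : ℕ} (hij : i < j) (hj : j < L) :
    fermi L b i * fermi L b' j + fermi L b' j * fermi L b i = 0 := by
  ext f η
  have hne : (i : ZMod L) ≠ j := by rw [Ne, natCast_zmod_inj (hij.trans hj) hj]; omega
  simp only [add_apply, mul_apply_eq_comp, Pi.add_apply, fermi_apply, zero_apply,
    Pi.zero_apply, flipSite_of_ne _ hne, flipSite_of_ne _ hne.symm,
    parityString_flipSite η (hij.trans hj) hj.le,
    parityString_flipSite η hj (hij.trans hj).le, if_pos hij, if_neg hij.not_gt,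
    flipSite_comm η (j : ZMod L) i]
  split_ifs <;> ring

lemma fermi_anticomm (b b' : Bool) {i j : ℕ} (hij : i ≠ j) (hi : i < L) (hj : j < L) :
    fermi L b i * fermi L b' j = - (fermi L b' j * fermi L b i) := by
  rcases lt_or_gt_of_ne hij with h | h
  · exact eq_neg_of_add_eq_zero_left (fermi_anticomm_of_lt b b' h hj)
  · rw [eq_neg_iff_add_eq_zero, add_comm]; exact fermi_anticomm_of_lt b' b h hi

lemma fermi_mul_self (b : Bool) (j : ℕ) : fermi L b j * fermi L b j = 0 := by
  ext f η
  simp only [mul_apply_eq_comp, fermi_apply, zero_apply, Pi.zero_apply, flipSite_same]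
  cases b <;> cases η (j : ZMod L) <;> simp

lemma fermi_mul_add (b : Bool) {j : ℕ} (hj : j < L) :
    fermi L b j * fermi L (!b) j + fermi L (!b) j * fermi L b j = 1 := by
  ext f η
  have h := parityString_mul_self η j
  simp only [add_apply, mul_apply_eq_comp, Pi.add_apply, fermi_apply,
    one_apply_eq_self, flipSite_same, parityString_flipSite η hj hj.le,
    flipSite_flipSite_same, lt_irrefl, if_false, one_mul]
  have : parityString η j * (parityString η j * f η) = f η := by rw [← mul_assoc, h, one_mul]
  cases b <;> cases η (j : ZMod L) <;> simp [this]

lemma create_mul_create {i j : ℕ} (hi : i < L) (hj : j < L) :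
    fermi L true i * fermi L true j = - (fermi L true j * fermi L true i) := by
  rcases eq_or_ne i j with rfl | h
  · rw [fermi_mul_self, neg_zero]
  · exact fermi_anticomm _ _ h hi hj

lemma annihilate_mul_create {i j : ℕ} (hi : i < L) (hj : j < L) :
    fermi L false i * fermi L true j
      = (if i = j then 1 else 0) - fermi L true j * fermi L false i := by
  rcases eq_or_ne i j with rfl | h
  · rw [if_pos rfl, ← fermi_mul_add false hi]; simp
  · rw [if_neg h, fermi_anticomm _ _ h hi hj, zero_sub]

lemma fermi_number_apply {j : ℕ} (hj : j < L) (f : Config L → ℂ) (η : Config L) :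
    (fermi L true j * fermi L false j) f η = (occ η j : ℂ) * f η := by
  have h := parityString_mul_self η j
  have : parityString η j * (parityString η j * f η) = f η := by rw [← mul_assoc, h, one_mul]
  simp only [mul_apply_eq_comp, fermi_apply, flipSite_same,
    parityString_flipSite η hj hj.le, flipSite_flipSite_same, lt_irrefl, if_false, one_mul, occ]
  cases η (j : ZMod L) <;> simp [this]

/-- The four bilinears flip a pair that is empty, full, or singly occupied on either side. The
hypothesis `2 q = p + r` makes their weights affine in the number of particles of the bond, as the
flip rates are; the strings of adjacent sites cancel up to the sign of site `j`. -/
lemma fermi_bond_apply (hL : 2 ≤ L) (p q r : ℂ) {j : ℕ} (hj : j + 1 < L) (f : Config L → ℂ)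
    (η : Config L) (hq : 2 * q = p + r) :
    (p • (fermi L false (j + 1) * fermi L false j) + r • (fermi L true j * fermi L true (j + 1))
      + q • (fermi L true j * fermi L false (j + 1) + fermi L true (j + 1) * fermi L false j)) f η
    = (p + (q - p) * ((occ η j : ℂ) + (occ η (j + 1) : ℂ))) * f (flipPair η j) := by
  have hj' : j < L := by omega
  have hne : (j : ZMod L) ≠ ((j + 1 : ℕ) : ZMod L) := by
    rw [Ne, natCast_zmod_inj hj' hj]; omega
  have hcast : (j : ZMod L) + 1 = ((j + 1 : ℕ) : ZMod L) := by push_cast; rfl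
  rw [flipPair_eq hL, hcast]
  have h := parityString_mul_self η j
  have hs := parityString_succ η j
  have hsj : ∀ x, parityString η j * (parityString η j * x) = x := fun x => by
    rw [← mul_assoc, h, one_mul]
  have hr : r = 2 * q - p := by rw [hq]; ring
  simp only [add_apply, smul_apply, mul_apply_eq_comp, Pi.add_apply, Pi.smul_apply,
    fermi_apply, smul_eq_mul, flipSite_of_ne _ hne, flipSite_of_ne _ hne.symm,
    parityString_flipSite η hj' hj.le,
    parityString_flipSite η hj hj'.le, lt_add_one, if_true, (show ¬ (j + 1 < j) by omega),
    if_false, flipSite_comm η ((j + 1 : ℕ) : ZMod L) j, hs, occ, hr]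
  cases η (j : ZMod L) <;> cases η ((j + 1 : ℕ) : ZMod L) <;> simp [hsj] <;>
    first | ring1 | (left; ring1)

/-- On the bond closing the torus the strings do not cancel but leave the parity of the sites before
the last one. In the even sector this is the sign of the last site, and the net effect is the global
minus sign of antiperiodic boundary conditions. -/
lemma fermi_boundary_apply (hL : 2 ≤ L) (p q r : ℂ) (f : Config L → ℂ)
    {η : Config L} (hη : η ∈ evenSector L) (hq : 2 * q = p + r) :
    (p • (fermi L false 0 * fermi L false (L - 1)) + r • (fermi L true (L - 1) * fermi L true 0)
      + q • (fermi L true (L - 1) * fermi L false 0 + fermi L true 0 * fermi L false (L - 1))) f η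
    = - ((p + (q - p) * ((occ η ((L - 1 : ℕ) : ZMod L) : ℂ)
        + (occ η (((L - 1 : ℕ) : ZMod L) + 1) : ℂ))) * f (flipPair η ((L - 1 : ℕ) : ZMod L))) := by
  have hj' : L - 1 < L := by omega
  have h0 : 0 < L := by omega
  have hne : ((L - 1 : ℕ) : ZMod L) ≠ ((0 : ℕ) : ZMod L) := by
    rw [Ne, natCast_zmod_inj hj' h0]; omega
  have hcast : ((L - 1 : ℕ) : ZMod L) + 1 = ((0 : ℕ) : ZMod L) := by
    rw [← Nat.cast_add_one, Nat.sub_add_cancel h0]; simp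
  rw [flipPair_eq hL, hcast]
  -- Total parity `1` determines the string before the last site.
  have hs : parityString η (L - 1) = if η ((L - 1 : ℕ) : ZMod L) then -1 else 1 := by
    have e : parityString η L = 1 := hη
    have e2 : parityString η ((L - 1) + 1) = 1 := by rw [Nat.sub_add_cancel h0]; exact e
    rw [parityString_succ] at e2
    split_ifs at e2 ⊢
    · linear_combination -e2
    · linear_combination e2
  have hz : parityString η 0 = 1 := by simp [parityString]
  have hz' : parityString (flipSite η ((L - 1 : ℕ) : ZMod L)) 0 = 1 := by simp [parityString]
  have hr : r = 2 * q - p := by rw [hq]; ring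
  simp only [add_apply, smul_apply, mul_apply_eq_comp, Pi.add_apply, Pi.smul_apply,
    fermi_apply, smul_eq_mul, flipSite_of_ne _ hne, flipSite_of_ne _ hne.symm,
    parityString_flipSite η h0 hj'.le, hz', (show 0 < L - 1 by omega), if_true,
    flipSite_comm η ((0 : ℕ) : ZMod L) ((L - 1 : ℕ) : ZMod L), hs, hz, occ, hr]
  cases η ((L - 1 : ℕ) : ZMod L) <;> cases η ((0 : ℕ) : ZMod L) <;> simp <;>
    first | ring1 | (left; ring1)

/-- The tilted generator on complex functions. -/
def complexTiltedGenerator (w μ u : ℝ) (L : ℕ) (f : Config L → ℂ) (η : Config L) : ℂ :=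
  ∑ k ∈ Finset.range L,
    (((μ : ℂ) + w * u * ((occ η k : ℂ) + (occ η (k + 1) : ℂ))) * f (flipPair η k)
      - ((μ : ℂ) + w * ((occ η k : ℂ) + (occ η (k + 1) : ℂ))) * f η)

/-- The rates are real, so the real part of a complex eigenfunction with real eigenvalue is again an
eigenfunction. -/
lemma tiltedGenerator_re (w μ u : ℝ) (L : ℕ) (f : Config L → ℂ) (η : Config L) :
    tiltedGenerator w μ u L (fun η => (f η).re) η = (complexTiltedGenerator w μ u L f η).re := by
  rw [tiltedGenerator_apply, complexTiltedGenerator, Complex.re_sum]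
  refine Finset.sum_congr rfl fun k _ => ?_
  have h1 : ((μ : ℂ) + w * u * ((occ η k : ℂ) + (occ η (k + 1) : ℂ)))
    = ((μ + w * u * ((occ η k : ℝ) + (occ η (k + 1) : ℝ)) : ℝ) : ℂ) := by push_cast; ring
  have h2 : ((μ : ℂ) + w * ((occ η k : ℂ) + (occ η (k + 1) : ℂ)))
    = ((μ + w * ((occ η k : ℝ) + (occ η (k + 1) : ℝ)) : ℝ) : ℂ) := by push_cast; ring
  rw [h1, h2, Complex.sub_re, Complex.re_ofReal_mul, Complex.re_ofReal_mul]

lemma sum_occ_succ {L : ℕ} (η : Config L) :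
    ∑ k ∈ Finset.range L, (occ η ((k : ZMod L) + 1) : ℂ) = ∑ k ∈ Finset.range L, (occ η k : ℂ) := by
  have h1 := Finset.sum_range_succ (fun k : ℕ => (occ η (k : ZMod L) : ℂ)) L
  have h2 := Finset.sum_range_succ' (fun k : ℕ => (occ η (k : ZMod L) : ℂ)) L
  rw [h1] at h2
  simp only [ZMod.natCast_self, Nat.cast_zero, Nat.cast_add, Nat.cast_one] at h2
  exact (add_right_cancel h2).symm

/-- On the even sector the tilted generator is an antiperiodic quadratic form in the fermions. -/
lemma complexTiltedGenerator_eq (hL : 2 ≤ L) (w μ u : ℝ) (f : Config L → ℂ)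
    {η : Config L} (hη : η ∈ evenSector L) {p q r : ℂ} (hp : p = μ) (hq : q = μ + w * u)
    (hr : r = μ + 2 * w * u) :
    complexTiltedGenerator w μ u L f η =
      (p • (∑ j ∈ Finset.range (L - 1), fermi L false (j + 1) * fermi L false j
          - fermi L false 0 * fermi L false (L - 1))
      + r • (∑ j ∈ Finset.range (L - 1), fermi L true j * fermi L true (j + 1)
          - fermi L true (L - 1) * fermi L true 0)
      + q • (∑ j ∈ Finset.range (L - 1), fermi L true j * fermi L false (j + 1)
          - fermi L true (L - 1) * fermi L false 0)
      + q • (∑ j ∈ Finset.range (L - 1), fermi L true (j + 1) * fermi L false j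
          - fermi L true 0 * fermi L false (L - 1))
      - (2 * w : ℂ) • (∑ j ∈ Finset.range L, fermi L true j * fermi L false j)
      - (L * μ : ℂ) • (1 : (Config L → ℂ) →L[ℂ] (Config L → ℂ))) f η := by
  have hq2 : 2 * q = p + r := by rw [hp, hq, hr]; ring
  have hqp : q - p = w * u := by rw [hp, hq]; ring
  have hnum : (∑ j ∈ Finset.range L, fermi L true j * fermi L false j) f η
      = (∑ k ∈ Finset.range L, (occ η k : ℂ)) * f η := by
    rw [sum_apply, Finset.sum_apply, Finset.sum_mul]
    exact Finset.sum_congr rfl fun j hj => fermi_number_apply (Finset.mem_range.mp hj) f η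
  have hbulk : ∑ k ∈ Finset.range L,
      (((μ : ℂ) + w * u * ((occ η k : ℂ) + (occ η (k + 1) : ℂ))) * f (flipPair η k))
      = (p • (∑ j ∈ Finset.range (L - 1), fermi L false (j + 1) * fermi L false j
          - fermi L false 0 * fermi L false (L - 1))
      + r • (∑ j ∈ Finset.range (L - 1), fermi L true j * fermi L true (j + 1)
          - fermi L true (L - 1) * fermi L true 0)
      + q • (∑ j ∈ Finset.range (L - 1), fermi L true j * fermi L false (j + 1)
          - fermi L true (L - 1) * fermi L false 0)
      + q • (∑ j ∈ Finset.range (L - 1), fermi L true (j + 1) * fermi L false j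
          - fermi L true 0 * fermi L false (L - 1))) f η := by
    have hsplit := Finset.sum_range_succ (fun k : ℕ =>
      (((μ : ℂ) + w * u * ((occ η k : ℂ) + (occ η (k + 1) : ℂ))) * f (flipPair η k))) (L - 1)
    rw [Nat.sub_add_cancel (by omega : 1 ≤ L)] at hsplit
    rw [hsplit]
    -- The bond `(L - 1, 0)` has the reversed sign, which matches the four subtracted bilinears.
    have hb := fermi_boundary_apply hL p q r f hη hq2
    rw [hqp, hp, ← neg_eq_iff_eq_neg] at hb
    rw [← hb]
    have hj : ∀ k ∈ Finset.range (L - 1),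
        (((μ : ℂ) + w * u * ((occ η k : ℂ) + (occ η (k + 1) : ℂ))) * f (flipPair η k))
        = (p • (fermi L false (k + 1) * fermi L false k)
          + r • (fermi L true k * fermi L true (k + 1))
          + q • (fermi L true k * fermi L false (k + 1)
            + fermi L true (k + 1) * fermi L false k)) f η := fun k hk => by
      have := fermi_bond_apply hL p q r (by have := Finset.mem_range.mp hk; omega) f η hq2 (j := k)
      rw [hqp] at this
      rw [← hp]
      exact this.symm
    rw [Finset.sum_congr rfl hj]
    simp only [add_apply, sub_apply, smul_apply, sum_apply, Pi.add_apply, Pi.sub_apply,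
      Pi.smul_apply, Finset.sum_apply, smul_eq_mul, Finset.sum_add_distrib, mul_add, ← Finset.mul_sum, hp]
    ring
  rw [sub_apply, sub_apply, Pi.sub_apply, Pi.sub_apply, ← hbulk, complexTiltedGenerator,
    Finset.sum_sub_distrib, smul_apply, smul_apply, Pi.smul_apply, Pi.smul_apply, hnum]
  simp only [add_mul, mul_add, Finset.sum_add_distrib, Finset.sum_const, Finset.card_range,
    ← Finset.mul_sum, ← Finset.sum_mul, sum_occ_succ, smul_eq_mul, nsmul_eq_mul,
    one_apply_eq_self]
  ring

end Fermions

set_option maxSynthPendingDepth 3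

/-! ### Fermionic Gaussian states -/

section GaussianState

variable {L : ℕ} [NeZero L]

open Classical in
/-- The Fock vacuum. -/
def vacuum (L : ℕ) : Config L → ℂ := fun η => if η = fun _ => false then 1 else 0

/-- The pair creation operator with antisymmetric amplitude `g`. -/
def pairing (L : ℕ) [NeZero L] (g : ℕ → ℕ → ℂ) : (Config L → ℂ) →L[ℂ] (Config L → ℂ) :=
  (1 / 2 : ℂ) • ∑ i ∈ Finset.range L, ∑ l ∈ Finset.range L,
    g i l • (fermi L true i * fermi L true l)

/-- The fermionic Gaussian (BCS) state with pair amplitude `g`. -/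
def gaussianState (L : ℕ) [NeZero L] (g : ℕ → ℕ → ℂ) : Config L → ℂ :=
  NormedSpace.exp (pairing L g) (vacuum L)

lemma annihilate_vacuum (j : ℕ) : fermi L false j (vacuum L) = 0 := by
  ext η
  rw [fermi_apply, Pi.zero_apply]
  split_ifs with h
  · have : flipSite η (j : ZMod L) ≠ fun _ => false := fun e => by
      have := congrFun e (j : ZMod L)
      rw [flipSite_same, h] at this
      simp at this
    simp [vacuum, this]
  · rfl

lemma pairing_apply_empty (g : ℕ → ℕ → ℂ) (f : Config L → ℂ) :
    pairing L g f (fun _ => false) = 0 := by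
  simp [pairing, sum_apply, mul_apply_eq_comp, fermi_apply]

/-- Every function in the range of the pair creation operator vanishes at the empty configuration,
so only the zeroth term of the exponential contributes there. -/
lemma gaussianState_empty (g : ℕ → ℕ → ℂ) : gaussianState L g (fun _ => false) = 1 := by
  have h := (hasSum_exp_apply (pairing L g) (vacuum L)).mapL
    (ContinuousLinearMap.proj (R := ℂ) (fun _ => false : Config L))
  refine h.unique ?_
  suffices HasSum (fun n : ℕ => ContinuousLinearMap.proj (R := ℂ) (φ := fun _ : Config L => ℂ)
      (fun _ => false : Config L) (((n.factorial : ℂ))⁻¹ • (pairing L g ^ n) (vacuum L)))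
      (ContinuousLinearMap.proj (R := ℂ) (φ := fun _ : Config L => ℂ) (fun _ => false : Config L)
      ((((Nat.factorial 0 : ℕ) : ℂ))⁻¹ • (pairing L g ^ 0) (vacuum L))) by
    simpa [vacuum] using this
  refine hasSum_single 0 fun n hn => ?_
  obtain ⟨k, rfl⟩ := Nat.exists_eq_succ_of_ne_zero hn
  rw [Nat.succ_eq_add_one, pow_succ', mul_apply_eq_comp]
  simp [pairing_apply_empty]

lemma continuous_gaussianState {g : ℝ → ℕ → ℕ → ℂ} (hg : ∀ i l, Continuous fun s => g s i l)
    (η : Config L) : Continuous fun s => gaussianState L (g s) η := by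
  have hc : Continuous fun s => pairing L (g s) := by
    unfold pairing
    have h : Continuous fun s => ∑ i ∈ Finset.range L, ∑ l ∈ Finset.range L,
        g s i l • (fermi L true i * fermi L true l) := continuous_finsetSum _ fun i _ =>
      continuous_finsetSum _ fun l _ => (hg i l).smul continuous_const
    exact h.const_smul (1 / 2 : ℂ)
  let _ : NormedAlgebra ℚ ((Config L → ℂ) →L[ℂ] (Config L → ℂ)) :=
    NormedAlgebra.restrictScalars ℚ ℂ _
  have he : Continuous fun s => NormedSpace.exp (pairing L (g s)) :=
    (NormedSpace.exp_continuous (𝔸 := (Config L → ℂ) →L[ℂ] (Config L → ℂ))).comp hc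
  exact (continuous_apply η).comp (he.clm_apply continuous_const)

/-- Moving the annihilator past two creators produces two contractions. They are equal because `g`
is antisymmetric, which compensates the factor `1 / 2` in the pairing. -/
lemma annihilate_mul_pairing {g : ℕ → ℕ → ℂ} (hg : ∀ i < L, ∀ l < L, g l i = - g i l)
    {j : ℕ} (hj : j < L) :
    fermi L false j * pairing L g = pairing L g * fermi L false j
      + ∑ l ∈ Finset.range L, g j l • fermi L true l := by
  have hterm : ∀ i ∈ Finset.range L, ∀ l ∈ Finset.range L,
      fermi L false j * (g i l • (fermi L true i * fermi L true l))
      = g i l • (fermi L true i * fermi L true l) * fermi L false j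
        + ((if j = i then g j l • fermi L true l else 0)
          + (if j = l then g j i • fermi L true i else 0)) := by
    intro i hi l hl
    rw [Finset.mem_range] at hi hl
    have h1 : fermi L false j * (fermi L true i * fermi L true l)
        = (if j = i then fermi L true l else 0) - (if j = l then fermi L true i else 0)
          + fermi L true i * fermi L true l * fermi L false j := by
      rw [← mul_assoc, annihilate_mul_create hj hi, sub_mul, mul_assoc (fermi L true i),
        annihilate_mul_create hj hl, mul_sub, ← mul_assoc]
      split_ifs <;> simp <;> abel
    rw [mul_smul_comm, h1, smul_mul_assoc, smul_add, smul_sub]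
    have h2 : g i l • (if j = i then fermi L true l else 0)
        = if j = i then g j l • fermi L true l else 0 := by
      split_ifs with h
      · rw [h]
      · simp
    have h3 : g i l • (if j = l then fermi L true i else 0)
        = - if j = l then g j i • fermi L true i else 0 := by
      split_ifs with h
      · rw [h, hg i hi l hl, neg_smul, neg_neg]
      · simp
    rw [h2, h3]; abel
  unfold pairing
  rw [mul_smul_comm, smul_mul_assoc, Finset.mul_sum, Finset.sum_mul]
  simp only [Finset.mul_sum, Finset.sum_mul]
  rw [Finset.sum_congr rfl fun i hi => Finset.sum_congr rfl (hterm i hi)]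
  simp only [Finset.sum_add_distrib]
  have e1 : ∑ i ∈ Finset.range L, ∑ l ∈ Finset.range L,
      (if j = i then g j l • fermi L true l else 0)
      = ∑ l ∈ Finset.range L, g j l • fermi L true l := by
    rw [Finset.sum_comm]
    exact Finset.sum_congr rfl fun l _ => by simp [hj]
  have e2 : ∑ i ∈ Finset.range L, ∑ l ∈ Finset.range L,
      (if j = l then g j i • fermi L true i else 0)
      = ∑ l ∈ Finset.range L, g j l • fermi L true l :=
    Finset.sum_congr rfl fun l _ => by simp [hj]
  rw [e1, e2, smul_add, ← two_smul ℂ (∑ l ∈ Finset.range L, g j l • fermi L true l), smul_smul]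
  norm_num

lemma commute_create_pairing (g : ℕ → ℕ → ℂ) {j : ℕ} (hj : j < L) :
    Commute (fermi L true j) (pairing L g) := by
  unfold pairing
  refine Commute.smul_right (Commute.sum_right _ _ _ fun i hi => Commute.sum_right _ _ _
    fun l hl => Commute.smul_right ?_ _) _
  rw [Finset.mem_range] at hi hl
  unfold Commute SemiconjBy
  rw [← mul_assoc, create_mul_create hj hi, neg_mul, mul_assoc, create_mul_create hj hl, mul_neg,
    neg_neg, mul_assoc]

/-- The commutator `D` of the annihilator with `Q` commutes with `Q`, and the annihilator kills the
vacuum. Hence it sends `Q ^ (n + 1) |0>` to `(n + 1) D Q ^ n |0>`, and summing with the factorials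
gives `D exp Q |0>`. -/
lemma annihilate_gaussianState {g : ℕ → ℕ → ℂ} (hg : ∀ i < L, ∀ l < L, g l i = - g i l)
    {j : ℕ} (hj : j < L) :
    fermi L false j (gaussianState L g)
      = ∑ l ∈ Finset.range L, g j l • fermi L true l (gaussianState L g) := by
  set a := fermi L false j
  set Q := pairing L g
  set D : (Config L → ℂ) →L[ℂ] (Config L → ℂ) := ∑ l ∈ Finset.range L, g j l • fermi L true l
    with hD
  have hcomm : Commute D Q := Commute.sum_left _ _ _ fun l hl =>
    Commute.smul_left (commute_create_pairing g (Finset.mem_range.mp hl)) _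
  have haQ : a * Q = Q * a + D := annihilate_mul_pairing hg hj
  have hpow : ∀ n : ℕ, a ((Q ^ (n + 1)) (vacuum L)) = ((n : ℂ) + 1) • D ((Q ^ n) (vacuum L)) := by
    intro n
    have hstep : ∀ v, a (Q v) = Q (a v) + D v := fun v => by
      have := congrArg (fun T : (Config L → ℂ) →L[ℂ] (Config L → ℂ) => T v) haQ
      simpa [mul_apply_eq_comp] using this
    have hDQ : ∀ v, D (Q v) = Q (D v) := fun v =>
      congrArg (fun T : (Config L → ℂ) →L[ℂ] (Config L → ℂ) => T v) hcomm.eq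
    induction n with
    | zero =>
      have h0 : a (vacuum L) = 0 := annihilate_vacuum j
      simp [hstep, h0]
    | succ n ih =>
      rw [pow_succ', mul_apply_eq_comp, hstep, ih, map_smul, ← hDQ, ← mul_apply_eq_comp Q,
        ← pow_succ']
      push_cast
      module
  have h1 := hasSum_exp_apply Q (vacuum L)
  have h2 := h1.mapL a
  have h3 := h1.mapL D
  have h4 : HasSum (fun n : ℕ => a (((n.factorial : ℂ)⁻¹) • (Q ^ n) (vacuum L)))
      (D (NormedSpace.exp Q (vacuum L))) := by
    -- The zeroth term is killed, so the series may start at index one; the factor `n + 1` then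
    -- lowers the factorial.
    rw [← hasSum_nat_add_iff' 1]
    have h0 : a (vacuum L) = 0 := annihilate_vacuum j
    simp only [Finset.range_one, Finset.sum_singleton, pow_zero, one_apply_eq_self, map_smul, h0,
      smul_zero, sub_zero]
    refine Eq.subst (motive := fun f => HasSum f _) (funext fun n => ?_) h3
    rw [map_smul, hpow, smul_smul, Nat.factorial_succ]
    congr 1
    push_cast
    have : (n : ℂ) + 1 ≠ 0 := by exact_mod_cast Nat.succ_ne_zero n
    field_simp
  have h5 := h2.unique h4
  have h6 : D (gaussianState L g)
      = ∑ l ∈ Finset.range L, g j l • fermi L true l (gaussianState L g) := by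
    rw [hD, sum_apply]; rfl
  rw [← h6]; exact h5

end GaussianState

/-! ### Antiperiodic Fourier modes -/

section Fourier

/-- The wave number of an antiperiodic mode. -/
def waveNumber (L m : ℕ) : ℝ := (2 * m + 1) * Real.pi / L

/-- The phase of an antiperiodic mode. -/
def phase (L m : ℕ) : ℂ := Complex.exp (waveNumber L m * Complex.I)

lemma phase_ne_zero (L m : ℕ) : phase L m ≠ 0 := Complex.exp_ne_zero _

lemma phase_eq_cos_add_sin (L m : ℕ) :
    phase L m = Real.cos (waveNumber L m) + Real.sin (waveNumber L m) * Complex.I := by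
  rw [phase, Complex.exp_mul_I]; push_cast; rfl

lemma phase_inv_eq_cos_sub_sin (L m : ℕ) :
    (phase L m)⁻¹ = Real.cos (waveNumber L m) - Real.sin (waveNumber L m) * Complex.I := by
  rw [phase, ← Complex.exp_neg, ← neg_mul, Complex.exp_mul_I, Complex.cos_neg, Complex.sin_neg]
  push_cast; ring

/-- The index reflection `m ↦ L - 1 - m` is `k ↦ -k` modulo `2 π`; it pairs the momenta throughout.
-/
lemma waveNumber_reflect {L m : ℕ} (hm : m < L) :
    waveNumber L (L - 1 - m) = 2 * Real.pi - waveNumber L m := by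
  have hL : (L : ℝ) ≠ 0 := by exact_mod_cast (by omega : L ≠ 0)
  have : ((L - 1 - m : ℕ) : ℝ) = L - 1 - m := by
    rw [Nat.sub_sub, Nat.cast_sub (by omega)]; push_cast; ring
  unfold waveNumber
  rw [this]; field_simp; ring

lemma phase_reflect {L m : ℕ} (hm : m < L) : phase L (L - 1 - m) = (phase L m)⁻¹ := by
  rw [phase_eq_cos_add_sin, phase_inv_eq_cos_sub_sin, waveNumber_reflect hm, Real.cos_two_pi_sub,
    Real.sin_two_pi_sub]
  push_cast; ring

/-- The primitive root of unity generating the phases. -/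
def rootOfUnity (L : ℕ) : ℂ := Complex.exp (2 * Real.pi * Complex.I / L)

lemma phase_eq {L : ℕ} (hL : L ≠ 0) (m : ℕ) : phase L m = phase L 0 * rootOfUnity L ^ m := by
  have : (L : ℂ) ≠ 0 := by exact_mod_cast hL
  rw [phase, phase, rootOfUnity, ← Complex.exp_nat_mul, ← Complex.exp_add]
  congr 1
  unfold waveNumber
  push_cast
  field_simp
  ring

lemma phase_zero_pow {L : ℕ} (hL : L ≠ 0) : phase L 0 ^ L = -1 := by
  have : (L : ℂ) ≠ 0 := by exact_mod_cast hL
  rw [phase, ← Complex.exp_nat_mul, ← Complex.exp_pi_mul_I]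
  congr 1
  unfold waveNumber
  push_cast
  field_simp
  ring

lemma sum_rootOfUnity_zpow {L : ℕ} (hL : L ≠ 0) (d : ℤ) :
    ∑ j ∈ Finset.range L, (rootOfUnity L ^ d) ^ j = if (L : ℤ) ∣ d then (L : ℂ) else 0 := by
  have hprim : IsPrimitiveRoot (rootOfUnity L) L := Complex.isPrimitiveRoot_exp L hL
  split_ifs with h
  · rw [(hprim.zpow_eq_one_iff_dvd d).mpr h]; simp
  · have hne : rootOfUnity L ^ d ≠ 1 := fun e => h ((hprim.zpow_eq_one_iff_dvd d).mp e)
    rw [geom_sum_eq hne, ← zpow_natCast, ← zpow_mul, mul_comm, zpow_mul, zpow_natCast,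
      hprim.pow_eq_one, one_zpow, sub_self, zero_div]

lemma sum_phase_zpow {L : ℕ} (hL : L ≠ 0) (d : ℤ) :
    ∑ m ∈ Finset.range L, phase L m ^ d = if (L : ℤ) ∣ d then phase L 0 ^ d * L else 0 := by
  have : ∀ m ∈ Finset.range L, phase L m ^ d = phase L 0 ^ d * (rootOfUnity L ^ d) ^ m := by
    intro m _
    rw [phase_eq hL, mul_zpow, ← zpow_natCast, ← zpow_natCast, ← zpow_mul, ← zpow_mul, mul_comm d]
  rw [Finset.sum_congr rfl this, ← Finset.mul_sum, sum_rootOfUnity_zpow hL]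
  split_ifs <;> simp

lemma sum_phase_pow_mul_inv_pow {L : ℕ} (hL : L ≠ 0) {j l : ℕ} (hj : j < L) (hl : l < L) :
    ∑ m ∈ Finset.range L, phase L m ^ j * (phase L m)⁻¹ ^ l = if j = l then (L : ℂ) else 0 := by
  have e : ∀ m ∈ Finset.range L,
      phase L m ^ j * (phase L m)⁻¹ ^ l = phase L m ^ ((j : ℤ) - l) := fun m _ => by
    rw [zpow_sub₀ (phase_ne_zero L m), zpow_natCast, zpow_natCast, inv_pow, div_eq_mul_inv]
  rw [Finset.sum_congr rfl e, sum_phase_zpow hL]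
  by_cases h : j = l
  · simp [h]
  · have : ¬ (L : ℤ) ∣ (j : ℤ) - l := by
      intro hd
      have := Int.eq_zero_of_abs_lt_dvd hd (by rw [abs_lt]; constructor <;> omega)
      omega
    rw [if_neg this, if_neg h]

/-- The exponent `j + 1 - l` is a multiple of `L` only if it is `0` or `L`. The second case occurs
for `j = L - 1`, `l = 0`, and its sign comes from `phase L 0 ^ L = -1`. -/
lemma sum_phase_mul_pow_mul_inv_pow {L : ℕ} (hL : L ≠ 0) {j l : ℕ} (hj : j < L) (hl : l < L) :
    ∑ m ∈ Finset.range L, phase L m * (phase L m ^ j * (phase L m)⁻¹ ^ l)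
      = if j + 1 = L then (if l = 0 then -(L : ℂ) else 0) else
        (if j + 1 = l then (L : ℂ) else 0) := by
  have e : ∀ m ∈ Finset.range L,
      phase L m * (phase L m ^ j * (phase L m)⁻¹ ^ l) = phase L m ^ ((j : ℤ) + 1 - l) :=
    fun m _ => by
      rw [zpow_sub₀ (phase_ne_zero L m), zpow_add₀ (phase_ne_zero L m), zpow_natCast, zpow_natCast,
        inv_pow, div_eq_mul_inv, zpow_one]; ring
  rw [Finset.sum_congr rfl e, sum_phase_zpow hL]
  by_cases h : j + 1 = L
  · rw [if_pos h]
    by_cases h0 : l = 0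
    · have : (j : ℤ) + 1 - l = (L : ℤ) := by omega
      rw [this, if_pos dvd_rfl, if_pos h0, zpow_natCast, phase_zero_pow hL]; ring
    · have : ¬ (L : ℤ) ∣ (j : ℤ) + 1 - l := by
        intro hd
        have := Int.eq_zero_of_abs_lt_dvd hd (by rw [abs_lt]; constructor <;> omega)
        omega
      rw [if_neg this, if_neg h0]
  · rw [if_neg h]
    by_cases h0 : j + 1 = l
    · have : (j : ℤ) + 1 - l = 0 := by omega
      rw [this, if_pos h0]; simp
    · have : ¬ (L : ℤ) ∣ (j : ℤ) + 1 - l := by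
        intro hd
        have := Int.eq_zero_of_abs_lt_dvd hd (by rw [abs_lt]; constructor <;> omega)
        omega
      rw [if_neg this, if_neg h0]

lemma sum_phase_orthogonal {L : ℕ} (hL : L ≠ 0) {m n : ℕ} (hm : m < L) (hn : n < L) :
    ∑ j ∈ Finset.range L, (phase L n)⁻¹ ^ j * phase L m ^ j = if m = n then (L : ℂ) else 0 := by
  have e : ∀ j ∈ Finset.range L, (phase L n)⁻¹ ^ j * phase L m ^ j
      = (rootOfUnity L ^ ((m : ℤ) - n)) ^ j := fun j _ => by
    have h0 := phase_ne_zero L 0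
    have h1 : rootOfUnity L ≠ 0 := Complex.exp_ne_zero _
    rw [← mul_pow, phase_eq hL m, phase_eq hL n, zpow_sub₀ h1, zpow_natCast, zpow_natCast]
    congr 1
    field_simp
  rw [Finset.sum_congr rfl e, sum_rootOfUnity_zpow hL]
  by_cases h : m = n
  · simp [h]
  · have : ¬ (L : ℤ) ∣ (m : ℤ) - n := by
      intro hd
      have := Int.eq_zero_of_abs_lt_dvd hd (by rw [abs_lt]; constructor <;> omega)
      omega
    rw [if_neg this, if_neg h]

lemma sum_phase_smul_diag {L : ℕ} (hL : L ≠ 0) {M : Type*} [AddCommGroup M] [Module ℂ M]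
    (F : ℕ → ℕ → M) :
    ∑ m ∈ Finset.range L, ∑ j ∈ Finset.range L, ∑ l ∈ Finset.range L,
      (phase L m ^ j * (phase L m)⁻¹ ^ l) • F j l
    = (L : ℂ) • ∑ j ∈ Finset.range L, F j j := by
  rw [Finset.sum_comm, Finset.smul_sum]
  refine Finset.sum_congr rfl fun j hj => ?_
  rw [Finset.sum_comm]
  simp only [← Finset.sum_smul]
  rw [Finset.sum_congr rfl fun l hl => by
    rw [sum_phase_pow_mul_inv_pow hL (Finset.mem_range.mp hj) (Finset.mem_range.mp hl)]]
  simp [Finset.mem_range.mp hj]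

/-- A factor of the phase in momentum space is a translation by one site, which changes sign when it
wraps around the torus. This is how the nearest-neighbour bilinears are rewritten in modes. -/
lemma sum_phase_smul_shift {L : ℕ} (hL : L ≠ 0) {M : Type*} [AddCommGroup M] [Module ℂ M]
    (F : ℕ → ℕ → M) :
    ∑ m ∈ Finset.range L, phase L m • ∑ j ∈ Finset.range L, ∑ l ∈ Finset.range L,
      (phase L m ^ j * (phase L m)⁻¹ ^ l) • F j l
    = (L : ℂ) • (∑ j ∈ Finset.range (L - 1), F j (j + 1) - F (L - 1) 0) := by
  have h1 : ∀ j ∈ Finset.range L, ∑ m ∈ Finset.range L, ∑ l ∈ Finset.range L,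
      (phase L m * (phase L m ^ j * (phase L m)⁻¹ ^ l)) • F j l
      = if j + 1 = L then -((L : ℂ) • F j 0) else (L : ℂ) • F j (j + 1) := by
    intro j hj
    rw [Finset.mem_range] at hj
    rw [Finset.sum_comm]
    simp only [← Finset.sum_smul]
    rw [Finset.sum_congr rfl fun l hl => by
      rw [sum_phase_mul_pow_mul_inv_pow hL hj (Finset.mem_range.mp hl)]]
    by_cases h : j + 1 = L
    · simp [h, Nat.pos_of_ne_zero hL]
    · have : j + 1 < L := by omega
      simp [h, this]
  simp only [Finset.smul_sum, smul_smul]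
  rw [Finset.sum_comm, Finset.sum_congr rfl h1]
  have hLs : L = (L - 1) + 1 := by omega
  have h2 := Finset.sum_range_succ
    (fun j => if j + 1 = L then -((L : ℂ) • F j 0) else (L : ℂ) • F j (j + 1)) (L - 1)
  rw [← hLs] at h2
  rw [h2, if_pos rfl, smul_sub, Finset.smul_sum, ← sub_eq_add_neg]
  congr 1
  refine Finset.sum_congr rfl fun j hj => ?_
  rw [Finset.mem_range] at hj
  rw [if_neg (by omega)]

end Fourier

/-! ### Mode operators and the Riccati equation -/

section Modes

variable {L : ℕ} [NeZero L]

/-- Creation (`b = true`) or annihilation (`b = false`) operator with amplitude `z ^ j` at `j`. -/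
def modeOp (L : ℕ) [NeZero L] (b : Bool) (z : ℂ) : (Config L → ℂ) →L[ℂ] (Config L → ℂ) :=
  ∑ j ∈ Finset.range L, z ^ j • fermi L b j

lemma modeOp_apply (b : Bool) (z : ℂ) (f : Config L → ℂ) :
    modeOp L b z f = ∑ j ∈ Finset.range L, z ^ j • fermi L b j f := by
  rw [modeOp, sum_apply]; rfl

lemma modeOp_mul_modeOp (b b' : Bool) (z z' : ℂ) :
    modeOp L b z * modeOp L b' z' = ∑ j ∈ Finset.range L, ∑ l ∈ Finset.range L,
      (z ^ j * z' ^ l) • (fermi L b j * fermi L b' l) := by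
  unfold modeOp
  rw [Finset.sum_mul_sum]
  exact Finset.sum_congr rfl fun j _ => Finset.sum_congr rfl fun l _ => by
    rw [smul_mul_smul_comm]

lemma create_mode_anticomm (z z' : ℂ) :
    modeOp L true z * modeOp L true z' = - (modeOp L true z' * modeOp L true z) := by
  rw [modeOp_mul_modeOp, modeOp_mul_modeOp, Finset.sum_comm]
  simp only [← Finset.sum_neg_distrib]
  refine Finset.sum_congr rfl fun j hj => Finset.sum_congr rfl fun l hl => ?_
  rw [create_mul_create (Finset.mem_range.mp hl) (Finset.mem_range.mp hj), smul_neg, mul_comm]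

lemma annihilate_mul_create_mode {z : ℂ} (hz : z ≠ 0) :
    modeOp L false z⁻¹ * modeOp L true z
      = (L : ℂ) • (1 : (Config L → ℂ) →L[ℂ] (Config L → ℂ))
        - modeOp L true z * modeOp L false z⁻¹ := by
  rw [modeOp_mul_modeOp, modeOp_mul_modeOp,
    Finset.sum_comm (f := fun j l => (z ^ j * z⁻¹ ^ l) • (fermi L true j * fermi L false l))]
  have h : ∀ j ∈ Finset.range L, ∑ l ∈ Finset.range L,
      (z⁻¹ ^ j * z ^ l) • (fermi L false j * fermi L true l)
      = 1 - ∑ l ∈ Finset.range L, (z ^ l * z⁻¹ ^ j) • (fermi L true l * fermi L false j) := by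
    intro j hj
    have h2 : ∀ l ∈ Finset.range L, (z⁻¹ ^ j * z ^ l) • (fermi L false j * fermi L true l)
        = (if j = l then 1 else 0) - (z ^ l * z⁻¹ ^ j) • (fermi L true l * fermi L false j) := by
      intro l hl
      rw [annihilate_mul_create (Finset.mem_range.mp hj) (Finset.mem_range.mp hl), smul_sub,
        mul_comm (z ^ l)]
      congr 1
      split_ifs with h
      · rw [h, ← mul_pow, inv_mul_cancel₀ hz, one_pow, one_smul]
      · rw [smul_zero]
    rw [Finset.sum_congr rfl h2, Finset.sum_sub_distrib]
    simp [Finset.mem_range.mp hj]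
  rw [Finset.sum_congr rfl h, Finset.sum_sub_distrib, Finset.sum_const, Finset.card_range,
    Nat.cast_smul_eq_nsmul ℂ]

/-- The translation-invariant antiperiodic amplitude with Fourier coefficients `σ`. -/
def fourierAmplitude (L : ℕ) (σ : ℕ → ℂ) (j l : ℕ) : ℂ :=
  (L : ℂ)⁻¹ * ∑ m ∈ Finset.range L, σ m * (phase L m ^ j * (phase L m)⁻¹ ^ l)

/-- Reflecting the momentum exchanges the roles of the two sites and reverses the sign of an odd
coefficient. -/
lemma fourierAmplitude_antisymm {N : ℕ} {σ : ℕ → ℂ} (hσ : ∀ m < N, σ (N - 1 - m) = - σ m)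
    (i l : ℕ) : fourierAmplitude N σ l i = - fourierAmplitude N σ i l := by
  unfold fourierAmplitude
  rw [← mul_neg, ← Finset.sum_neg_distrib, ← Finset.sum_range_reflect]
  congr 1
  refine Finset.sum_congr rfl fun m hm => ?_
  rw [Finset.mem_range] at hm
  rw [hσ m hm, phase_reflect hm, inv_inv]; ring

/-- The linear relation of `annihilate_gaussianState` is a convolution, so it becomes diagonal in
the modes by orthogonality of the phases. -/
lemma annihilate_mode_gaussianState {σ : ℕ → ℂ} (hσ : ∀ m < L, σ (L - 1 - m) = - σ m) {n : ℕ}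
    (hn : n < L) :
    modeOp L false (phase L n)⁻¹ (gaussianState L (fourierAmplitude L σ))
      = σ n • modeOp L true (phase L n)⁻¹ (gaussianState L (fourierAmplitude L σ)) := by
  have hL : L ≠ 0 := NeZero.ne L
  have hLc : (L : ℂ) ≠ 0 := by exact_mod_cast hL
  rw [modeOp_apply, modeOp_apply, Finset.smul_sum]
  have h1 : ∀ j ∈ Finset.range L, (phase L n)⁻¹ ^ j •
      fermi L false j (gaussianState L (fourierAmplitude L σ))
      = ∑ l ∈ Finset.range L, ((phase L n)⁻¹ ^ j * fourierAmplitude L σ j l) •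
        fermi L true l (gaussianState L (fourierAmplitude L σ)) := by
    intro j hj
    rw [annihilate_gaussianState (fun i _ l _ => fourierAmplitude_antisymm hσ i l)
      (Finset.mem_range.mp hj), Finset.smul_sum]
    exact Finset.sum_congr rfl fun l _ => smul_smul _ _ _
  rw [Finset.sum_congr rfl h1, Finset.sum_comm]
  refine Finset.sum_congr rfl fun l _ => ?_
  rw [← Finset.sum_smul, smul_smul]
  congr 1
  calc ∑ j ∈ Finset.range L, (phase L n)⁻¹ ^ j * fourierAmplitude L σ j l
      = (L : ℂ)⁻¹ * ∑ m ∈ Finset.range L, σ m * (phase L m)⁻¹ ^ l *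
          ∑ j ∈ Finset.range L, (phase L n)⁻¹ ^ j * phase L m ^ j := by
        unfold fourierAmplitude
        simp only [Finset.mul_sum]
        rw [Finset.sum_comm]
        exact Finset.sum_congr rfl fun m _ => Finset.sum_congr rfl fun j _ => by ring
    _ = (L : ℂ)⁻¹ * ∑ m ∈ Finset.range L, σ m * (phase L m)⁻¹ ^ l *
          (if m = n then (L : ℂ) else 0) := by
        congr 1
        exact Finset.sum_congr rfl fun m hm => by
          rw [sum_phase_orthogonal hL (Finset.mem_range.mp hm) hn]
    _ = σ n * (phase L n)⁻¹ ^ l := by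
        simp only [mul_ite, mul_zero, Finset.sum_ite_eq', Finset.mem_range, hn, if_true]
        field_simp

lemma annihilate_mode_gaussianState' {σ : ℕ → ℂ} (hσ : ∀ m < L, σ (L - 1 - m) = - σ m) {n : ℕ}
    (hn : n < L) :
    modeOp L false (phase L n) (gaussianState L (fourierAmplitude L σ))
      = - σ n • modeOp L true (phase L n) (gaussianState L (fourierAmplitude L σ)) := by
  have h := annihilate_mode_gaussianState hσ (show L - 1 - n < L by omega)
  rwa [phase_reflect hn, inv_inv, hσ n hn] at h

/-- A Gaussian state whose Fourier coefficients solve the Riccati equation is an eigenfunction of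
the tilted generator on the even sector. -/
lemma complexTiltedGenerator_gaussianState (hL : 2 ≤ L) {w μ u : ℝ} {p q r : ℂ} (hp : p = μ)
    (hq : q = μ + w * u) (hr : r = μ + 2 * w * u) {σ : ℕ → ℂ}
    (hσ : ∀ m < L, σ (L - 1 - m) = - σ m)
    (hric : ∀ m < L, phase L m * (p * σ m ^ 2 + r + 2 * q * σ m) - 2 * w * σ m
      = (phase L m)⁻¹ * (p * σ m ^ 2 + r - 2 * q * σ m) + 2 * w * σ m)
    {η : Config L} (hη : η ∈ evenSector L) :
    complexTiltedGenerator w μ u L (gaussianState L (fourierAmplitude L σ)) η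
      = (- p * ∑ m ∈ Finset.range L, phase L m * σ m - L * μ)
        * gaussianState L (fourierAmplitude L σ) η := by
  have hL0 : L ≠ 0 := by omega
  have hLc : (L : ℂ) ≠ 0 := by exact_mod_cast hL0
  set ψ := gaussianState L (fourierAmplitude L σ) with hψ
  rw [complexTiltedGenerator_eq hL w μ u ψ hη hp hq hr]
  set X1 := ∑ j ∈ Finset.range (L - 1), fermi L false (j + 1) * fermi L false j
    - fermi L false 0 * fermi L false (L - 1) with hX1
  set X2 := ∑ j ∈ Finset.range (L - 1), fermi L true j * fermi L true (j + 1)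
    - fermi L true (L - 1) * fermi L true 0 with hX2
  set X3 := ∑ j ∈ Finset.range (L - 1), fermi L true j * fermi L false (j + 1)
    - fermi L true (L - 1) * fermi L false 0 with hX3
  set X4 := ∑ j ∈ Finset.range (L - 1), fermi L true (j + 1) * fermi L false j
    - fermi L true 0 * fermi L false (L - 1) with hX4
  set N := ∑ j ∈ Finset.range L, fermi L true j * fermi L false j with hN
  have e1 : (L : ℂ) • X1 = ∑ m ∈ Finset.range L,
      phase L m • (modeOp L false (phase L m)⁻¹ * modeOp L false (phase L m)) := by
    rw [hX1, ← sum_phase_smul_shift hL0 (fun j l => fermi L false l * fermi L false j)]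
    refine Finset.sum_congr rfl fun m _ => ?_
    rw [modeOp_mul_modeOp, Finset.sum_comm]
    simp only [mul_comm]
  have e2 : (L : ℂ) • X2 = ∑ m ∈ Finset.range L,
      phase L m • (modeOp L true (phase L m) * modeOp L true (phase L m)⁻¹) := by
    rw [hX2, ← sum_phase_smul_shift hL0 (fun j l => fermi L true j * fermi L true l)]
    exact Finset.sum_congr rfl fun m _ => by rw [modeOp_mul_modeOp]
  have e3 : (L : ℂ) • X3 = ∑ m ∈ Finset.range L,
      phase L m • (modeOp L true (phase L m) * modeOp L false (phase L m)⁻¹) := by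
    rw [hX3, ← sum_phase_smul_shift hL0 (fun j l => fermi L true j * fermi L false l)]
    exact Finset.sum_congr rfl fun m _ => by rw [modeOp_mul_modeOp]
  have e4 : (L : ℂ) • X4 = ∑ m ∈ Finset.range L,
      phase L m • (modeOp L true (phase L m)⁻¹ * modeOp L false (phase L m)) := by
    rw [hX4, ← sum_phase_smul_shift hL0 (fun j l => fermi L true l * fermi L false j)]
    refine Finset.sum_congr rfl fun m _ => ?_
    rw [modeOp_mul_modeOp, Finset.sum_comm]
    simp only [mul_comm]
  have eN : (L : ℂ) • N = ∑ m ∈ Finset.range L,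
      modeOp L true (phase L m) * modeOp L false (phase L m)⁻¹ := by
    rw [hN, ← sum_phase_smul_diag hL0 (fun j l => fermi L true j * fermi L false l)]
    exact Finset.sum_congr rfl fun m _ => by rw [modeOp_mul_modeOp]
  -- The state with an additional pair of opposite momenta. Every bilinear applied to `ψ` reduces to
  -- `P m` and `ψ`.
  set P : ℕ → Config L → ℂ := fun m =>
    modeOp L true (phase L m) (modeOp L true (phase L m)⁻¹ ψ) with hP
  have hPr : ∀ m < L, P (L - 1 - m) = - P m := by
    intro m hm
    simp only [hP]
    rw [phase_reflect hm, inv_inv, ← mul_apply_eq_comp, create_mode_anticomm, neg_apply,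
      mul_apply_eq_comp]
  -- The annihilators are traded for creators by means of the Gaussian relations. Only the product
  -- of two annihilators leaves a contraction, of size `L`, and this contributes the multiple of
  -- `ψ`.
  have hmode : ∀ m ∈ Finset.range L,
      (p • phase L m • (modeOp L false (phase L m)⁻¹ * modeOp L false (phase L m))
      + r • phase L m • (modeOp L true (phase L m) * modeOp L true (phase L m)⁻¹)
      + q • phase L m • (modeOp L true (phase L m) * modeOp L false (phase L m)⁻¹)
      + q • phase L m • (modeOp L true (phase L m)⁻¹ * modeOp L false (phase L m))
      - (2 * w : ℂ) • (modeOp L true (phase L m) * modeOp L false (phase L m)⁻¹)) ψ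
      = (phase L m * (p * σ m ^ 2 + r + 2 * q * σ m) - 2 * w * σ m) • P m
        + (- (p * L) * (phase L m * σ m)) • ψ := by
    intro m hm
    rw [Finset.mem_range] at hm
    have ha := annihilate_mode_gaussianState hσ hm
    have ha' := annihilate_mode_gaussianState' hσ hm
    rw [← hψ] at ha ha'
    have h3 : (modeOp L true (phase L m) * modeOp L false (phase L m)⁻¹) ψ = σ m • P m := by
      rw [mul_apply_eq_comp, ha, map_smul]
    have h4 : (modeOp L true (phase L m)⁻¹ * modeOp L false (phase L m)) ψ = σ m • P m := by
      rw [mul_apply_eq_comp, ha', map_smul, ← mul_apply_eq_comp, create_mode_anticomm, neg_apply,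
        mul_apply_eq_comp, smul_neg, neg_smul, neg_neg]
    have h1 : (modeOp L false (phase L m)⁻¹ * modeOp L false (phase L m)) ψ
        = (σ m ^ 2) • P m - (L * σ m) • ψ := by
      rw [mul_apply_eq_comp, ha', map_smul, ← mul_apply_eq_comp,
        annihilate_mul_create_mode (phase_ne_zero L m), sub_apply, h3, smul_apply,
        one_apply_eq_self]
      module
    have h2 : (modeOp L true (phase L m) * modeOp L true (phase L m)⁻¹) ψ = P m := rfl
    simp only [add_apply, sub_apply, smul_apply, h1, h2, h3, h4]
    module
  -- By the Riccati equation the coefficient of `P m` is even under reflection of the momentum,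
  -- while `P m` is odd, so the sum equals its own negative.
  have hsum : ∑ m ∈ Finset.range L,
      (phase L m * (p * σ m ^ 2 + r + 2 * q * σ m) - 2 * w * σ m) • P m = 0 := by
    set c : ℕ → ℂ := fun m =>
      phase L m * (p * σ m ^ 2 + r + 2 * q * σ m) - 2 * w * σ m with hc
    have hcr : ∀ m < L, c (L - 1 - m) = c m := by
      intro m hm
      simp only [hc]
      rw [hric m hm, phase_reflect hm, hσ m hm]; ring
    have h := Finset.sum_range_reflect (fun m => c m • P m) L
    have h2 : ∑ m ∈ Finset.range L, c (L - 1 - m) • P (L - 1 - m)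
        = - ∑ m ∈ Finset.range L, c m • P m := by
      rw [← Finset.sum_neg_distrib]
      refine Finset.sum_congr rfl fun m hm => ?_
      rw [Finset.mem_range] at hm
      rw [hcr m hm, hPr m hm, smul_neg]
    rw [h2] at h
    exact self_eq_neg.mp h.symm
  have hmain : (L : ℂ) • ((p • X1 + r • X2 + q • X3 + q • X4 - (2 * w : ℂ) • N) ψ)
      = (- (p * L) * ∑ m ∈ Finset.range L, phase L m * σ m) • ψ := by
    have : (L : ℂ) • (p • X1 + r • X2 + q • X3 + q • X4 - (2 * w : ℂ) • N)
        = p • ((L : ℂ) • X1) + r • ((L : ℂ) • X2) + q • ((L : ℂ) • X3) + q • ((L : ℂ) • X4)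
          - (2 * w : ℂ) • ((L : ℂ) • N) := by module
    rw [← smul_apply, this, e1, e2, e3, e4, eN]
    simp only [Finset.smul_sum]
    rw [← Finset.sum_add_distrib, ← Finset.sum_add_distrib, ← Finset.sum_add_distrib,
      ← Finset.sum_sub_distrib, sum_apply, Finset.sum_congr rfl hmode, Finset.sum_add_distrib, hsum,
      zero_add, ← Finset.sum_smul, Finset.mul_sum]
  have hmain2 : (p • X1 + r • X2 + q • X3 + q • X4 - (2 * w : ℂ) • N) ψ
      = (- p * ∑ m ∈ Finset.range L, phase L m * σ m) • ψ := by
    have h := congrArg (fun v => (L : ℂ)⁻¹ • v) hmain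
    simp only [smul_smul] at h
    rw [inv_mul_cancel₀ hLc, one_smul] at h
    rw [h]
    congr 1
    field_simp
  rw [sub_apply, hmain2, smul_apply, one_apply_eq_self, Pi.sub_apply, Pi.smul_apply, Pi.smul_apply,
    smul_eq_mul, smul_eq_mul]
  ring

end Modes

/-! ### The leading eigenvalue and the cumulant generating function -/

section Spectrum

/-- The squared (doubled) excitation energy of a mode with `cos k = c` at `u = e^s`. -/
def discriminant (ν u c : ℝ) : ℝ :=
  1 - 2 * (1 - ν + u) * c + (1 - ν + u) ^ 2 - u ^ 2 * (1 - c ^ 2)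

/-- With `1 - c ^ 2` the squared sine, this is a quarter of the discriminant of the Riccati equation
as a quadratic in the amplitude. In this form positivity can be read off. -/
lemma discriminant_eq (ν u c : ℝ) : discriminant ν u c
    = (1 - (1 - ν + u) * c) ^ 2 + ((1 - ν) * (1 - ν + 2 * u)) * (1 - c ^ 2) := by
  unfold discriminant; ring

lemma waveNumber_mem_Ioo {L m : ℕ} (hm : m < L) :
    waveNumber L m ∈ Set.Ioo 0 (2 * Real.pi) := by
  have hL : (0 : ℝ) < L := by exact_mod_cast (by omega : 0 < L)
  have hm' : (m : ℝ) + 1 ≤ L := by exact_mod_cast hm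
  have hpi := Real.pi_pos
  unfold waveNumber
  constructor
  · positivity
  · rw [div_lt_iff₀ hL]; nlinarith

lemma cos_waveNumber_lt_one {L m : ℕ} (hm : m < L) : Real.cos (waveNumber L m) < 1 := by
  obtain ⟨h0, h1⟩ := waveNumber_mem_Ioo hm
  refine lt_of_le_of_ne (Real.cos_le_one _) fun h => ?_
  have := (Real.cos_eq_one_iff_of_lt_of_lt (by linarith [Real.pi_pos]) h1).mp h
  linarith

/-- The second summand is positive for `|c| < 1`, and the first one at `c = -1`. At `c = 1` the
value is `(ν - u) ^ 2`, which vanishes at criticality; antiperiodic momenta never reach this point.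
-/
lemma discriminant_pos {ν u c : ℝ} (hν : ν < 1) (hu : 0 ≤ u) (hc : c < 1) (hc' : -1 ≤ c) :
    0 < discriminant ν u c := by
  rw [discriminant_eq]
  have h2 : 0 < (1 - ν) * (1 - ν + 2 * u) := by
    have : 0 < 1 - ν := by linarith
    positivity
  rcases hc'.eq_or_lt with h | h
  · rw [← h]
    have : 0 < 1 - ν := by linarith
    have : 0 < (1 - (1 - ν + u) * -1) := by linarith
    have h3 : 0 < (1 - (1 - ν + u) * -1) ^ 2 := by positivity
    linarith
  · have : 0 < 1 - c ^ 2 := by nlinarith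
    have := mul_pos h2 this
    positivity

/-- The pairing amplitude of the ground state at a mode with cosine `c` and sine `d`. -/
def bogoliubovAmplitude (ν u c d : ℝ) : ℝ :=
  if d = 0 then 0 else ((1 - ν + u) * c - 1 + Real.sqrt (discriminant ν u c)) / ((1 - ν) * d)

lemma bogoliubovAmplitude_neg (ν u c d : ℝ) :
    bogoliubovAmplitude ν u c (-d) = - bogoliubovAmplitude ν u c d := by
  unfold bogoliubovAmplitude
  by_cases h : d = 0
  · simp [h]
  · rw [if_neg (neg_ne_zero.mpr h), if_neg h, mul_neg, div_neg]

/-- For `d = 0` necessarily `c = -1`, where the right-hand side vanishes, so the default value `0`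
of the amplitude is harmless. -/
lemma mul_bogoliubovAmplitude {ν u c d : ℝ} (hν : ν < 1) (hu : 0 ≤ u) (hcd : c ^ 2 + d ^ 2 = 1)
    (hc : c < 1) : (1 - ν) * d * bogoliubovAmplitude ν u c d
      = (1 - ν + u) * c - 1 + Real.sqrt (discriminant ν u c) := by
  unfold bogoliubovAmplitude
  have h1 : 1 - ν ≠ 0 := by linarith
  split_ifs with h
  · have hc1 : c = -1 := by
      rw [h] at hcd
      have : (c - 1) * (c + 1) = 0 := by linarith
      rcases mul_eq_zero.mp this with h | h <;> linarith
    have : discriminant ν u c = (1 + (1 - ν + u)) ^ 2 := by rw [discriminant_eq, hc1]; ring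
    rw [this, Real.sqrt_sq (by linarith), hc1]; ring
  · field_simp

/-- The amplitude is the root of this quadratic with the positive square root, the choice for which
the eigenvalue vanishes at `s = 0`. -/
lemma bogoliubovAmplitude_riccati {ν u c d : ℝ} (hν : ν < 1) (hu : 0 ≤ u)
    (hcd : c ^ 2 + d ^ 2 = 1) (hc : c < 1) (hc' : -1 ≤ c) :
    d * (1 - ν + 2 * u - (1 - ν) * bogoliubovAmplitude ν u c d ^ 2)
      + 2 * bogoliubovAmplitude ν u c d * ((1 - ν + u) * c - 1) = 0 := by
  have h := mul_bogoliubovAmplitude hν hu hcd hc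
  have hs := Real.sq_sqrt (discriminant_pos hν hu hc hc').le
  by_cases hd : d = 0
  · simp [bogoliubovAmplitude, hd]
  · set t := bogoliubovAmplitude ν u c d
    set R := Real.sqrt (discriminant ν u c)
    have h1 : 1 - ν ≠ 0 := by linarith
    have hR : R = (1 - ν) * d * t - ((1 - ν + u) * c - 1) := by linarith
    rw [hR, discriminant_eq] at hs
    have hd2 : 1 - c ^ 2 = d ^ 2 := by linarith
    rw [hd2] at hs
    have : (1 - ν) * d * (d * (1 - ν + 2 * u - (1 - ν) * t ^ 2)
      + 2 * t * ((1 - ν + u) * c - 1)) = 0 := by linear_combination -hs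
    rcases mul_eq_zero.mp this with h | h
    · exact absurd h (mul_ne_zero h1 hd)
    · exact h

lemma sum_cos_waveNumber {L : ℕ} (hL : 2 ≤ L) :
    ∑ m ∈ Finset.range L, Real.cos (waveNumber L m) = 0 := by
  have h := sum_phase_zpow (by omega : L ≠ 0) 1
  have hd : ¬ (L : ℤ) ∣ 1 := by
    intro hd
    have := Int.le_of_dvd one_pos hd
    omega
  rw [if_neg hd] at h
  have h2 := congrArg Complex.re h
  rw [Complex.re_sum] at h2
  simpa [phase_eq_cos_add_sin, -Complex.ofReal_cos, -Complex.ofReal_sin] using h2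

/-- The leading eigenvalue of the tilted generator in the even sector. -/
def leadingEigenvalue (ν : ℝ) (L : ℕ) (s : ℝ) : ℝ :=
  (1 / 2) * ∑ m ∈ Finset.range L,
      Real.sqrt (discriminant ν (Real.exp s) (Real.cos (waveNumber L m)))
    - L * (depositionRate ν + 1 / 2)

/-- Without tilt the discriminant is the perfect square `(2 - ν - cos k) ^ 2`, and the cosines sum
to zero. -/
lemma leadingEigenvalue_zero {ν : ℝ} (hν : ν < 1) {L : ℕ} (hL : 2 ≤ L) :
    leadingEigenvalue ν L 0 = 0 := by
  have h : ∀ m ∈ Finset.range L,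
      Real.sqrt (discriminant ν (Real.exp 0) (Real.cos (waveNumber L m)))
      = (2 - ν) - Real.cos (waveNumber L m) := by
    intro m _
    have : discriminant ν (Real.exp 0) (Real.cos (waveNumber L m))
        = ((2 - ν) - Real.cos (waveNumber L m)) ^ 2 := by
      rw [Real.exp_zero]; unfold discriminant; ring
    rw [this, Real.sqrt_sq (by linarith [Real.cos_le_one (waveNumber L m)])]
  unfold leadingEigenvalue depositionRate
  rw [Finset.sum_congr rfl h, Finset.sum_sub_distrib, sum_cos_waveNumber hL, Finset.sum_const,
    Finset.card_range, nsmul_eq_mul]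
  ring

/-- The Fourier coefficients of the pair amplitude of the ground state. -/
def groundStateCoefficient (ν : ℝ) (L : ℕ) (s : ℝ) (m : ℕ) : ℂ :=
  bogoliubovAmplitude ν (Real.exp s) (Real.cos (waveNumber L m)) (Real.sin (waveNumber L m))
    * Complex.I

lemma groundStateCoefficient_reflect (ν : ℝ) {L : ℕ} (s : ℝ) {m : ℕ} (hm : m < L) :
    groundStateCoefficient ν L s (L - 1 - m) = - groundStateCoefficient ν L s m := by
  unfold groundStateCoefficient
  rw [waveNumber_reflect hm, Real.cos_two_pi_sub, Real.sin_two_pi_sub, bogoliubovAmplitude_neg]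
  push_cast; ring

lemma continuous_groundStateCoefficient (ν : ℝ) (L m : ℕ) :
    Continuous fun s => groundStateCoefficient ν L s m := by
  unfold groundStateCoefficient bogoliubovAmplitude discriminant
  split_ifs <;> fun_prop

lemma complexTiltedGenerator_groundState {ν : ℝ} (hν : ν < 1) {L : ℕ} [NeZero L] (hL : 2 ≤ L)
    (s : ℝ) {η : Config L} (hη : η ∈ evenSector L) :
    complexTiltedGenerator (1 / 2) (depositionRate ν) (Real.exp s) L
      (gaussianState L (fourierAmplitude L (groundStateCoefficient ν L s))) η
    = (leadingEigenvalue ν L s : ℂ)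
      * gaussianState L (fourierAmplitude L (groundStateCoefficient ν L s)) η := by
  have hu := Real.exp_nonneg s
  have hcs : ∀ m, Real.cos (waveNumber L m) ^ 2 + Real.sin (waveNumber L m) ^ 2 = 1 :=
    fun m => Real.cos_sq_add_sin_sq _
  rw [complexTiltedGenerator_gaussianState hL rfl rfl rfl
    (fun m hm => groundStateCoefficient_reflect ν s hm)]
  · congr 1
    set T : ℕ → ℝ := fun m => bogoliubovAmplitude ν (Real.exp s) (Real.cos (waveNumber L m))
      (Real.sin (waveNumber L m)) with hT
    -- The amplitude is odd in the momentum, so only the sine part of the phase survives in the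
    -- eigenvalue, which is therefore real.
    have hodd : ∑ m ∈ Finset.range L, Real.cos (waveNumber L m) * T m = 0 := by
      have h := Finset.sum_range_reflect (fun m => Real.cos (waveNumber L m) * T m) L
      have h2 : ∑ m ∈ Finset.range L, Real.cos (waveNumber L (L - 1 - m)) * T (L - 1 - m)
          = - ∑ m ∈ Finset.range L, Real.cos (waveNumber L m) * T m := by
        rw [← Finset.sum_neg_distrib]
        refine Finset.sum_congr rfl fun m hm => ?_
        simp only [hT]
        rw [waveNumber_reflect (Finset.mem_range.mp hm), Real.cos_two_pi_sub, Real.sin_two_pi_sub,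
          bogoliubovAmplitude_neg]
        ring
      rw [h2] at h
      linarith
    have hsum : ∑ m ∈ Finset.range L, phase L m * groundStateCoefficient ν L s m
        = - ((∑ m ∈ Finset.range L, Real.sin (waveNumber L m) * T m : ℝ) : ℂ) := by
      have : ∀ m ∈ Finset.range L, phase L m * groundStateCoefficient ν L s m
          = ((Real.cos (waveNumber L m) * T m : ℝ) : ℂ) * Complex.I
            - ((Real.sin (waveNumber L m) * T m : ℝ) : ℂ) := by
        intro m _
        rw [phase_eq_cos_add_sin, groundStateCoefficient, Complex.ofReal_mul, Complex.ofReal_mul]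
        linear_combination (Real.sin (waveNumber L m) : ℂ) * (T m : ℂ) * Complex.I_sq
      rw [Finset.sum_congr rfl this, Finset.sum_sub_distrib, ← Finset.sum_mul,
        ← Complex.ofReal_sum, ← Complex.ofReal_sum, hodd]
      simp
    have hs2 : (1 - ν) * ∑ m ∈ Finset.range L, Real.sin (waveNumber L m) * T m
        = ∑ m ∈ Finset.range L, Real.sqrt (discriminant ν (Real.exp s)
          (Real.cos (waveNumber L m))) - L := by
      rw [Finset.mul_sum]
      have : ∀ m ∈ Finset.range L, (1 - ν) * (Real.sin (waveNumber L m) * T m)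
          = (1 - ν + Real.exp s) * Real.cos (waveNumber L m) - 1
            + Real.sqrt (discriminant ν (Real.exp s) (Real.cos (waveNumber L m))) := fun m hm => by
        rw [← mul_bogoliubovAmplitude hν hu (hcs m)
          (cos_waveNumber_lt_one (Finset.mem_range.mp hm)), mul_assoc]
      rw [Finset.sum_congr rfl this, Finset.sum_add_distrib, Finset.sum_sub_distrib,
        ← Finset.mul_sum, sum_cos_waveNumber hL]
      simp; ring
    rw [hsum]
    have h3 : leadingEigenvalue ν L s = depositionRate ν *
        (∑ m ∈ Finset.range L, Real.sin (waveNumber L m) * T m) - L * depositionRate ν := by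
      unfold leadingEigenvalue depositionRate
      linear_combination -(1 / 2) * hs2
    rw [h3]
    push_cast
    ring
  · intro m hm
    have hr := bogoliubovAmplitude_riccati hν hu (hcs m) (cos_waveNumber_lt_one hm)
      (Real.neg_one_le_cos _)
    have hrc := congrArg (fun x : ℝ => (x : ℂ)) hr
    push_cast at hrc
    rw [phase_inv_eq_cos_sub_sin, phase_eq_cos_add_sin, groundStateCoefficient, depositionRate]
    push_cast
    set t : ℂ := ((bogoliubovAmplitude ν (Real.exp s) (Real.cos (waveNumber L m))
      (Real.sin (waveNumber L m)) : ℝ) : ℂ)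
    -- Under `σ = i t` the complex condition is `i` times the real Riccati equation, up to `i ^ 2 =
    -- -1`.
    linear_combination Complex.I * hrc
      + Complex.sin (waveNumber L m) * Complex.I * (1 - ν) * t ^ 2 * Complex.I_sq
  · exact hη

lemma tendsto_scaledLogMGF_leadingEigenvalue {ν : ℝ} (hν : ν < 1) {L : ℕ} (hL : 2 ≤ L) (s : ℝ)
    {η : Config L} (hη : η ∈ evenSector L) :
    Tendsto (fun t => scaledLogMGF (1 / 2) (depositionRate ν) L η s t) atTop
      (𝓝 (leadingEigenvalue ν L s / L)) := by
  have : NeZero L := ⟨by omega⟩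
  refine tendsto_scaledLogMGF (by norm_num) (by unfold depositionRate; linarith) hL
    (φ := fun s η =>
      (gaussianState L (fourierAmplitude L (groundStateCoefficient ν L s)) η).re)
    (Λ := leadingEigenvalue ν L) (fun η => ?_) (fun s => ?_) (fun s ζ hζ => ?_)
    (leadingEigenvalue_zero hν hL) s hη
  · refine Complex.continuous_re.comp (continuous_gaussianState (fun i l => ?_) η)
    unfold fourierAmplitude
    exact continuous_const.mul (continuous_finsetSum _ fun m _ =>
      (continuous_groundStateCoefficient ν L m).mul continuous_const)
  · rw [gaussianState_empty, Complex.one_re]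
  · rw [tiltedGenerator_re, complexTiltedGenerator_groundState hν hL s hζ,
      Complex.re_ofReal_mul]

lemma K_eq {ν : ℝ} (hν : ν < 1) {L : ℕ} (hL : 2 ≤ L) (s : ℝ) :
    K ν L s = (1 / (2 * L)) * ∑ m ∈ Finset.range L,
      Real.sqrt (discriminant ν (Real.exp s) (Real.cos (waveNumber L m)))
      - (depositionRate ν + 1 / 2) := by
  have hL0 : (L : ℝ) ≠ 0 := by exact_mod_cast (by omega : L ≠ 0)
  unfold K evenCGF
  rw [(tendsto_scaledLogMGF_leadingEigenvalue hν hL s (empty_mem_evenSector L)).limUnder_eq,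
    leadingEigenvalue]
  field_simp

lemma tendsto_scaledLogMGF_K {ν : ℝ} (hν : ν < 1) {L : ℕ} (hL : 2 ≤ L) (s : ℝ) {η : Config L}
    (hη : Even (particleNumber η)) :
    Tendsto (fun t => scaledLogMGF (1 / 2) (depositionRate ν) L η s t) atTop (𝓝 (K ν L s)) := by
  have h := tendsto_scaledLogMGF_leadingEigenvalue hν hL s
    ((even_particleNumber_iff η).mp hη : η ∈ evenSector L)
  have : K ν L s = leadingEigenvalue ν L s / L := by
    unfold K evenCGF
    exact (tendsto_scaledLogMGF_leadingEigenvalue hν hL s (empty_mem_evenSector L)).limUnder_eq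
  rwa [this]

end Spectrum

/-! ### Square roots of power series -/

section SqrtSeries

/-- The coefficients of the square root of the power series with coefficients `d`. -/
def sqrtCoeff (d : ℕ → ℝ) : ℕ → ℝ
  | 0 => Real.sqrt (d 0)
  | n + 1 => (d (n + 1) - ∑ i : Fin n, sqrtCoeff d (i + 1) * sqrtCoeff d (n - i))
      / (2 * Real.sqrt (d 0))
decreasing_by all_goals omega

lemma sqrtCoeff_zero (d : ℕ → ℝ) : sqrtCoeff d 0 = Real.sqrt (d 0) := by rw [sqrtCoeff]

lemma sqrtCoeff_succ (d : ℕ → ℝ) (n : ℕ) : sqrtCoeff d (n + 1) =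
    (d (n + 1) - ∑ i : Fin n, sqrtCoeff d (i + 1) * sqrtCoeff d (n - i))
      / (2 * Real.sqrt (d 0)) := by rw [sqrtCoeff]

lemma mk_sqrtCoeff_mul_self {d : ℕ → ℝ} (hd : 0 < d 0) :
    PowerSeries.mk (sqrtCoeff d) * PowerSeries.mk (sqrtCoeff d) = PowerSeries.mk d := by
  ext n
  rw [PowerSeries.coeff_mul, PowerSeries.coeff_mk]
  simp only [PowerSeries.coeff_mk]
  have hs := Real.sqrt_pos.mpr hd
  rw [Finset.Nat.sum_antidiagonal_eq_sum_range_succ (fun i j => sqrtCoeff d i * sqrtCoeff d j) n]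
  cases n with
  | zero => simp [sqrtCoeff_zero, Real.mul_self_sqrt hd.le]
  | succ n =>
    rw [Finset.sum_range_succ, Finset.sum_range_succ']
    have h1 : ∑ i ∈ Finset.range n, sqrtCoeff d (i + 1) * sqrtCoeff d (n + 1 - (i + 1))
        = ∑ i : Fin n, sqrtCoeff d (i + 1) * sqrtCoeff d (n - i) := by
      rw [Finset.sum_range]
      exact Finset.sum_congr rfl fun i _ => by rw [Nat.add_sub_add_right]
    rw [h1, Nat.sub_zero, Nat.sub_self, sqrtCoeff_zero, sqrtCoeff_succ]
    field_simp
    ring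

/-- Power series form a domain, so two square roots agree up to sign, and the constant term fixes
the sign. -/
lemma powerSeries_eq_of_mul_self_eq {A B : PowerSeries ℝ} (h : A * A = B * B)
    (hA : 0 < PowerSeries.coeff 0 A) (hB : 0 < PowerSeries.coeff 0 B) : A = B := by
  rcases mul_self_eq_mul_self_iff.mp h with h | h
  · exact h
  · rw [h, map_neg] at hA
    linarith

lemma contDiff_sqrtCoeff {d : ℝ → ℕ → ℝ} {N : ℕ∞} (hd : ∀ n, ContDiff ℝ N fun y => d y n)
    (h0 : ∀ y, 0 < d y 0) (n : ℕ) : ContDiff ℝ N fun y => sqrtCoeff (d y) n := by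
  have hs : ContDiff ℝ N fun y => Real.sqrt (d y 0) := (hd 0).sqrt fun y => (h0 y).ne'
  induction n using Nat.strong_induction_on with
  | _ n ih =>
    cases n with
    | zero => simpa only [sqrtCoeff_zero] using hs
    | succ n =>
      rw [funext fun y => sqrtCoeff_succ (d y) n]
      refine ((hd _).sub (ContDiff.sum fun i _ => (ih _ ?_).mul (ih _ ?_))).div
        (contDiff_const.mul hs) fun y => ?_
      · omega
      · omega
      · have := Real.sqrt_pos.mpr (h0 y)
        positivity

/-- Differentiating the square root of a power series in a parameter. -/
lemma two_mul_mk_mul_mk_deriv {d : ℝ → ℕ → ℝ} (hd : ∀ n, ContDiff ℝ 1 fun y => d y n)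
    (h0 : ∀ y, 0 < d y 0) (y₀ : ℝ) :
    2 * PowerSeries.mk (sqrtCoeff (d y₀)) *
      PowerSeries.mk (fun n => deriv (fun y => sqrtCoeff (d y) n) y₀)
      = PowerSeries.mk (fun n => deriv (fun y => d y n) y₀) := by
  have hF : ∀ n, DifferentiableAt ℝ (fun y => sqrtCoeff (d y) n) y₀ := fun n =>
    (contDiff_sqrtCoeff (N := 1) hd h0 n).differentiable (by simp) y₀
  ext n
  have h : (fun y => d y n)
      = fun y => ∑ p ∈ Finset.HasAntidiagonal.antidiagonal n, sqrtCoeff (d y) p.1 * sqrtCoeff (d y) p.2 := by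
    funext y
    have := congrArg (PowerSeries.coeff n) (mk_sqrtCoeff_mul_self (h0 y))
    rw [PowerSeries.coeff_mul] at this
    simpa only [PowerSeries.coeff_mk] using this.symm
  rw [PowerSeries.coeff_mk, h, deriv_fun_sum fun p _ => (hF p.1).mul (hF p.2)]
  rw [mul_assoc, two_mul]
  nth_rewrite 1 [mul_comm]
  rw [map_add, PowerSeries.coeff_mul, PowerSeries.coeff_mul, ← Finset.sum_add_distrib]
  refine Finset.sum_congr rfl fun p _ => ?_
  simp only [PowerSeries.coeff_mk]
  rw [deriv_fun_mul (hF p.1) (hF p.2)]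

lemma choose_succ_mul (r : ℝ) (n : ℕ) :
    ((n : ℝ) + 1) * Ring.choose r (n + 1) = (r - n) * Ring.choose r n := by
  have h := Ring.choose_smul_choose r (Nat.le_succ n)
  rw [Nat.succ_eq_add_one, Nat.add_sub_cancel_left, Ring.choose_one_right, Nat.choose_succ_self_right,
    nsmul_eq_mul] at h
  push_cast at h
  linarith

lemma choose_half_succ (n : ℕ) : Ring.choose (1 / 2 : ℝ) (n + 1)
    = Ring.choose (-1 / 2 : ℝ) n + Ring.choose (-1 / 2 : ℝ) (n + 1) := by
  have := Ring.choose_succ_succ (-1 / 2 : ℝ) n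
  norm_num at this ⊢
  exact this

section Quadratic

variable {a b : ℝ} {B : PowerSeries ℝ}

/-- Differentiating `B * B` and multiplying by `B` gives the first-order equation `(a + b X ^ 2) B'
= b X B`; the claim compares its coefficients. -/
lemma coeff_sqrt_quadratic_recursion (hB : B * B = PowerSeries.C a + PowerSeries.C b * PowerSeries.X ^ 2)
    (n : ℕ) : a * ((n : ℝ) + 2) * PowerSeries.coeff (n + 2) B
      = b * (1 - n) * PowerSeries.coeff n B := by
  have hD := congrArg (PowerSeries.derivative ℝ) hB
  have h1 : (PowerSeries.C a + PowerSeries.C b * PowerSeries.X ^ 2) * PowerSeries.derivative ℝ B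
      = PowerSeries.C b * (PowerSeries.X * B) := by
    rw [Derivation.leibniz, map_add, Derivation.leibniz, PowerSeries.derivative_C,
      PowerSeries.derivative_C, PowerSeries.derivative_pow, PowerSeries.derivative_X] at hD
    simp only [smul_eq_mul] at hD
    have h2 : (2 : PowerSeries ℝ) ≠ 0 := by
      rw [← map_ofNat (PowerSeries.C (R := ℝ)) 2]
      exact (map_ne_zero_iff _ PowerSeries.C_injective).mpr two_ne_zero
    refine mul_left_cancel₀ h2 ?_
    rw [← hB]
    push_cast at hD
    linear_combination B * hD
  have h2 := congrArg (PowerSeries.coeff (n + 1)) h1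
  rw [add_mul, map_add, mul_assoc, PowerSeries.coeff_C_mul, PowerSeries.coeff_C_mul,
    PowerSeries.coeff_C_mul, PowerSeries.coeff_succ_X_mul, PowerSeries.coeff_derivative] at h2
  have h3 : PowerSeries.coeff (n + 1) (PowerSeries.X ^ 2 * PowerSeries.derivative ℝ B)
      = n * PowerSeries.coeff n B := by
    rw [pow_two, mul_assoc, PowerSeries.coeff_succ_X_mul]
    cases n with
    | zero => simp
    | succ n =>
      rw [PowerSeries.coeff_succ_X_mul, PowerSeries.coeff_derivative]; push_cast; ring
  rw [h3] at h2
  push_cast at h2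
  linear_combination h2

/-- The binomial series of `√a (1 + (b / a) X ^ 2) ^ (1 / 2)`: the recursion for `B` is that of the
binomial coefficients. -/
lemma coeff_sqrt_quadratic_even (ha : 0 < a)
    (hB : B * B = PowerSeries.C a + PowerSeries.C b * PowerSeries.X ^ 2)
    (h0 : PowerSeries.coeff 0 B = Real.sqrt a) (p : ℕ) :
    PowerSeries.coeff (2 * p) B = Real.sqrt a * Ring.choose (1 / 2 : ℝ) p * (b / a) ^ p := by
  induction p with
  | zero => simp [h0]
  | succ p ih =>
    have h := coeff_sqrt_quadratic_recursion hB (2 * p)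
    rw [ih] at h
    have hc := choose_succ_mul (1 / 2 : ℝ) p
    have hne : a * (((2 * p : ℕ) : ℝ) + 2) ≠ 0 := by positivity
    refine mul_left_cancel₀ hne ?_
    rw [mul_add_one, h, pow_succ]
    have hba : a * (b / a) = b := by field_simp
    set t := b / a
    push_cast
    linear_combination (-2 * b * Real.sqrt a * t ^ p) * hc
      - (2 * p + 2) * Real.sqrt a * Ring.choose (1 / 2 : ℝ) (p + 1) * t ^ p * hba

lemma coeff_sqrt_quadratic_odd (ha : 0 < a)
    (hB : B * B = PowerSeries.C a + PowerSeries.C b * PowerSeries.X ^ 2)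
    (h0 : PowerSeries.coeff 0 B = Real.sqrt a) (p : ℕ) :
    PowerSeries.coeff (2 * p + 1) B = 0 := by
  induction p with
  | zero =>
    have h := congrArg (PowerSeries.coeff 1) hB
    rw [PowerSeries.coeff_mul] at h
    simp [Finset.Nat.antidiagonal_succ, PowerSeries.coeff_X_pow] at h
    have hs := Real.sqrt_pos.mpr ha
    rw [← PowerSeries.coeff_zero_eq_constantCoeff_apply, h0] at h
    have : Real.sqrt a * PowerSeries.coeff 1 B = 0 := by linarith
    exact (mul_eq_zero.mp this).resolve_left hs.ne'
  | succ p ih =>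
    have h := coeff_sqrt_quadratic_recursion hB (2 * p + 1)
    rw [ih, mul_zero] at h
    have hne : a * (((2 * p + 1 : ℕ) : ℝ) + 2) ≠ 0 := by positivity
    exact (mul_eq_zero.mp h).resolve_left hne

/-- Here `R` is the first-order change of the root `B` when `e X + b X ^ 3` is added to its square.
Formally `R = (e X + b X ^ 3) / (2 √(a + b X ^ 2))`, a binomial series of exponent `-1 / 2`.
Multiplying by `B` removes the root and gives a two-term recursion. -/
lemma coeff_perturbation_odd (ha : 0 < a)
    (hB : B * B = PowerSeries.C a + PowerSeries.C b * PowerSeries.X ^ 2)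
    (h0 : PowerSeries.coeff 0 B = Real.sqrt a) {R : PowerSeries ℝ} {e : ℝ}
    (hR : 2 * B * R = PowerSeries.C e * PowerSeries.X + PowerSeries.C b * PowerSeries.X ^ 3) (p : ℕ) :
    PowerSeries.coeff (2 * p + 3) R = (1 / 2) * Real.sqrt a * (b / a) ^ (p + 1) *
      (e / a * Ring.choose (-1 / 2 : ℝ) (p + 1) + Ring.choose (-1 / 2 : ℝ) p) := by
  have h1 : PowerSeries.C (2 * a) * R + PowerSeries.C (2 * b) * (PowerSeries.X * (PowerSeries.X * R))
      = PowerSeries.C e * (PowerSeries.X * B)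
        + PowerSeries.C b * (PowerSeries.X * (PowerSeries.X * (PowerSeries.X * B))) := by
    rw [map_mul, map_mul]
    have : (PowerSeries.C (2 : ℝ)) = 2 := map_ofNat _ 2
    rw [this]
    linear_combination B * hR - 2 * R * hB
  have hs := Real.sqrt_pos.mpr ha
  have hone : PowerSeries.coeff 1 R = (1 / 2) * Real.sqrt a * (e / a) := by
    have h := congrArg (PowerSeries.coeff (0 + 1)) h1
    rw [map_add, map_add, PowerSeries.coeff_C_mul, PowerSeries.coeff_C_mul, PowerSeries.coeff_C_mul,
      PowerSeries.coeff_C_mul, PowerSeries.coeff_succ_X_mul,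
      PowerSeries.coeff_succ_X_mul, PowerSeries.coeff_succ_X_mul, PowerSeries.coeff_zero_X_mul,
      PowerSeries.coeff_zero_X_mul, h0] at h
    rw [zero_add] at h
    field_simp
    linarith
  have hrec : ∀ n, 2 * a * PowerSeries.coeff (n + 3) R + 2 * b * PowerSeries.coeff (n + 1) R
      = e * PowerSeries.coeff (n + 2) B + b * PowerSeries.coeff n B := by
    intro n
    have h := congrArg (PowerSeries.coeff (n + 3)) h1
    rw [map_add, map_add, PowerSeries.coeff_C_mul, PowerSeries.coeff_C_mul, PowerSeries.coeff_C_mul,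
      PowerSeries.coeff_C_mul, show n + 3 = (n + 2) + 1 from rfl, PowerSeries.coeff_succ_X_mul,
      PowerSeries.coeff_succ_X_mul, PowerSeries.coeff_succ_X_mul,
      show n + 2 = (n + 1) + 1 from rfl, PowerSeries.coeff_succ_X_mul,
      PowerSeries.coeff_succ_X_mul, PowerSeries.coeff_succ_X_mul] at h
    exact h
  induction p with
  | zero =>
    have h := hrec 0
    have h2 := coeff_sqrt_quadratic_even ha hB h0 1
    rw [zero_add, zero_add, zero_add, hone, h0, ← mul_one 2, h2] at h
    have hne : 2 * a ≠ 0 := by positivity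
    refine mul_left_cancel₀ hne ?_
    simp only [mul_zero, zero_add, Ring.choose_one_right, Ring.choose_zero_right] at h ⊢
    have h3 : 2 * a * PowerSeries.coeff 3 R
      = e * (Real.sqrt a * (1 / 2) * (b / a) ^ 1) + b * Real.sqrt a
        - 2 * b * (1 / 2 * Real.sqrt a * (e / a)) := by linarith
    rw [h3]
    field_simp
    ring
  | succ p ih =>
    have h := hrec (2 * p + 2)
    have h2 := coeff_sqrt_quadratic_even ha hB h0 (p + 1)
    have h4 := coeff_sqrt_quadratic_even ha hB h0 (p + 2)
    -- Pascal's rule expresses the coefficients of `B` through those of exponent `-1 / 2`.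
    rw [choose_half_succ] at h2 h4
    rw [show 2 * p + 2 + 1 = 2 * p + 3 by ring, ih, show 2 * p + 2 + 2 = 2 * (p + 2) by ring, h4,
      show 2 * p + 2 = 2 * (p + 1) by ring, h2] at h
    have hne : 2 * a ≠ 0 := by positivity
    refine mul_left_cancel₀ hne ?_
    rw [show 2 * (p + 1) + 3 = 2 * (p + 1) + 3 from rfl, eq_sub_of_add_eq h]
    rw [pow_succ _ (p + 1)]
    field_simp
    ring

end Quadratic

end SqrtSeries

/-! ### Taylor expansion of the mode energies at the critical point -/

section Taylor

/-- The Taylor coefficients at the critical point, in the variable `(s - s_c) / y`, of the squared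
excitation energy divided by `y ^ 2`, where `y = sin (k / 2)`. -/
def energyCoeff (ν y : ℝ) : ℕ → ℝ
  | 0 => 4 * (1 - ν ^ 2 * (1 - y ^ 2))
  | 1 => 4 * ν * y * (1 - 2 * ν * (1 - y ^ 2))
  | n + 2 => y ^ n * (ν ^ 2 * (2 ^ (n + 2) - 2) / ((n + 2).factorial : ℝ) * (1 - 2 * y ^ 2) ^ 2
      + 4 * ν * y ^ 2 / ((n + 2).factorial : ℝ) * (1 - 2 * ν * (1 - y ^ 2)))

/-- The rescaled Taylor coefficients at the critical point of the excitation energy. -/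
def energySqrtCoeff (ν : ℝ) (n : ℕ) (y : ℝ) : ℝ := sqrtCoeff (energyCoeff ν y) n

variable {ν : ℝ}

lemma contDiff_energyCoeff (ν : ℝ) (n : ℕ) : ContDiff ℝ 1 fun y => energyCoeff ν y n := by
  rcases n with _ | _ | n <;> simp only [energyCoeff] <;> fun_prop

lemma energyCoeff_zero_pos (h0 : 0 ≤ ν) (h1 : ν < 1) (y : ℝ) : 0 < energyCoeff ν y 0 := by
  have : ν ^ 2 < 1 := by nlinarith
  simp only [energyCoeff]
  nlinarith [mul_nonneg (sq_nonneg ν) (sq_nonneg y)]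

lemma contDiff_energySqrtCoeff (h0 : 0 ≤ ν) (h1 : ν < 1) (n : ℕ) :
    ContDiff ℝ 1 (energySqrtCoeff ν n) :=
  contDiff_sqrtCoeff (N := 1) (contDiff_energyCoeff ν) (energyCoeff_zero_pos h0 h1) n

/-- The scaling limit of the squared energy at small momentum: from order three on a power of `y` is
left over, so only two terms survive. -/
lemma mk_energyCoeff_zero (ν : ℝ) : PowerSeries.mk (energyCoeff ν 0)
    = PowerSeries.C (4 * (1 - ν ^ 2)) + PowerSeries.C (ν ^ 2) * PowerSeries.X ^ 2 := by
  ext n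
  rw [PowerSeries.coeff_mk, map_add, PowerSeries.coeff_C, PowerSeries.coeff_C_mul,
    PowerSeries.coeff_X_pow]
  rcases n with _ | _ | _ | n
  · simp [energyCoeff]
  · simp [energyCoeff]
  · simp [energyCoeff, Nat.factorial]; ring
  · simp [energyCoeff]

/-- All factors in `y ^ 2` are stationary at `0`, so a first-order contribution needs an explicit
factor `y`; this occurs only at orders one and three. -/
lemma mk_deriv_energyCoeff_zero (ν : ℝ) :
    PowerSeries.mk (fun n => deriv (fun y => energyCoeff ν y n) 0)
    = PowerSeries.C (4 * ν * (1 - 2 * ν)) * PowerSeries.X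
      + PowerSeries.C (ν ^ 2) * PowerSeries.X ^ 3 := by
  have hsq : HasDerivAt (fun y : ℝ => y ^ 2) 0 0 := by simpa using hasDerivAt_pow 2 (0 : ℝ)
  have h1 : HasDerivAt (fun y : ℝ => 1 - 2 * ν * (1 - y ^ 2)) 0 0 := by
    simpa using ((hsq.const_sub 1).const_mul (2 * ν)).const_sub 1
  have h2 : HasDerivAt (fun y : ℝ => (1 - 2 * y ^ 2) ^ 2) 0 0 := by
    simpa using ((hsq.const_mul 2).const_sub 1).fun_pow 2
  have hG : ∀ A B : ℝ, HasDerivAt (fun y : ℝ => A * (1 - 2 * y ^ 2) ^ 2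
      + 4 * ν * y ^ 2 / B * (1 - 2 * ν * (1 - y ^ 2))) 0 0 := fun A B => by
    simpa using (h2.const_mul A).fun_add (((hsq.const_mul (4 * ν)).div_const B).fun_mul h1)
  ext n
  rw [PowerSeries.coeff_mk, map_add, PowerSeries.coeff_C_mul, PowerSeries.coeff_C_mul,
    PowerSeries.coeff_X_pow, PowerSeries.coeff_X]
  rcases n with _ | _ | n
  · simp [energyCoeff]
  · have : HasDerivAt (fun y : ℝ => 4 * ν * y * (1 - 2 * ν * (1 - y ^ 2)))
        (4 * ν * (1 - 2 * ν)) 0 := by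
      simpa using ((hasDerivAt_id (0 : ℝ)).const_mul (4 * ν)).fun_mul h1
    simpa [energyCoeff] using this.deriv
  · have h := (hasDerivAt_pow n (0 : ℝ)).mul
      (hG (ν ^ 2 * (2 ^ (n + 2) - 2) / ((n + 2).factorial : ℝ)) ((n + 2).factorial : ℝ))
    have e : deriv (fun y => energyCoeff ν y (n + 2)) 0 = _ := h.deriv
    rw [e]
    rcases n with _ | _ | n
    · simp
    · simp [Nat.factorial]; ring
    · simp

lemma mk_energySqrtCoeff_zero_mul_self (h0 : 0 ≤ ν) (h1 : ν < 1) :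
    PowerSeries.mk (fun n => energySqrtCoeff ν n 0) * PowerSeries.mk (fun n => energySqrtCoeff ν n 0)
    = PowerSeries.C (4 * (1 - ν ^ 2)) + PowerSeries.C (ν ^ 2) * PowerSeries.X ^ 2 := by
  rw [← mk_energyCoeff_zero]
  exact mk_sqrtCoeff_mul_self (energyCoeff_zero_pos h0 h1 0)

lemma coeff_zero_mk_energySqrtCoeff_zero (ν : ℝ) :
    PowerSeries.coeff 0 (PowerSeries.mk (fun n => energySqrtCoeff ν n 0))
      = Real.sqrt (4 * (1 - ν ^ 2)) := by
  rw [PowerSeries.coeff_mk, energySqrtCoeff, sqrtCoeff_zero, energyCoeff]; simp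

lemma energySqrtCoeff_even_zero (h0 : 0 ≤ ν) (h1 : ν < 1) (p : ℕ) :
    energySqrtCoeff ν (2 * p) 0 = Real.sqrt (4 * (1 - ν ^ 2)) * Ring.choose (1 / 2 : ℝ) p
      * (ν ^ 2 / (4 * (1 - ν ^ 2))) ^ p := by
  have ha : 0 < 4 * (1 - ν ^ 2) := by nlinarith
  have := coeff_sqrt_quadratic_even ha (mk_energySqrtCoeff_zero_mul_self h0 h1)
    (coeff_zero_mk_energySqrtCoeff_zero ν) p
  rwa [PowerSeries.coeff_mk] at this

/-- This vanishing gains one power of `y` and gives the cumulants of orders `2 n` and `2 n + 1` the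
same growth. -/
lemma energySqrtCoeff_odd_zero (h0 : 0 ≤ ν) (h1 : ν < 1) (p : ℕ) :
    energySqrtCoeff ν (2 * p + 1) 0 = 0 := by
  have ha : 0 < 4 * (1 - ν ^ 2) := by nlinarith
  have := coeff_sqrt_quadratic_odd ha (mk_energySqrtCoeff_zero_mul_self h0 h1)
    (coeff_zero_mk_energySqrtCoeff_zero ν) p
  rwa [PowerSeries.coeff_mk] at this

lemma deriv_energySqrtCoeff_odd_zero (h0 : 0 ≤ ν) (h1 : ν < 1) (p : ℕ) :
    deriv (energySqrtCoeff ν (2 * p + 3)) 0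
      = (1 / 2) * Real.sqrt (4 * (1 - ν ^ 2)) * (ν ^ 2 / (4 * (1 - ν ^ 2))) ^ (p + 1) *
      (4 * ν * (1 - 2 * ν) / (4 * (1 - ν ^ 2)) * Ring.choose (-1 / 2 : ℝ) (p + 1)
        + Ring.choose (-1 / 2 : ℝ) p) := by
  have ha : 0 < 4 * (1 - ν ^ 2) := by nlinarith
  have hR := two_mul_mk_mul_mk_deriv (contDiff_energyCoeff ν) (energyCoeff_zero_pos h0 h1) 0
  rw [mk_deriv_energyCoeff_zero] at hR
  have := coeff_perturbation_odd ha (mk_energySqrtCoeff_zero_mul_self h0 h1)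
    (coeff_zero_mk_energySqrtCoeff_zero ν) hR p
  rwa [PowerSeries.coeff_mk] at this

/-- The contribution of a mode with `cos k = c` to the cumulant generating function. -/
def modeEnergy (ν c s : ℝ) : ℝ := Real.sqrt (discriminant ν (Real.exp s) c)

lemma contDiff_modeEnergy (h1 : ν < 1) {c : ℝ} (hc : c < 1) (hc' : -1 ≤ c) :
    ContDiff ℝ (⊤ : ℕ∞) (modeEnergy ν c) := by
  unfold modeEnergy
  refine ContDiff.sqrt ?_ fun s => (discriminant_pos h1 (Real.exp_nonneg s) hc hc').ne'
  unfold discriminant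
  fun_prop

lemma iteratedDeriv_exp_quadratic (p₀ p₁ p₂ : ℝ) (n : ℕ) :
    iteratedDeriv (n + 1) (fun s => p₀ + p₁ * Real.exp s + p₂ * Real.exp (2 * s))
      = fun s => p₁ * Real.exp s + 2 ^ (n + 1) * p₂ * Real.exp (2 * s) := by
  have hd : ∀ q₀ q₁ q₂ : ℝ, deriv (fun s => q₀ + q₁ * Real.exp s + q₂ * Real.exp (2 * s))
      = fun s => q₁ * Real.exp s + 2 * q₂ * Real.exp (2 * s) := by
    intro q₀ q₁ q₂
    funext s
    have h1 : HasDerivAt (fun s => Real.exp (2 * s)) (Real.exp (2 * s) * 2) s := by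
      simpa using ((hasDerivAt_id s).const_mul 2).exp
    have h := (((Real.hasDerivAt_exp s).const_mul q₁).const_add q₀).add (h1.const_mul q₂)
    have e := h.deriv
    refine e.trans ?_
    ring
  induction n with
  | zero => rw [zero_add, iteratedDeriv_one, hd]; simp
  | succ n ih =>
    rw [iteratedDeriv_succ, ih]
    have := hd 0 p₁ (2 ^ (n + 1) * p₂)
    simp only [zero_add] at this
    rw [this]
    funext s
    ring

/-- The discriminant is a quadratic polynomial in `exp s`. At the critical point its value and its
first derivative are multiples of `y ^ 2`, and from order two on the factor `y ^ n` contains `y ^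
2`; hence the rescaled coefficients are polynomials in `y`. -/
lemma discriminant_taylor (h : 0 < ν) (y : ℝ) (n : ℕ) :
    y ^ n * iteratedDeriv n (fun s => discriminant ν (Real.exp s) (1 - 2 * y ^ 2)) (Real.log ν)
      = y ^ 2 * (n.factorial : ℝ) * energyCoeff ν y n := by
  cases n with
  | zero =>
    rw [iteratedDeriv_zero, Real.exp_log h]
    simp only [discriminant, energyCoeff, Nat.factorial]
    push_cast
    ring
  | succ n =>
    have e : (fun s => discriminant ν (Real.exp s) (1 - 2 * y ^ 2))
        = fun s => (1 - 2 * (1 - ν) * (1 - 2 * y ^ 2) + (1 - ν) ^ 2)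
          + (4 * y ^ 2 - 2 * ν) * Real.exp s + (1 - 2 * y ^ 2) ^ 2 * Real.exp (2 * s) := by
      funext s
      rw [two_mul s, Real.exp_add]
      unfold discriminant
      ring
    rw [e, iteratedDeriv_exp_quadratic]
    simp only []
    rw [two_mul (Real.log ν), Real.exp_add, Real.exp_log h]
    cases n with
    | zero => simp only [energyCoeff, Nat.factorial]; push_cast; ring
    | succ n =>
      have hf : ((n + 1 + 1).factorial : ℝ) ≠ 0 := by exact_mod_cast Nat.factorial_ne_zero _
      simp only [energyCoeff]
      field_simp
      ring

/-- By the Leibniz rule the rescaled Taylor series of the energy squares to the series with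
coefficients `energyCoeff`. So does the formal root, and both have positive constant term. -/
lemma modeEnergy_taylor (h0 : 0 < ν) (h1 : ν < 1) {y : ℝ} (hy : 0 < y) (hy1 : y ≤ 1) (n : ℕ) :
    iteratedDeriv n (modeEnergy ν (1 - 2 * y ^ 2)) (Real.log ν)
      = (n.factorial : ℝ) * (y / y ^ n) * energySqrtCoeff ν n y := by
  have hc : 1 - 2 * y ^ 2 < 1 := by nlinarith
  have hc' : -1 ≤ 1 - 2 * y ^ 2 := by nlinarith
  have hsm := contDiff_modeEnergy h1 hc hc'
  set A : PowerSeries ℝ := PowerSeries.mk fun n =>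
    y ^ n * (iteratedDeriv n (modeEnergy ν (1 - 2 * y ^ 2)) (Real.log ν) / (n.factorial : ℝ)) / y
    with hA
  have hAA : A * A = PowerSeries.mk (energyCoeff ν y) := by
    ext n
    rw [PowerSeries.coeff_mul, PowerSeries.coeff_mk]
    simp only [hA, PowerSeries.coeff_mk]
    have hprod : modeEnergy ν (1 - 2 * y ^ 2) * modeEnergy ν (1 - 2 * y ^ 2)
        = fun s => discriminant ν (Real.exp s) (1 - 2 * y ^ 2) := by
      funext s
      exact Real.mul_self_sqrt (discriminant_pos h1 (Real.exp_nonneg s) hc hc').le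
    have hD := discriminant_taylor h0 y n
    have hat : ContDiffAt ℝ n (modeEnergy ν (1 - 2 * y ^ 2)) (Real.log ν) :=
      (hsm.of_le (by exact_mod_cast le_top)).contDiffAt
    rw [← hprod, iteratedDeriv_mul hat hat] at hD
    rw [Finset.Nat.sum_antidiagonal_eq_sum_range_succ (fun i j =>
      (y ^ i * (iteratedDeriv i (modeEnergy ν (1 - 2 * y ^ 2)) (Real.log ν) / (i.factorial : ℝ)) / y)
      * (y ^ j * (iteratedDeriv j (modeEnergy ν (1 - 2 * y ^ 2)) (Real.log ν)
        / (j.factorial : ℝ)) / y)) n]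
    have hf : (n.factorial : ℝ) ≠ 0 := by exact_mod_cast Nat.factorial_ne_zero _
    have hy2 : y ^ 2 * (n.factorial : ℝ) ≠ 0 := by positivity
    refine mul_left_cancel₀ hy2 ?_
    rw [← hD, Finset.mul_sum, Finset.mul_sum]
    refine Finset.sum_congr rfl fun i hi => ?_
    have hi' : i ≤ n := Nat.lt_succ_iff.mp (Finset.mem_range.mp hi)
    have hch := congrArg (fun k : ℕ => (k : ℝ)) (Nat.choose_mul_factorial_mul_factorial hi')
    push_cast at hch
    have hfi : (i.factorial : ℝ) ≠ 0 := by exact_mod_cast Nat.factorial_ne_zero _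
    have hfj : ((n - i).factorial : ℝ) ≠ 0 := by exact_mod_cast Nat.factorial_ne_zero _
    have hyn : y ^ n = y ^ i * y ^ (n - i) := by rw [← pow_add, Nat.add_sub_cancel' hi']
    rw [← hch, hyn]
    field_simp
  have hB := mk_sqrtCoeff_mul_self (energyCoeff_zero_pos h0.le h1 y)
  have hs : 0 < Real.sqrt (energyCoeff ν y 0) := Real.sqrt_pos.mpr (energyCoeff_zero_pos h0.le h1 y)
  have hAB : A = PowerSeries.mk (sqrtCoeff (energyCoeff ν y)) := by
    refine powerSeries_eq_of_mul_self_eq (hAA.trans hB.symm) ?_ ?_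
    · simp only [hA, PowerSeries.coeff_mk, iteratedDeriv_zero, modeEnergy, pow_zero, one_mul,
        Nat.factorial_zero, Nat.cast_one, div_one]
      have := Real.sqrt_pos.mpr (discriminant_pos h1 (Real.exp_nonneg (Real.log ν)) hc hc')
      positivity
    · rw [PowerSeries.coeff_mk, sqrtCoeff_zero]; exact hs
  have h := congrArg (PowerSeries.coeff n) hAB
  rw [hA, PowerSeries.coeff_mk, PowerSeries.coeff_mk] at h
  have hf : (n.factorial : ℝ) ≠ 0 := by exact_mod_cast Nat.factorial_ne_zero _
  rw [energySqrtCoeff, ← h]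
  field_simp

end Taylor

/-! ### Asymptotics of sums over modes -/

section Sums

/-- The midpoints of the partition of `[0, π]` into `L` intervals: half the wave numbers. -/
def halfAngle (L m : ℕ) : ℝ := (2 * m + 1) * Real.pi / (2 * L)

lemma halfAngle_mem_Ioo {L m : ℕ} (hm : m < L) : halfAngle L m ∈ Set.Ioo 0 Real.pi := by
  have hL : (0 : ℝ) < L := by exact_mod_cast (by omega : 0 < L)
  have hm' : (m : ℝ) + 1 ≤ L := by exact_mod_cast hm
  have hpi := Real.pi_pos
  unfold halfAngle
  constructor
  · positivity
  · rw [div_lt_iff₀ (by positivity)]; nlinarith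

lemma sin_halfAngle_pos {L m : ℕ} (hm : m < L) : 0 < Real.sin (halfAngle L m) :=
  Real.sin_pos_of_mem_Ioo (halfAngle_mem_Ioo hm)

lemma sin_halfAngle_reflect {L m : ℕ} (hm : m < L) :
    Real.sin (halfAngle L (L - 1 - m)) = Real.sin (halfAngle L m) := by
  have hL : (L : ℝ) ≠ 0 := by exact_mod_cast (by omega : L ≠ 0)
  have : ((L - 1 - m : ℕ) : ℝ) = L - 1 - m := by
    rw [Nat.sub_sub, Nat.cast_sub (by omega)]; push_cast; ring
  have h : halfAngle L (L - 1 - m) = Real.pi - halfAngle L m := by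
    unfold halfAngle
    rw [this]; field_simp; ring
  rw [h, Real.sin_pi_sub]

lemma cos_waveNumber_eq (L m : ℕ) :
    Real.cos (waveNumber L m) = 1 - 2 * Real.sin (halfAngle L m) ^ 2 := by
  have : waveNumber L m = 2 * halfAngle L m := by
    unfold waveNumber halfAngle; rw [mul_div_assoc', mul_div_mul_left _ _ two_ne_zero]
  rw [this, Real.cos_two_mul, Real.sin_sq]; ring

/-- The multiplicity of the `m`-th mode when modes are folded at the middle. -/
def foldWeight (L m : ℕ) : ℝ :=
  (if 2 * m + 1 ≤ L then 1 else 0) + if 2 * m + 1 < L then 1 else 0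

lemma foldWeight_nonneg (L m : ℕ) : 0 ≤ foldWeight L m := by
  unfold foldWeight; split_ifs <;> norm_num

lemma foldWeight_le_two (L m : ℕ) : foldWeight L m ≤ 2 := by
  unfold foldWeight; split_ifs <;> norm_num

lemma foldWeight_eq_zero {L m : ℕ} (h : ¬ 2 * m + 1 ≤ L) : foldWeight L m = 0 := by
  unfold foldWeight; rw [if_neg h, if_neg (by omega)]; norm_num

lemma foldWeight_eq_two {L m : ℕ} (h : 2 * m + 1 < L) : foldWeight L m = 2 := by
  unfold foldWeight; rw [if_pos h.le, if_pos h]; norm_num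

/-- Symmetry about the middle restricts the sum to angles at most `π / 2`, where the sine is bounded
below linearly; for odd `L` the middle mode is counted once. -/
lemma sum_fold {L : ℕ} {g : ℕ → ℝ} (hg : ∀ m < L, g (L - 1 - m) = g m) :
    ∑ m ∈ Finset.range L, g m = ∑ m ∈ Finset.range L, foldWeight L m * g m := by
  have h1 : ∑ m ∈ Finset.range L, g m = ∑ m ∈ Finset.range L, (if 2 * m + 1 ≤ L then 1 else 0) * g m
      + ∑ m ∈ Finset.range L, (if L < 2 * m + 1 then 1 else 0) * g m := by
    rw [← Finset.sum_add_distrib]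
    refine Finset.sum_congr rfl fun m _ => ?_
    by_cases h : 2 * m + 1 ≤ L
    · rw [if_pos h, if_neg (by omega)]; ring
    · rw [if_neg h, if_pos (by omega)]; ring
  have h2 : ∑ m ∈ Finset.range L, (if L < 2 * m + 1 then 1 else 0) * g m
      = ∑ m ∈ Finset.range L, (if 2 * m + 1 < L then 1 else 0) * g m := by
    rw [← Finset.sum_range_reflect]
    refine Finset.sum_congr rfl fun m hm => ?_
    rw [Finset.mem_range] at hm
    rw [hg m hm]
    congr 1
    by_cases h : 2 * m + 1 < L
    · rw [if_pos h, if_pos (by omega)]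
    · rw [if_neg h, if_neg (by omega)]
  rw [h1, h2, ← Finset.sum_add_distrib]
  exact Finset.sum_congr rfl fun m _ => by unfold foldWeight; ring

/-- The sum of the inverse `q`-th powers of the gap parameters of the modes. -/
def gapSum (q L : ℕ) : ℝ := ∑ m ∈ Finset.range L, ((Real.sin (halfAngle L m))⁻¹) ^ q

lemma gapSum_eq_fold (q L : ℕ) : gapSum q L
    = ∑ m ∈ Finset.range L, foldWeight L m * ((Real.sin (halfAngle L m))⁻¹) ^ q :=
  sum_fold fun m hm => by rw [sin_halfAngle_reflect hm]

/-- Jordan's inequality `sin x ≥ 2 x / π`. The bound is uniform in `L` and serves as the dominating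
function. -/
lemma le_mul_sin_halfAngle {L m : ℕ} (h : 2 * m + 1 ≤ L) :
    (2 * m + 1 : ℝ) ≤ L * Real.sin (halfAngle L m) := by
  have hL : (0 : ℝ) < L := by exact_mod_cast (by omega : 0 < L)
  have h' : (2 * m + 1 : ℝ) ≤ L := by exact_mod_cast h
  have hpi := Real.pi_pos
  have hx0 : 0 ≤ halfAngle L m := by unfold halfAngle; positivity
  have hx1 : halfAngle L m ≤ Real.pi / 2 := by
    unfold halfAngle
    rw [div_le_div_iff₀ (by positivity) two_pos]
    nlinarith
  have h2 := mul_le_mul_of_nonneg_left (Real.mul_le_sin hx0 hx1) hL.le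
  refine le_trans (le_of_eq ?_) h2
  unfold halfAngle
  field_simp

lemma tendsto_mul_sin_halfAngle (m : ℕ) :
    Tendsto (fun L : ℕ => (L : ℝ) * Real.sin (halfAngle L m)) atTop
      (𝓝 ((2 * m + 1) * Real.pi / 2)) := by
  set θ : ℝ := (2 * m + 1) * Real.pi / 2 with hθ
  have hθ0 : θ ≠ 0 := by have := Real.pi_pos; positivity
  have h1 : Tendsto (fun L : ℕ => θ / (L : ℝ)) atTop (𝓝 0) := tendsto_const_div_atTop_nhds_zero_nat θ
  have h2 : Tendsto (fun L : ℕ => θ * Real.sinc (θ / (L : ℝ))) atTop (𝓝 (θ * Real.sinc 0)) :=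
    ((Real.continuous_sinc.tendsto 0).comp h1).const_mul θ
  rw [Real.sinc_zero, mul_one] at h2
  refine h2.congr' ?_
  filter_upwards [eventually_gt_atTop 0] with L hL
  have hL' : (L : ℝ) ≠ 0 := by exact_mod_cast hL.ne'
  have : halfAngle L m = θ / L := by unfold halfAngle; rw [hθ]; field_simp
  rw [this, Real.sinc_of_ne_zero (by positivity)]
  field_simp

lemma summable_inv_odd_pow {q : ℕ} (hq : 2 ≤ q) :
    Summable fun j : ℕ => ((2 * (j : ℝ) + 1)⁻¹) ^ q := by
  have h : Summable fun n : ℕ => 1 / (n : ℝ) ^ q := Real.summable_one_div_nat_pow.mpr (by omega)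
  have := h.comp_injective (i := fun j : ℕ => 2 * j + 1) (fun a b hab => by simpa using hab)
  refine this.congr fun j => ?_
  simp

/-- Dominated convergence: `L sin` of the `m`-th half-angle tends to `(2 m + 1) π / 2`, the bound
`(2 m + 1)⁻¹ ^ q` is summable for `q ≥ 2`, and the folding weight tends to `2`. -/
lemma tendsto_gapSum_div_pow {q : ℕ} (hq : 2 ≤ q) :
    Tendsto (fun L : ℕ => gapSum q L / (L : ℝ) ^ q) atTop
      (𝓝 (2 * (2 / Real.pi) ^ q * ∑' j : ℕ, ((2 * (j : ℝ) + 1)⁻¹) ^ q)) := by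
  have hlim : Tendsto (fun L : ℕ => ∑' m : ℕ,
      foldWeight L m * (((L : ℝ) * Real.sin (halfAngle L m))⁻¹) ^ q) atTop
      (𝓝 (∑' m : ℕ, 2 * (((2 * (m : ℝ) + 1) * Real.pi / 2)⁻¹) ^ q)) := by
    refine tendsto_tsum_of_dominated_convergence (bound := fun m : ℕ =>
      2 * ((2 * (m : ℝ) + 1)⁻¹) ^ q) ((summable_inv_odd_pow hq).mul_left 2) (fun m => ?_)
      (Eventually.of_forall fun L m => ?_)
    · have h1 : Tendsto (fun L : ℕ => foldWeight L m) atTop (𝓝 2) := by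
        refine tendsto_const_nhds.congr' ?_
        filter_upwards [eventually_gt_atTop (2 * m + 1)] with L hL
        exact (foldWeight_eq_two hL).symm
      have hne : (2 * (m : ℝ) + 1) * Real.pi / 2 ≠ 0 := by have := Real.pi_pos; positivity
      exact h1.mul (((tendsto_mul_sin_halfAngle m).inv₀ hne).pow q)
    · by_cases h : 2 * m + 1 ≤ L
      · have h1 := le_mul_sin_halfAngle h
        have h0 : (0 : ℝ) < 2 * m + 1 := by positivity
        rw [norm_mul, norm_pow, norm_inv, Real.norm_of_nonneg (foldWeight_nonneg L m),
          Real.norm_of_nonneg (h0.le.trans h1)]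
        refine mul_le_mul (foldWeight_le_two L m) ?_
          (pow_nonneg (inv_nonneg.mpr (h0.le.trans h1)) q) (by norm_num)
        exact pow_le_pow_left₀ (inv_nonneg.mpr (h0.le.trans h1)) (inv_anti₀ h0 h1) q
      · rw [foldWeight_eq_zero h, zero_mul, norm_zero]; positivity
  have e1 : ∑' m : ℕ, 2 * (((2 * (m : ℝ) + 1) * Real.pi / 2)⁻¹) ^ q
      = 2 * (2 / Real.pi) ^ q * ∑' j : ℕ, ((2 * (j : ℝ) + 1)⁻¹) ^ q := by
    rw [← tsum_mul_left]
    refine tsum_congr fun m => ?_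
    rw [mul_assoc, ← mul_pow]
    congr 2
    rw [inv_div, mul_comm (2 / Real.pi), ← div_eq_inv_mul, div_div, mul_comm Real.pi]
  rw [← e1]
  refine hlim.congr fun L => ?_
  rw [gapSum_eq_fold, Finset.sum_div, tsum_eq_sum (s := Finset.range L)]
  · refine Finset.sum_congr rfl fun m _ => ?_
    rw [mul_inv, mul_pow, inv_pow (L : ℝ)]; ring
  · intro m hm
    rw [Finset.mem_range] at hm
    rw [foldWeight_eq_zero (by omega), zero_mul]

lemma tsum_inv_odd_pow {q : ℕ} (hq : 2 ≤ q) :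
    ∑' j : ℕ, ((2 * (j : ℝ) + 1)⁻¹) ^ q = (1 - (2⁻¹ : ℝ) ^ q) * (riemannZeta (q : ℂ)).re := by
  have h : Summable fun n : ℕ => 1 / (n : ℝ) ^ q := Real.summable_one_div_nat_pow.mpr (by omega)
  have hz : (riemannZeta (q : ℂ)).re = ∑' n : ℕ, 1 / (n : ℝ) ^ q := by
    rw [zeta_nat_eq_tsum_of_gt_one (by omega)]
    have : ∑' n : ℕ, 1 / (n : ℂ) ^ q = ((∑' n : ℕ, 1 / (n : ℝ) ^ q : ℝ) : ℂ) := by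
      rw [Complex.ofReal_tsum]
      exact tsum_congr fun n => by push_cast; rfl
    rw [this, Complex.ofReal_re]
  have hodd : Summable fun k : ℕ => 1 / ((2 * k + 1 : ℕ) : ℝ) ^ q :=
    h.comp_injective (i := fun j : ℕ => 2 * j + 1) (fun a b hab => by simpa using hab)
  have heven : Summable fun k : ℕ => 1 / ((2 * k : ℕ) : ℝ) ^ q :=
    h.comp_injective (i := fun j : ℕ => 2 * j) (fun a b hab => by simpa using hab)
  have hsplit := tsum_even_add_odd (f := fun n : ℕ => 1 / (n : ℝ) ^ q) heven hodd
  have he : ∑' k : ℕ, 1 / ((2 * k : ℕ) : ℝ) ^ q = (2⁻¹ : ℝ) ^ q * ∑' n : ℕ, 1 / (n : ℝ) ^ q := by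
    rw [← tsum_mul_left]
    refine tsum_congr fun k => ?_
    push_cast
    rw [mul_pow, inv_pow, one_div, one_div, mul_inv]
  have ho : ∑' k : ℕ, 1 / ((2 * k + 1 : ℕ) : ℝ) ^ q = ∑' j : ℕ, ((2 * (j : ℝ) + 1)⁻¹) ^ q :=
    tsum_congr fun k => by push_cast; rw [inv_pow, one_div]
  rw [he, ho] at hsplit
  rw [hz]
  linarith

/-- Telescoping with `log (1 + x) ≤ x` for `x = 2 / (2 M + 1)`. For `q = 1` the limiting series
diverges, and such two-sided logarithmic bounds take the place of dominated convergence. -/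
lemma log_le_sum_inv_odd (M : ℕ) :
    (1 / 2) * Real.log (2 * M + 1) ≤ ∑ m ∈ Finset.range M, (2 * (m : ℝ) + 1)⁻¹ := by
  induction M with
  | zero => simp
  | succ M ih =>
    rw [Finset.sum_range_succ]
    have h0 : (0 : ℝ) < 2 * M + 1 := by positivity
    have h1 : (2 * ((M + 1 : ℕ) : ℝ) + 1) = (2 * M + 1) * (1 + 2 * (2 * (M : ℝ) + 1)⁻¹) := by
      push_cast; field_simp; ring
    have h3 := Real.log_le_sub_one_of_pos (show 0 < 1 + 2 * (2 * (M : ℝ) + 1)⁻¹ by positivity)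
    rw [h1, Real.log_mul h0.ne' (by positivity)]
    linarith

lemma sum_inv_odd_le_log {M : ℕ} (hM : 1 ≤ M) :
    ∑ m ∈ Finset.range M, (2 * (m : ℝ) + 1)⁻¹ ≤ 1 + (1 / 2) * Real.log (2 * M - 1) := by
  induction M, hM using Nat.le_induction with
  | base => norm_num
  | succ M hM ih =>
    rw [Finset.sum_range_succ]
    have hM' : (1 : ℝ) ≤ M := by exact_mod_cast hM
    have h0 : (0 : ℝ) < 2 * M + 1 := by positivity
    have hm : (0 : ℝ) < 2 * M - 1 := by linarith
    have h1 : (2 * (M : ℝ) - 1) = (2 * M + 1) * (1 - 2 * (2 * (M : ℝ) + 1)⁻¹) := by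
      field_simp; ring
    have hp : 0 < 1 - 2 * (2 * (M : ℝ) + 1)⁻¹ := by
      rw [h1] at hm
      exact pos_of_mul_pos_right hm h0.le
    have h3 := Real.log_le_sub_one_of_pos hp
    rw [h1, Real.log_mul h0.ne' hp.ne'] at ih
    have : (2 * ((M + 1 : ℕ) : ℝ) - 1) = 2 * M + 1 := by push_cast; ring
    rw [this]
    linarith

lemma sum_foldWeight_mul {L : ℕ} (g : ℕ → ℝ) : ∑ m ∈ Finset.range L, foldWeight L m * g m
    = ∑ m ∈ Finset.range ((L + 1) / 2), g m + ∑ m ∈ Finset.range (L / 2), g m := by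
  unfold foldWeight
  simp only [add_mul, ite_mul, one_mul, zero_mul, Finset.sum_add_distrib, ← Finset.sum_filter]
  congr 2
  · ext m; simp only [Finset.mem_filter, Finset.mem_range]; omega
  · ext m; simp only [Finset.mem_filter, Finset.mem_range]; omega

/-- Replacing the sine by its argument costs a bounded error per mode, hence `O(L)` in total,
negligible against `L log L`. -/
lemma inv_sin_le {x : ℝ} (h0 : 0 < x) (h1 : x ≤ Real.pi / 2) : (Real.sin x)⁻¹ ≤ x⁻¹ + 1 := by
  have hpi := Real.pi_pos
  have hs : x / (1 + x) ≤ Real.sin x := by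
    -- Below `1` the cubic lower bound for the sine suffices; above `1` Jordan's inequality does,
    -- because `π ≤ 4`.
    rcases le_or_gt x 1 with h | h
    · refine le_trans ?_ (Real.sin_gt_sub_cube h0).le
      rw [div_le_iff₀ (by positivity)]
      have h3 : x ^ 3 ≤ x ^ 2 := pow_le_pow_of_le_one h0.le h (by norm_num)
      have h4 : x ^ 4 ≤ x ^ 2 := pow_le_pow_of_le_one h0.le h (by norm_num)
      nlinarith [sq_nonneg x]
    · refine le_trans ?_ (Real.mul_le_sin h0.le h1)
      rw [div_le_iff₀ (by positivity), div_mul_eq_mul_div, div_mul_eq_mul_div, le_div_iff₀ hpi]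
      nlinarith [Real.pi_le_four]
  have : x⁻¹ + 1 = (x / (1 + x))⁻¹ := by field_simp
  rw [this]
  exact inv_anti₀ (by positivity) hs

lemma gapSum_one_bounds {L : ℕ} (hL : 2 ≤ L) :
    2 * L / Real.pi * Real.log L ≤ gapSum 1 L ∧
    gapSum 1 L ≤ 2 * L / Real.pi * (2 + Real.log L) + 2 * L := by
  have hLp : (0 : ℝ) < L := by exact_mod_cast (by omega : 0 < L)
  have hpi := Real.pi_pos
  have hsum : ∑ m ∈ Finset.range L, foldWeight L m * (halfAngle L m)⁻¹
      = 2 * L / Real.pi * (∑ m ∈ Finset.range ((L + 1) / 2), (2 * (m : ℝ) + 1)⁻¹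
        + ∑ m ∈ Finset.range (L / 2), (2 * (m : ℝ) + 1)⁻¹) := by
    rw [← sum_foldWeight_mul, Finset.mul_sum]
    refine Finset.sum_congr rfl fun m _ => ?_
    unfold halfAngle
    have : (2 * (m : ℝ) + 1) ≠ 0 := by positivity
    field_simp
  have hb1 : (L : ℝ) ≤ 2 * (((L + 1) / 2 : ℕ) : ℝ) + 1 := by
    exact_mod_cast (by omega : L ≤ 2 * ((L + 1) / 2) + 1)
  have hb2 : (L : ℝ) ≤ 2 * ((L / 2 : ℕ) : ℝ) + 1 := by
    exact_mod_cast (by omega : L ≤ 2 * (L / 2) + 1)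
  have hb3 : 2 * (((L + 1) / 2 : ℕ) : ℝ) - 1 ≤ (L : ℝ) := by
    have : 2 * (((L + 1) / 2 : ℕ) : ℝ) ≤ (L : ℝ) + 1 := by
      exact_mod_cast (by omega : 2 * ((L + 1) / 2) ≤ L + 1)
    linarith
  have hb4 : 2 * ((L / 2 : ℕ) : ℝ) - 1 ≤ (L : ℝ) := by
    have : 2 * ((L / 2 : ℕ) : ℝ) ≤ (L : ℝ) := by exact_mod_cast (by omega : 2 * (L / 2) ≤ L)
    linarith
  have hb5 : (1 : ℝ) ≤ (((L + 1) / 2 : ℕ) : ℝ) := by exact_mod_cast (by omega : 1 ≤ (L + 1) / 2)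
  have hb6 : (1 : ℝ) ≤ ((L / 2 : ℕ) : ℝ) := by exact_mod_cast (by omega : 1 ≤ L / 2)
  have hc : 0 ≤ 2 * L / Real.pi := by positivity
  rw [gapSum_eq_fold]
  simp only [pow_one]
  constructor
  · have h1 := log_le_sum_inv_odd ((L + 1) / 2)
    have h2 := log_le_sum_inv_odd (L / 2)
    have h3 := Real.log_le_log hLp hb1
    have h4 := Real.log_le_log hLp hb2
    calc 2 * L / Real.pi * Real.log L
        ≤ ∑ m ∈ Finset.range L, foldWeight L m * (halfAngle L m)⁻¹ := by
          rw [hsum]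
          exact mul_le_mul_of_nonneg_left (by linarith) hc
      _ ≤ _ := by
          refine Finset.sum_le_sum fun m hm => mul_le_mul_of_nonneg_left ?_ (foldWeight_nonneg L m)
          have hm' := Finset.mem_range.mp hm
          exact inv_anti₀ (sin_halfAngle_pos hm') (Real.sin_le (halfAngle_mem_Ioo hm').1.le)
  · have h1 := sum_inv_odd_le_log (M := (L + 1) / 2) (by omega)
    have h2 := sum_inv_odd_le_log (M := L / 2) (by omega)
    have h3 := Real.log_le_log (by linarith) hb3
    have h4 := Real.log_le_log (by linarith) hb4
    calc ∑ m ∈ Finset.range L, foldWeight L m * (Real.sin (halfAngle L m))⁻¹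
        ≤ ∑ m ∈ Finset.range L, (foldWeight L m * (halfAngle L m)⁻¹ + 2) := by
          refine Finset.sum_le_sum fun m hm => ?_
          have hm' := Finset.mem_range.mp hm
          by_cases h : 2 * m + 1 ≤ L
          · have hx1 : halfAngle L m ≤ Real.pi / 2 := by
              have h' : (2 * m + 1 : ℝ) ≤ L := by exact_mod_cast h
              unfold halfAngle
              rw [div_le_div_iff₀ (by positivity) two_pos]
              nlinarith
            have h5 := mul_le_mul_of_nonneg_left (inv_sin_le (halfAngle_mem_Ioo hm').1 hx1)
              (foldWeight_nonneg L m)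
            linarith [foldWeight_le_two L m]
          · rw [foldWeight_eq_zero h]; norm_num
      _ = 2 * L / Real.pi * (∑ m ∈ Finset.range ((L + 1) / 2), (2 * (m : ℝ) + 1)⁻¹
        + ∑ m ∈ Finset.range (L / 2), (2 * (m : ℝ) + 1)⁻¹) + 2 * L := by
          rw [Finset.sum_add_distrib, hsum, Finset.sum_const, Finset.card_range, nsmul_eq_mul,
            mul_comm (L : ℝ) 2]
      _ ≤ _ := by
          have := mul_le_mul_of_nonneg_left (show ∑ m ∈ Finset.range ((L + 1) / 2),
            (2 * (m : ℝ) + 1)⁻¹ + ∑ m ∈ Finset.range (L / 2), (2 * (m : ℝ) + 1)⁻¹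
              ≤ 2 + Real.log L by linarith) hc
          linarith

lemma tendsto_log_natCast_atTop : Tendsto (fun L : ℕ => Real.log (L : ℝ)) atTop atTop :=
  Real.tendsto_log_atTop.comp tendsto_natCast_atTop_atTop

lemma tendsto_gapSum_one : Tendsto (fun L : ℕ => gapSum 1 L / (L * Real.log L)) atTop
    (𝓝 (2 / Real.pi)) := by
  have hpi := Real.pi_pos
  have hinv : Tendsto (fun L : ℕ => (Real.log (L : ℝ))⁻¹) atTop (𝓝 0) :=
    tendsto_inv_atTop_zero.comp tendsto_log_natCast_atTop
  have hup : Tendsto (fun L : ℕ => 2 / Real.pi + (4 / Real.pi + 2) * (Real.log (L : ℝ))⁻¹) atTop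
      (𝓝 (2 / Real.pi)) := by
    have := (hinv.const_mul (4 / Real.pi + 2)).const_add (2 / Real.pi)
    simpa using this
  refine tendsto_of_tendsto_of_tendsto_of_le_of_le' tendsto_const_nhds hup ?_ ?_
  all_goals
    filter_upwards [eventually_ge_atTop 2, tendsto_log_natCast_atTop.eventually_gt_atTop 0]
      with L hL hlog
    have hLp : (0 : ℝ) < L := by exact_mod_cast (by omega : 0 < L)
    obtain ⟨h1, h2⟩ := gapSum_one_bounds hL
  · rw [le_div_iff₀ (by positivity)]
    refine le_trans (le_of_eq ?_) h1
    ring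
  · rw [div_le_iff₀ (by positivity)]
    refine le_trans h2 (le_of_eq ?_)
    field_simp
    ring

/-- The weighted sums concentrate on the modes with small gap. -/
lemma tendsto_weighted_gapSum {q : ℕ} {N : ℕ → ℝ} {c : ℝ} {g : ℝ → ℝ}
    (hg : ContinuousOn g (Set.Icc 0 1)) (hN : ∀ᶠ L in atTop, 0 < N L)
    (hLN : Tendsto (fun L : ℕ => (L : ℝ) / N L) atTop (𝓝 0))
    (hW : Tendsto (fun L : ℕ => gapSum q L / N L) atTop (𝓝 c)) :
    Tendsto (fun L : ℕ => (∑ m ∈ Finset.range L, ((Real.sin (halfAngle L m))⁻¹) ^ q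
      * g (Real.sin (halfAngle L m))) / N L) atTop (𝓝 (c * g 0)) := by
  have hmain : Tendsto (fun L : ℕ => (∑ m ∈ Finset.range L, ((Real.sin (halfAngle L m))⁻¹) ^ q
      * (g (Real.sin (halfAngle L m)) - g 0)) / N L) atTop (𝓝 0) := by
    obtain ⟨M, hM⟩ := isCompact_Icc.exists_bound_of_continuousOn
      (hg.sub (continuousOn_const (c := g 0)))
    have hM0 : 0 ≤ M := (norm_nonneg _).trans (hM 0 ⟨le_rfl, zero_le_one⟩)
    rw [Metric.tendsto_atTop']
    intro ε hε
    -- Chosen so that `ε₁ (|c| + 1) = ε / 2`, as the normalized gap sum is eventually below `|c| +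
    -- 1`.
    set ε₁ : ℝ := ε / (2 * (|c| + 1)) with hε₁
    have hcp : 0 < |c| + 1 := by positivity
    have hε₁p : 0 < ε₁ := by positivity
    obtain ⟨δ, hδ, hδg⟩ := Metric.continuousWithinAt_iff.mp (hg 0 ⟨le_rfl, zero_le_one⟩) ε₁ hε₁p
    -- Modes with gap parameter below `δ` have `g` within `ε₁` of `g 0`. Each remaining mode
    -- contributes a bounded amount, at most `O(L)` altogether, and `L / N L` tends to zero.
    have hbound : ∀ L : ℕ, |∑ m ∈ Finset.range L, ((Real.sin (halfAngle L m))⁻¹) ^ q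
        * (g (Real.sin (halfAngle L m)) - g 0)| ≤ ε₁ * gapSum q L + L * (δ⁻¹ ^ q * M) := by
      intro L
      have hterm : ∀ m ∈ Finset.range L, |((Real.sin (halfAngle L m))⁻¹) ^ q
          * (g (Real.sin (halfAngle L m)) - g 0)|
          ≤ ε₁ * ((Real.sin (halfAngle L m))⁻¹) ^ q + δ⁻¹ ^ q * M := by
        intro m hm
        have hy := sin_halfAngle_pos (Finset.mem_range.mp hm)
        set y := Real.sin (halfAngle L m) with hyd
        have hy1 : y ≤ 1 := Real.sin_le_one _
        have hyq : 0 ≤ (y⁻¹) ^ q := by positivity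
        rw [abs_mul, abs_of_nonneg hyq]
        have hgM : |g y - g 0| ≤ M := hM y ⟨hy.le, hy1⟩
        rcases lt_or_ge y δ with h | h
        · have h1 := hδg (x := y) ⟨hy.le, hy1⟩ (by rwa [Real.dist_eq, sub_zero, abs_of_pos hy])
          rw [Real.dist_eq] at h1
          have h2 := mul_le_mul_of_nonneg_left h1.le hyq
          have h3 : 0 ≤ δ⁻¹ ^ q * M := by positivity
          linarith
        · have h1 : (y⁻¹) ^ q ≤ δ⁻¹ ^ q := pow_le_pow_left₀ (by positivity) (inv_anti₀ hδ h) q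
          have h2 := mul_le_mul h1 hgM (abs_nonneg _) (by positivity)
          have h3 : 0 ≤ ε₁ * (y⁻¹) ^ q := by positivity
          linarith
      refine (Finset.abs_sum_le_sum_abs _ _).trans ((Finset.sum_le_sum hterm).trans (le_of_eq ?_))
      rw [Finset.sum_add_distrib, ← Finset.mul_sum, Finset.sum_const, Finset.card_range,
        nsmul_eq_mul]
      rfl
    have hW1 : ∀ᶠ L in atTop, gapSum q L / N L < |c| + 1 :=
      hW.eventually_lt_const (by linarith [le_abs_self c])
    have hL1 : ∀ᶠ L : ℕ in atTop, (L : ℝ) / N L * (δ⁻¹ ^ q * M) < ε / 2 := by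
      have := hLN.mul_const (δ⁻¹ ^ q * M)
      rw [zero_mul] at this
      exact this.eventually_lt_const (by positivity)
    obtain ⟨L₀, hL₀⟩ := eventually_atTop.mp (hN.and (hW1.and hL1))
    refine ⟨L₀, fun L hL => ?_⟩
    obtain ⟨h1, h2, h3⟩ := hL₀ L (le_of_lt hL)
    rw [Real.dist_eq, sub_zero, abs_div, abs_of_pos h1]
    have h4 := div_le_div_of_nonneg_right (hbound L) h1.le
    have h5 : (ε₁ * gapSum q L + L * (δ⁻¹ ^ q * M)) / N L
        = ε₁ * (gapSum q L / N L) + (L : ℝ) / N L * (δ⁻¹ ^ q * M) := by ring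
    have h6 := mul_lt_mul_of_pos_left h2 hε₁p
    have h7 : ε₁ * (|c| + 1) = ε / 2 := by rw [hε₁]; field_simp
    linarith
  have h := hmain.add (hW.mul_const (g 0))
  rw [zero_add] at h
  refine h.congr fun L => ?_
  simp only [mul_sub, Finset.sum_sub_distrib, gapSum, ← Finset.sum_mul]
  ring

/-- Convergence of midpoint sums on `[0, π]`. -/
lemma tendsto_midpoint_sum {Φ h : ℝ → ℝ} (hΦ : ∀ x, HasDerivAt Φ (h x) x) (hh : Continuous h) :
    Tendsto (fun L : ℕ => (∑ m ∈ Finset.range L, h (halfAngle L m)) / L) atTop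
      (𝓝 ((Φ Real.pi - Φ 0) / Real.pi)) := by
  have hpi := Real.pi_pos
  have huc := isCompact_Icc.uniformContinuousOn_of_continuous (s := Set.Icc 0 Real.pi) hh.continuousOn
  rw [Metric.tendsto_atTop]
  intro ε hε
  obtain ⟨δ, hδ, hδh⟩ := Metric.uniformContinuousOn_iff.mp huc (ε / 2) (by positivity)
  obtain ⟨L₀, hL₀⟩ := exists_nat_gt (Real.pi / δ)
  refine ⟨L₀ + 1, fun L hL => ?_⟩
  have hLp : (0 : ℝ) < L := by exact_mod_cast (by omega : 0 < L)
  have hLδ : Real.pi / L < δ := by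
    rw [div_lt_iff₀ hLp, mul_comm, ← div_lt_iff₀ hδ]
    exact hL₀.trans (by exact_mod_cast (by omega : L₀ < L))
  -- The increment of the primitive is split over the `L` cells. In each cell the mean value theorem
  -- gives a value of `h` at a point closer than `δ` to the midpoint.
  have htel : Φ Real.pi - Φ 0 = ∑ m ∈ Finset.range L,
      (Φ ((m + 1 : ℕ) * Real.pi / L) - Φ (m * Real.pi / L)) := by
    rw [Finset.sum_range_sub (fun m : ℕ => Φ (m * Real.pi / L))]
    rw [mul_div_cancel_left₀ _ hLp.ne']
    simp
  have hterm : ∀ m ∈ Finset.range L, |h (halfAngle L m) / L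
      - (Φ ((m + 1 : ℕ) * Real.pi / L) - Φ (m * Real.pi / L)) / Real.pi| ≤ ε / 2 / L := by
    intro m hm
    rw [Finset.mem_range] at hm
    have hm1 : (m : ℝ) + 1 ≤ L := by exact_mod_cast hm
    have hlt : (m : ℝ) * Real.pi / L < (m + 1 : ℕ) * Real.pi / L := by
      push_cast
      exact div_lt_div_of_pos_right (by nlinarith) hLp
    obtain ⟨ξ, hξ, hξe⟩ := exists_hasDerivAt_eq_slope Φ h hlt
      (fun x _ => (hΦ x).continuousAt.continuousWithinAt) (fun x _ => hΦ x)
    have hdiff : ((m + 1 : ℕ) : ℝ) * Real.pi / L - m * Real.pi / L = Real.pi / L := by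
      push_cast; ring
    rw [hdiff, eq_div_iff (by positivity)] at hξe
    rw [← hξe]
    have e : h (halfAngle L m) / L - h ξ * (Real.pi / L) / Real.pi
        = (h (halfAngle L m) - h ξ) / L := by field_simp
    rw [e, abs_div, abs_of_pos hLp]
    refine div_le_div_of_nonneg_right ?_ hLp.le
    have hθ := halfAngle_mem_Ioo hm
    have hξ0 : 0 ≤ ξ := le_trans (by positivity) hξ.1.le
    have hξ1 : ξ ≤ Real.pi := by
      refine hξ.2.le.trans ?_
      rw [div_le_iff₀ hLp]
      push_cast
      nlinarith
    have hclose : dist (halfAngle L m) ξ < δ := by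
      refine lt_of_lt_of_le ?_ hLδ.le
      have e1 : halfAngle L m = m * Real.pi / L + Real.pi / L / 2 := by
        unfold halfAngle; field_simp
      have e2 : halfAngle L m = (m + 1 : ℕ) * Real.pi / L - Real.pi / L / 2 := by
        unfold halfAngle; push_cast; field_simp; ring
      have hpL : 0 < Real.pi / L := by positivity
      rw [Real.dist_eq, abs_lt]
      constructor
      · linarith [hξ.2]
      · linarith [hξ.1]
    have := hδh _ ⟨hθ.1.le, hθ.2.le⟩ _ ⟨hξ0, hξ1⟩ hclose
    rw [Real.dist_eq] at this
    exact this.le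
  rw [Real.dist_eq, htel, Finset.sum_div, Finset.sum_div, ← Finset.sum_sub_distrib]
  refine lt_of_le_of_lt ((Finset.abs_sum_le_sum_abs _ _).trans (Finset.sum_le_sum hterm)) ?_
  rw [Finset.sum_const, Finset.card_range, nsmul_eq_mul, mul_div_cancel₀ _ hLp.ne']
  linarith

end Sums

/-! ### Smoothness and cumulants as sums over modes -/

section Cumulants

variable {ν : ℝ} {L : ℕ}

lemma K_eq_sum_modeEnergy (h1 : ν < 1) (hL : 2 ≤ L) : K ν L = fun s => (1 / (2 * (L : ℝ))) *
    ∑ m ∈ Finset.range L, modeEnergy ν (Real.cos (waveNumber L m)) s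
      - (depositionRate ν + 1 / 2) := by
  funext s
  exact K_eq h1 hL s

lemma contDiff_sum_modeEnergy (h1 : ν < 1) (L : ℕ) : ContDiff ℝ (⊤ : ℕ∞) fun s =>
    ∑ m ∈ Finset.range L, modeEnergy ν (Real.cos (waveNumber L m)) s :=
  ContDiff.sum fun _ hm => contDiff_modeEnergy h1 (cos_waveNumber_lt_one (Finset.mem_range.mp hm))
    (Real.neg_one_le_cos _)

lemma contDiff_K (h1 : ν < 1) (hL : 2 ≤ L) : ContDiff ℝ (⊤ : ℕ∞) (K ν L) := by
  rw [K_eq_sum_modeEnergy h1 hL]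
  exact (contDiff_const.mul (contDiff_sum_modeEnergy h1 L)).sub contDiff_const

lemma cumulant_eq_sum (h1 : ν < 1) (hL : 2 ≤ L) (n : ℕ) (s : ℝ) :
    cumulant (1 / 2) (depositionRate ν) L (n + 1) s = (1 / (2 * (L : ℝ))) *
      ∑ m ∈ Finset.range L, iteratedDeriv (n + 1) (modeEnergy ν (Real.cos (waveNumber L m))) s := by
  have hK : cumulant (1 / 2) (depositionRate ν) L (n + 1) s = iteratedDeriv (n + 1) (K ν L) s := rfl
  have hmode : ∀ m ∈ Finset.range L, ContDiffAt ℝ ((n + 1 : ℕ) : WithTop ℕ∞)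
      (modeEnergy ν (Real.cos (waveNumber L m))) s := fun m hm =>
    ((contDiff_modeEnergy h1 (cos_waveNumber_lt_one (Finset.mem_range.mp hm))
      (Real.neg_one_le_cos _)).of_le (by exact_mod_cast le_top)).contDiffAt
  rw [hK, K_eq_sum_modeEnergy h1 hL]
  -- The order is at least one, so the additive constant is removed by the first derivative.
  have hd : deriv (fun s => (1 / (2 * (L : ℝ))) *
      ∑ m ∈ Finset.range L, modeEnergy ν (Real.cos (waveNumber L m)) s
      - (depositionRate ν + 1 / 2)) = deriv (fun s => (1 / (2 * (L : ℝ))) *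
      ∑ m ∈ Finset.range L, modeEnergy ν (Real.cos (waveNumber L m)) s) := by
    funext s
    exact deriv_sub_const _
  rw [iteratedDeriv_succ', hd, ← iteratedDeriv_succ', iteratedDeriv_const_mul_field,
    iteratedDeriv_fun_sum hmode]

end Cumulants

/-! ### Cumulants at the critical point, including `ν = 0` -/

section Atbot

/-- By the chain rule the first derivative acquires a factor `exp s`, which persists:
differentiating `u g(u)` with `u = exp s` gives `u (g + u g')`. -/
lemma exists_iteratedDeriv_comp_exp {G : ℝ → ℝ} {U : Set ℝ} (hU : IsOpen U)
    (hexp : ∀ s, Real.exp s ∈ U) (hG : ContDiffOn ℝ (⊤ : ℕ∞) G U) (n : ℕ) :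
    ∃ g : ℝ → ℝ, ContDiffOn ℝ (⊤ : ℕ∞) g U ∧
      iteratedDeriv (n + 1) (fun s => G (Real.exp s)) = fun s => Real.exp s * g (Real.exp s) := by
  have key : ∀ {g : ℝ → ℝ}, ContDiffOn ℝ (⊤ : ℕ∞) g U → ContDiffOn ℝ (⊤ : ℕ∞) (deriv g) U ∧
      ∀ s, HasDerivAt (fun s => g (Real.exp s)) (deriv g (Real.exp s) * Real.exp s) s := by
    intro g hg
    obtain ⟨hd, hd'⟩ := (contDiffOn_infty_iff_deriv_of_isOpen hU).mp hg
    refine ⟨hd', fun s => ?_⟩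
    have h := (hd.differentiableAt (hU.mem_nhds (hexp s))).hasDerivAt
    exact h.comp s (Real.hasDerivAt_exp s)
  induction n with
  | zero =>
    refine ⟨deriv G, (key hG).1, ?_⟩
    rw [zero_add, iteratedDeriv_one]
    funext s
    rw [((key hG).2 s).deriv, mul_comm]
  | succ n ih =>
    obtain ⟨g, hg, he⟩ := ih
    refine ⟨fun u => g u + u * deriv g u, hg.add (contDiffOn_id.mul (key hg).1), ?_⟩
    rw [iteratedDeriv_succ, he]
    funext s
    have h := ((Real.hasDerivAt_exp s).mul ((key hg).2 s)).deriv
    refine Eq.trans h ?_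
    ring

/-- For `ν = 0` the discriminant is still positive at `u = 0`, so the cofactor of `exp s` stays
continuous there and the factor `exp s` forces the limit `0`. -/
lemma tendsto_iteratedDeriv_modeEnergy_zero {c : ℝ} (hc : c < 1) (hc' : -1 ≤ c) (n : ℕ) :
    Tendsto (iteratedDeriv (n + 1) (modeEnergy 0 c)) atBot (𝓝 0) := by
  have hcont : Continuous fun u => discriminant 0 u c := by unfold discriminant; fun_prop
  have hU : IsOpen {u | 0 < discriminant 0 u c} := isOpen_lt continuous_const hcont
  have h0 : (0 : ℝ) ∈ {u | 0 < discriminant 0 u c} :=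
    discriminant_pos zero_lt_one le_rfl hc hc'
  have hG : ContDiffOn ℝ (⊤ : ℕ∞) (fun u => Real.sqrt (discriminant 0 u c))
      {u | 0 < discriminant 0 u c} := by
    refine ContDiffOn.sqrt ?_ fun u hu => (ne_of_gt hu)
    unfold discriminant
    fun_prop
  obtain ⟨g, hg, he⟩ := exists_iteratedDeriv_comp_exp hU
    (fun s => discriminant_pos zero_lt_one (Real.exp_nonneg s) hc hc') hG n
  have h1 : Tendsto (fun s => Real.exp s * g (Real.exp s)) atBot (𝓝 (0 * g 0)) :=
    Real.tendsto_exp_atBot.mul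
      ((hg.continuousOn.continuousAt (hU.mem_nhds h0)).tendsto.comp Real.tendsto_exp_atBot)
  rw [zero_mul, ← he] at h1
  exact h1

lemma tendsto_cumulant_zero {L : ℕ} (hL : 2 ≤ L) {n : ℕ} (hn : 1 ≤ n) :
    Tendsto (cumulant (1 / 2) (depositionRate 0) L n) atBot (𝓝 0) := by
  obtain ⟨n, rfl⟩ := Nat.exists_eq_add_of_le' hn
  have h : Tendsto (fun s => (1 / (2 * (L : ℝ))) * ∑ m ∈ Finset.range L,
      iteratedDeriv (n + 1) (modeEnergy 0 (Real.cos (waveNumber L m))) s) atBot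
      (𝓝 ((1 / (2 * (L : ℝ))) * ∑ m ∈ Finset.range L, 0)) :=
    (tendsto_finsetSum _ fun m hm => tendsto_iteratedDeriv_modeEnergy_zero
      (cos_waveNumber_lt_one (Finset.mem_range.mp hm)) (Real.neg_one_le_cos _) n).const_mul _
  rw [Finset.sum_const_zero, mul_zero] at h
  exact h.congr fun s => (cumulant_eq_sum zero_lt_one hL n s).symm

lemma criticalCumulant_zero {L : ℕ} (hL : 2 ≤ L) {n : ℕ} (hn : 1 ≤ n) :
    criticalCumulant 0 n L = 0 := by
  rw [criticalCumulant, if_pos rfl]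
  exact (tendsto_cumulant_zero hL hn).limUnder_eq

lemma criticalPoint_depositionRate (ν : ℝ) :
    criticalPoint (1 / 2) (depositionRate ν) = Real.log ν := by
  unfold criticalPoint depositionRate
  congr 1
  ring

lemma criticalCumulant_eq {ν : ℝ} (h0 : 0 < ν) (h1 : ν < 1) {L : ℕ} (hL : 2 ≤ L) {n : ℕ}
    (hn : 1 ≤ n) : criticalCumulant ν n L = (n.factorial : ℝ) / 2 *
      ((∑ m ∈ Finset.range L, Real.sin (halfAngle L m) / Real.sin (halfAngle L m) ^ n
        * energySqrtCoeff ν n (Real.sin (halfAngle L m))) / L) := by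
  obtain ⟨n, rfl⟩ := Nat.exists_eq_add_of_le' hn
  rw [criticalCumulant, if_neg h0.ne', criticalPoint_depositionRate, cumulant_eq_sum h1 hL]
  have : ∀ m ∈ Finset.range L,
      iteratedDeriv (n + 1) (modeEnergy ν (Real.cos (waveNumber L m))) (Real.log ν)
      = ((n + 1).factorial : ℝ) * (Real.sin (halfAngle L m) / Real.sin (halfAngle L m) ^ (n + 1)
        * energySqrtCoeff ν (n + 1) (Real.sin (halfAngle L m))) := by
    intro m hm
    rw [cos_waveNumber_eq, modeEnergy_taylor h0 h1 (sin_halfAngle_pos (Finset.mem_range.mp hm))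
      (Real.sin_le_one _), mul_assoc]
  rw [Finset.sum_congr rfl this, ← Finset.mul_sum]
  field_simp

end Atbot

/-! ### Limits of the rescaled cumulants of order at least two -/

section Limits

variable {ν : ℝ}

/-- The order of growth of the cumulants of orders `2 n` and `2 n + 1`. -/
def growthScale (n L : ℕ) : ℝ := if n = 1 then Real.log L else (L : ℝ) ^ (2 * n - 2)

lemma tendsto_growthScale {n : ℕ} (hn : 1 ≤ n) : Tendsto (growthScale n) atTop atTop := by
  unfold growthScale
  split_ifs with h
  · exact tendsto_log_natCast_atTop
  · exact (tendsto_pow_atTop (by omega)).comp tendsto_natCast_atTop_atTop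

/-- The coefficient `alpha n` is this limit up to the factor `4 ^ n = 2 * 2 ^ (2 n - 1)`. The odd
terms of the zeta series supply `1 - 2 ^ (1 - 2 n)`. -/
lemma tendsto_gapSum_growthScale {n : ℕ} (hn : 1 ≤ n) :
    Tendsto (fun L : ℕ => gapSum (2 * n - 1) L / (L * growthScale n L)) atTop
      (𝓝 (4 ^ n * alpha n)) := by
  rcases eq_or_ne n 1 with rfl | h
  · have h := tendsto_gapSum_one
    have e : (4 : ℝ) ^ 1 * alpha 1 = 2 / Real.pi := by
      rw [alpha, if_pos rfl]; field_simp; norm_num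
    rw [e]
    exact h
  · have hq : 2 ≤ 2 * n - 1 := by omega
    have h1 := tendsto_gapSum_div_pow hq
    have e : (4 : ℝ) ^ n * alpha n = 2 * (2 / Real.pi) ^ (2 * n - 1) *
        ∑' j : ℕ, ((2 * (j : ℝ) + 1)⁻¹) ^ (2 * n - 1) := by
      rw [tsum_inv_odd_pow hq, alpha, if_neg h]
      have hc : ((2 * n - 1 : ℕ) : ℂ) = 2 * (n : ℂ) - 1 := by
        rw [Nat.cast_sub (by omega)]; push_cast; ring
      have hz : (2 : ℝ) ^ (1 - 2 * (n : ℤ)) = (2⁻¹ : ℝ) ^ (2 * n - 1) := by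
        rw [← zpow_natCast, inv_zpow', Nat.cast_sub (by omega)]
        congr 1
        push_cast
        ring
      have h4 : (4 : ℝ) ^ n = 2 * 2 ^ (2 * n - 1) := by
        rw [← pow_succ', show 2 * n - 1 + 1 = 2 * n by omega, pow_mul]; norm_num
      rw [hc, hz, h4, div_pow]
      ring
    rw [e]
    refine h1.congr fun L => ?_
    rw [growthScale, if_neg h, ← pow_succ', show 2 * n - 2 + 1 = 2 * n - 1 by omega]

/-- By uniqueness of limits `4 ^ n * alpha n` is a positive multiple of a series of positive terms,
so no estimate of the zeta function is needed. -/
lemma alpha_ne_zero {n : ℕ} (hn : 1 ≤ n) : alpha n ≠ 0 := by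
  have hpi := Real.pi_pos
  rcases eq_or_ne n 1 with rfl | h
  · rw [alpha, if_pos rfl]; positivity
  · have hq : 2 ≤ 2 * n - 1 := by omega
    have hpos : 0 < ∑' j : ℕ, ((2 * (j : ℝ) + 1)⁻¹) ^ (2 * n - 1) :=
      (summable_inv_odd_pow hq).tsum_pos (fun j => by positivity) 0 (by positivity)
    have h1 := tendsto_nhds_unique (tendsto_gapSum_div_pow hq)
      ((tendsto_gapSum_growthScale hn).congr fun L => by
        rw [growthScale, if_neg h, ← pow_succ', show 2 * n - 2 + 1 = 2 * n - 1 by omega])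
    intro h0
    rw [h0, mul_zero] at h1
    have : 0 < 2 * (2 / Real.pi) ^ (2 * n - 1) *
        ∑' j : ℕ, ((2 * (j : ℝ) + 1)⁻¹) ^ (2 * n - 1) := by positivity
    exact this.ne' h1

lemma tendsto_sum_growthScale {n : ℕ} (hn : 1 ≤ n) {g : ℝ → ℝ} (hg : ContinuousOn g (Set.Icc 0 1)) :
    Tendsto (fun L : ℕ => (∑ m ∈ Finset.range L, ((Real.sin (halfAngle L m))⁻¹) ^ (2 * n - 1)
      * g (Real.sin (halfAngle L m))) / L / growthScale n L) atTop (𝓝 (4 ^ n * alpha n * g 0)) := by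
  have hpos := (tendsto_growthScale hn).eventually_gt_atTop 0
  have h := tendsto_weighted_gapSum (N := fun L : ℕ => L * growthScale n L) hg ?_ ?_
    (tendsto_gapSum_growthScale hn)
  · exact h.congr fun L => by rw [div_div]
  · filter_upwards [hpos, eventually_gt_atTop 0] with L h1 h2
    have : (0 : ℝ) < L := by exact_mod_cast h2
    positivity
  · refine (tendsto_inv_atTop_zero.comp (tendsto_growthScale hn)).congr' ?_
    filter_upwards [eventually_gt_atTop 0] with L h2
    have : (L : ℝ) ≠ 0 := by exact_mod_cast h2.ne'
    rw [Function.comp_apply, div_mul_cancel_left₀ this]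

lemma rpow_sub_half {a : ℝ} (ha : 0 < a) (n : ℕ) :
    a ^ ((n : ℝ) - 1 / 2) = a ^ n / Real.sqrt a := by
  rw [Real.rpow_sub ha, Real.rpow_natCast, Real.sqrt_eq_rpow]

lemma rpow_add_half {a : ℝ} (ha : 0 < a) (n : ℕ) :
    a ^ ((n : ℝ) + 1 / 2) = a ^ n * Real.sqrt a := by
  rw [Real.rpow_add ha, Real.rpow_natCast, Real.sqrt_eq_rpow]

lemma sqrt_four_mul (a : ℝ) : Real.sqrt (4 * a) = 2 * Real.sqrt a := by
  rw [show (4 : ℝ) * a = 2 ^ 2 * a by norm_num, Real.sqrt_mul (by norm_num),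
    Real.sqrt_sq (by norm_num)]

/-- The mode weight is `y ^ (-(2 n - 1))`, and small `y` dominates, so only the value of the smooth
coefficient at `0` matters. -/
lemma tendsto_criticalCumulant_even (h0 : 0 < ν) (h1 : ν < 1) {n : ℕ} (hn : 1 ≤ n) :
    Tendsto (fun L : ℕ => criticalCumulant ν (2 * n) L / growthScale n L) atTop
      (𝓝 (kappaStarEven n ν)) := by
  have ha : 0 < 1 - ν ^ 2 := by nlinarith
  have h := (tendsto_sum_growthScale hn
    (contDiff_energySqrtCoeff h0.le h1 (2 * n)).continuous.continuousOn).const_mul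
    (((2 * n).factorial : ℝ) / 2)
  have e : ((2 * n).factorial : ℝ) / 2 * (4 ^ n * alpha n * energySqrtCoeff ν (2 * n) 0)
      = kappaStarEven n ν := by
    have hs := Real.sqrt_pos.mpr ha
    have hss := Real.mul_self_sqrt ha.le
    rw [energySqrtCoeff_even_zero h0.le h1, kappaStarEven, betaEven, rpow_sub_half ha,
      sqrt_four_mul, div_pow, mul_pow, pow_mul]
    field_simp
  rw [e] at h
  refine h.congr' ?_
  filter_upwards [eventually_ge_atTop 2] with L hL
  rw [criticalCumulant_eq h0 h1 hL (by omega), mul_div_assoc]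
  congr 3
  refine Finset.sum_congr rfl fun m hm => ?_
  have hy := sin_halfAngle_pos (Finset.mem_range.mp hm)
  have hp := pow_ne_zero (2 * n - 1) hy.ne'
  rw [show Real.sin (halfAngle L m) ^ (2 * n) = Real.sin (halfAngle L m)
    * Real.sin (halfAngle L m) ^ (2 * n - 1) by rw [← pow_succ']; congr 1; omega, inv_pow]
  congr 1
  field_simp

/-- The coefficient vanishes at `0`, hence equals `y` times its difference quotient. The factor `y`
reduces the weight to `y ^ (-(2 n - 1))` again, and the quotient at `0` is the derivative. -/
lemma tendsto_criticalCumulant_odd (h0 : 0 < ν) (h1 : ν < 1) {n : ℕ} (hn : 1 ≤ n) :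
    Tendsto (fun L : ℕ => criticalCumulant ν (2 * n + 1) L / growthScale n L) atTop
      (𝓝 (kappaStarOdd n ν)) := by
  have ha : 0 < 1 - ν ^ 2 := by nlinarith
  have hF := contDiff_energySqrtCoeff h0.le h1 (2 * n + 1)
  have hg : Continuous (dslope (energySqrtCoeff ν (2 * n + 1)) 0) := by
    rw [← continuousOn_univ, continuousOn_dslope univ_mem]
    exact ⟨hF.continuous.continuousOn, hF.differentiable one_ne_zero 0⟩
  have h := (tendsto_sum_growthScale hn hg.continuousOn).const_mul
    (((2 * n + 1).factorial : ℝ) / 2)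
  have e : ((2 * n + 1).factorial : ℝ) / 2 *
      (4 ^ n * alpha n * dslope (energySqrtCoeff ν (2 * n + 1)) 0 0) = kappaStarOdd n ν := by
    have hs := Real.sqrt_pos.mpr ha
    have hss := Real.mul_self_sqrt ha.le
    obtain ⟨p, rfl⟩ := Nat.exists_eq_add_of_le' hn
    rw [dslope_same, show 2 * (p + 1) + 1 = 2 * p + 3 by ring,
      deriv_energySqrtCoeff_odd_zero h0.le h1, kappaStarOdd, betaOdd, rpow_add_half ha,
      sqrt_four_mul, div_pow, mul_pow, pow_mul, Nat.add_sub_cancel,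
      show 2 * (p + 1) + 1 = 2 * p + 3 by ring]
    set s := Real.sqrt (1 - ν ^ 2)
    rw [← hss]
    field_simp
    ring
  rw [e] at h
  refine h.congr' ?_
  filter_upwards [eventually_ge_atTop 2] with L hL
  rw [criticalCumulant_eq h0 h1 hL (by omega), mul_div_assoc]
  congr 3
  refine Finset.sum_congr rfl fun m hm => ?_
  have hy := sin_halfAngle_pos (Finset.mem_range.mp hm)
  have hp := pow_ne_zero (2 * n - 1) hy.ne'
  rw [dslope_of_ne _ hy.ne', slope_def_field, energySqrtCoeff_odd_zero h0.le h1,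
    show Real.sin (halfAngle L m) ^ (2 * n + 1) = Real.sin (halfAngle L m) *
      (Real.sin (halfAngle L m) * Real.sin (halfAngle L m) ^ (2 * n - 1)) by
      rw [← pow_succ', ← pow_succ']; congr 1; omega, inv_pow, sub_zero, sub_zero]
  field_simp

lemma choose_half_ne_zero (n : ℕ) : Ring.choose (1 / 2 : ℝ) n ≠ 0 := by
  induction n with
  | zero => simp
  | succ n ih =>
    intro h
    have h1 := choose_succ_mul (1 / 2 : ℝ) n
    rw [h, mul_zero, eq_comm, mul_eq_zero, or_iff_left ih] at h1
    have h2 : ((1 : ℕ) : ℝ) = ((2 * n : ℕ) : ℝ) := by push_cast; linarith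
    have := Nat.cast_injective h2
    omega

lemma choose_neg_half_ne_zero (n : ℕ) : Ring.choose (-1 / 2 : ℝ) n ≠ 0 := by
  induction n with
  | zero => simp
  | succ n ih =>
    intro h
    have h1 := choose_succ_mul (-1 / 2 : ℝ) n
    rw [h, mul_zero, eq_comm, mul_eq_zero, or_iff_left ih] at h1
    have : (0 : ℝ) ≤ n := n.cast_nonneg
    linarith

lemma kappaStarEven_ne_zero (h0 : 0 < ν) (h1 : ν < 1) {n : ℕ} (hn : 1 ≤ n) :
    kappaStarEven n ν ≠ 0 := by
  have ha : 0 < 1 - ν ^ 2 := by nlinarith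
  have hr := Real.rpow_pos_of_pos ha ((n : ℝ) - 1 / 2)
  unfold kappaStarEven betaEven
  have := choose_half_ne_zero n
  have := alpha_ne_zero hn
  positivity

/-- A zero constant would turn asymptotic equivalence into eventual vanishing. With `n = p + 1`, the
recursion for binomial coefficients makes `p + 1` times the bracket equal to `((p + 1) - (p + 1/2) ν
+ p ν ^ 2)` times a nonzero binomial coefficient, and this polynomial is positive for `0 < ν < 1`.
-/
lemma kappaStarOdd_ne_zero (h0 : 0 < ν) (h1 : ν < 1) {n : ℕ} (hn : 1 ≤ n) :
    kappaStarOdd n ν ≠ 0 := by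
  have ha : 0 < 1 - ν ^ 2 := by nlinarith
  have hr := Real.rpow_pos_of_pos ha ((n : ℝ) + 1 / 2)
  have hα := alpha_ne_zero hn
  have hb : ν * (1 - 2 * ν) * Ring.choose (-1 / 2 : ℝ) n
      + (1 - ν ^ 2) * Ring.choose (-1 / 2 : ℝ) (n - 1) ≠ 0 := by
    obtain ⟨p, rfl⟩ := Nat.exists_eq_add_of_le' hn
    rw [Nat.add_sub_cancel]
    have hc := choose_succ_mul (-1 / 2 : ℝ) p
    have hp : (0 : ℝ) ≤ p := p.cast_nonneg
    intro h
    have h2 : ((p + 1) - (p + 1 / 2) * ν + p * ν ^ 2) * Ring.choose (-1 / 2 : ℝ) p = 0 := by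
      linear_combination ((p : ℝ) + 1) * h - ν * (1 - 2 * ν) * hc
    rw [mul_eq_zero, or_iff_left (choose_neg_half_ne_zero p)] at h2
    nlinarith [mul_nonneg hp (sq_nonneg ν), mul_nonneg hp (sub_nonneg.mpr h1.le)]
  unfold kappaStarOdd betaOdd
  positivity

lemma isEquivalent_of_tendsto_div {u v : ℕ → ℝ} {c : ℝ} (hc : c ≠ 0)
    (hv : ∀ᶠ L in atTop, v L ≠ 0) (h : Tendsto (fun L => u L / v L) atTop (𝓝 c)) :
    u ~[atTop] fun L => c * v L := by
  rw [isEquivalent_iff_tendsto_one (hv.mono fun L hL => mul_ne_zero hc hL)]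
  have := h.div_const c
  rw [div_self hc] at this
  refine this.congr fun L => ?_
  rw [Pi.div_apply, div_div, mul_comm]

end Limits

/-! ### The mean activity -/

section Mean

variable {ν : ℝ}

lemma energySqrtCoeff_one (y : ℝ) : energySqrtCoeff ν 1 y
    = ν * y * (1 - 2 * ν * (1 - y ^ 2)) / Real.sqrt (1 - ν ^ 2 * (1 - y ^ 2)) := by
  rw [energySqrtCoeff, sqrtCoeff_succ]
  simp only [Finset.univ_eq_empty, Finset.sum_empty, sub_zero, energyCoeff]
  rw [sqrt_four_mul, ← mul_assoc 2 2, mul_assoc (4 * ν), mul_assoc 4, show (2 : ℝ) * 2 = 4 by norm_num,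
    mul_div_mul_left _ _ (by norm_num), mul_assoc ν]

/-- The substitution `x = ν cos θ` turns the integrand into `-(1 - 2 x ^ 2 / ν) / √(1 - x ^ 2)`,
whose primitive combines `arcsin x` and `x √(1 - x ^ 2)`. -/
lemma hasDerivAt_mean_primitive (h0 : 0 < ν) (h1 : ν < 1) (θ : ℝ) :
    HasDerivAt (fun θ => -(Real.arcsin (ν * Real.cos θ) * (1 - 1 / ν)
      + Real.cos θ * Real.sqrt (1 - (ν * Real.cos θ) ^ 2)))
      (energySqrtCoeff ν 1 (Real.sin θ)) θ := by
  have hlt : |ν * Real.cos θ| < 1 := by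
    rw [abs_mul, abs_of_pos h0]
    nlinarith [Real.abs_cos_le_one θ, abs_nonneg (Real.cos θ)]
  obtain ⟨hl, hu⟩ := abs_lt.mp hlt
  have ha : 0 < 1 - (ν * Real.cos θ) ^ 2 := by nlinarith
  have hs := Real.sqrt_pos.mpr ha
  have hss := Real.mul_self_sqrt ha.le
  have hx : HasDerivAt (fun θ => ν * Real.cos θ) (ν * -Real.sin θ) θ :=
    (Real.hasDerivAt_cos θ).const_mul ν
  have hA := (Real.hasDerivAt_arcsin hl.ne' hu.ne).comp θ hx
  have hB := (((hx.fun_pow 2).const_sub 1).sqrt ha.ne')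
  have h := ((hA.mul_const (1 - 1 / ν)).fun_add ((Real.hasDerivAt_cos θ).fun_mul hB)).fun_neg
  refine h.congr_deriv ?_
  have hc : 1 - Real.sin θ ^ 2 = Real.cos θ ^ 2 := by linarith [Real.sin_sq_add_cos_sq θ]
  rw [energySqrtCoeff_one, hc, ← mul_pow]
  set s := Real.sqrt (1 - (ν * Real.cos θ) ^ 2)
  field_simp
  have hs2 : s ^ 2 = 1 - (ν * Real.cos θ) ^ 2 := by rw [sq, hss]
  rw [hs2]
  push_cast
  ring

/-- At order one the singular weight `y / y ^ n` equals one, so the sum over modes is an ordinary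
midpoint sum on `[0, π]`. -/
lemma tendsto_criticalCumulant_one (h0 : 0 < ν) (h1 : ν < 1) :
    Tendsto (fun L : ℕ => criticalCumulant ν 1 L) atTop (𝓝 (kappaStarOne ν)) := by
  have h := (tendsto_midpoint_sum (hasDerivAt_mean_primitive h0 h1)
    ((contDiff_energySqrtCoeff h0.le h1 1).continuous.comp Real.continuous_sin)).const_mul (1 / 2)
  have e : (1 / 2 : ℝ) * ((-(Real.arcsin (ν * Real.cos Real.pi) * (1 - 1 / ν)
      + Real.cos Real.pi * Real.sqrt (1 - (ν * Real.cos Real.pi) ^ 2))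
      - -(Real.arcsin (ν * Real.cos 0) * (1 - 1 / ν)
      + Real.cos 0 * Real.sqrt (1 - (ν * Real.cos 0) ^ 2))) / Real.pi) = kappaStarOne ν := by
    rw [kappaStarOne, if_neg h0.ne', Real.cos_pi, Real.cos_zero, mul_neg, mul_one, neg_sq,
      Real.arcsin_neg]
    field_simp
    ring
  rw [e] at h
  refine h.congr' ?_
  filter_upwards [eventually_ge_atTop 2] with L hL
  rw [criticalCumulant_eq h0 h1 hL le_rfl, Nat.factorial_one, Nat.cast_one]
  congr 2
  refine Finset.sum_congr rfl fun m hm => ?_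
  have hy := sin_halfAngle_pos (Finset.mem_range.mp hm)
  rw [pow_one, div_self hy.ne', one_mul]

/-- From `arcsin ν < tan (arcsin ν) = ν / √(1 - ν ^ 2)` the subtracted term is less than `(1 - ν) /
√(1 - ν ^ 2)`, which is at most `√(1 - ν ^ 2)` because `1 - ν ≤ 1 - ν ^ 2`. -/
lemma kappaStarOne_pos (h0 : 0 < ν) (h1 : ν < 1) : 0 < kappaStarOne ν := by
  have ha : 0 < 1 - ν ^ 2 := by nlinarith
  have hs := Real.sqrt_pos.mpr ha
  have hss := Real.mul_self_sqrt ha.le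
  have hθ : Real.arcsin ν < ν / Real.sqrt (1 - ν ^ 2) := by
    rw [← Real.tan_arcsin]
    exact Real.lt_tan (Real.arcsin_pos.mpr h0) (Real.arcsin_lt_pi_div_two.mpr h1)
  rw [kappaStarOne, if_neg h0.ne']
  refine mul_pos (by have := Real.pi_pos; positivity) (sub_pos.mpr ?_)
  refine (mul_lt_mul_of_pos_left hθ (div_pos (sub_pos.mpr h1) h0)).trans_le ?_
  rw [div_mul_div_comm, div_le_iff₀ (by positivity)]
  nlinarith [mul_pos h0 h0, mul_pos (mul_pos h0 h0) (sub_pos.mpr h1)]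

end Mean

/-! ### Asymptotic equivalences, uniformly including `ν = 0` -/

section Equivalence

variable {ν : ℝ}

lemma kappaStarEven_zero {n : ℕ} (hn : 1 ≤ n) : kappaStarEven n 0 = 0 := by
  rw [kappaStarEven, betaEven, zero_pow (by omega)]; simp

lemma kappaStarOdd_zero {n : ℕ} (hn : 1 ≤ n) : kappaStarOdd n 0 = 0 := by
  rw [kappaStarOdd, betaOdd, zero_pow (by omega)]; simp

/-- Equivalence to the zero sequence means eventual equality, which holds from `L = 2` on. -/
lemma isEquivalent_criticalCumulant_zero {n : ℕ} (hn : 1 ≤ n) {v : ℕ → ℝ} (hv : ∀ L, v L = 0) :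
    (fun L : ℕ => criticalCumulant 0 n L) ~[atTop] v := by
  refine EventuallyEq.isEquivalent ?_
  filter_upwards [eventually_ge_atTop 2] with L hL
  rw [criticalCumulant_zero hL hn, hv]

lemma isEquivalent_criticalCumulant_one (h0 : 0 ≤ ν) (h1 : ν < 1) :
    (fun L : ℕ => criticalCumulant ν 1 L) ~[atTop] fun _ : ℕ => kappaStarOne ν := by
  rcases h0.eq_or_lt with rfl | h0
  · exact isEquivalent_criticalCumulant_zero le_rfl fun _ => if_pos rfl
  · exact (isEquivalent_const_iff_tendsto (kappaStarOne_pos h0 h1).ne').mpr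
      (tendsto_criticalCumulant_one h0 h1)

lemma isEquivalent_criticalCumulant_even (h0 : 0 ≤ ν) (h1 : ν < 1) {n : ℕ} (hn : 1 ≤ n) :
    (fun L : ℕ => criticalCumulant ν (2 * n) L) ~[atTop]
      fun L : ℕ => kappaStarEven n ν * growthScale n L := by
  rcases h0.eq_or_lt with rfl | h0
  · exact isEquivalent_criticalCumulant_zero (by omega) fun L => by
      rw [kappaStarEven_zero hn, zero_mul]
  · exact isEquivalent_of_tendsto_div (kappaStarEven_ne_zero h0 h1 hn)
      ((tendsto_growthScale hn).eventually_ne_atTop 0) (tendsto_criticalCumulant_even h0 h1 hn)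

lemma isEquivalent_criticalCumulant_odd (h0 : 0 ≤ ν) (h1 : ν < 1) {n : ℕ} (hn : 1 ≤ n) :
    (fun L : ℕ => criticalCumulant ν (2 * n + 1) L) ~[atTop]
      fun L : ℕ => kappaStarOdd n ν * growthScale n L := by
  rcases h0.eq_or_lt with rfl | h0
  · exact isEquivalent_criticalCumulant_zero (by omega) fun L => by
      rw [kappaStarOdd_zero hn, zero_mul]
  · exact isEquivalent_of_tendsto_div (kappaStarOdd_ne_zero h0 h1 hn)
      ((tendsto_growthScale hn).eventually_ne_atTop 0) (tendsto_criticalCumulant_odd h0 h1 hn)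

end Equivalence

end DLPAD

end

/-! ### The theorem -/

theorem theorem1 (ν : ℝ) (hν0 : 0 ≤ ν) (hν1 : ν < 1) :
    -- the long-time limits exist, do not depend on the even initial configuration, and are smooth
    (∀ L : ℕ, 2 ≤ L →
      (∀ (s : ℝ) (η : DLPAD.Config L), Even (DLPAD.particleNumber η) →
        Tendsto (fun t : ℝ => DLPAD.scaledLogMGF (1 / 2) (DLPAD.depositionRate ν) L η s t)
          atTop (𝓝 (DLPAD.K ν L s))) ∧
      ContDiff ℝ (⊤ : ℕ∞) (DLPAD.K ν L) ∧
      -- for `ν = 0` the cumulants have limits at the critical point, which is then `-∞`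
      (ν = 0 → ∀ n : ℕ, 1 ≤ n →
        Tendsto (DLPAD.cumulant (1 / 2) (DLPAD.depositionRate ν) L n)
          atBot (𝓝 (DLPAD.criticalCumulant ν n L)))) ∧
    (fun L : ℕ => DLPAD.criticalCumulant ν 1 L) ~[atTop]
      (fun _ : ℕ => DLPAD.kappaStarOne ν) ∧
    (fun L : ℕ => DLPAD.criticalCumulant ν 2 L) ~[atTop]
      (fun L : ℕ => DLPAD.kappaStarEven 1 ν * Real.log (L : ℝ)) ∧
    (fun L : ℕ => DLPAD.criticalCumulant ν 3 L) ~[atTop]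
      (fun L : ℕ => DLPAD.kappaStarOdd 1 ν * Real.log (L : ℝ)) ∧
    (∀ n : ℕ, 2 ≤ n →
      (fun L : ℕ => DLPAD.criticalCumulant ν (2 * n) L) ~[atTop]
        (fun L : ℕ => DLPAD.kappaStarEven n ν * (L : ℝ) ^ (2 * n - 2))) ∧
    (∀ n : ℕ, 2 ≤ n →
      (fun L : ℕ => DLPAD.criticalCumulant ν (2 * n + 1) L) ~[atTop]
        (fun L : ℕ => DLPAD.kappaStarOdd n ν * (L : ℝ) ^ (2 * n - 2))) := by
  have hone := DLPAD.isEquivalent_criticalCumulant_one hν0 hν1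
  have heven := fun {n : ℕ} (hn : 1 ≤ n) => DLPAD.isEquivalent_criticalCumulant_even hν0 hν1 hn
  have hodd := fun {n : ℕ} (hn : 1 ≤ n) => DLPAD.isEquivalent_criticalCumulant_odd hν0 hν1 hn
  have hscale : ∀ n, 2 ≤ n → DLPAD.growthScale n = fun L : ℕ => (L : ℝ) ^ (2 * n - 2) :=
    fun n hn => by
      funext L
      rw [DLPAD.growthScale, if_neg (by omega)]
  have hlog : DLPAD.growthScale 1 = fun L : ℕ => Real.log (L : ℝ) :=
    funext fun L => by rw [DLPAD.growthScale, if_pos rfl]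
  have heven_one := heven le_rfl
  have hodd_one := hodd le_rfl
  rw [hlog, mul_one] at heven_one hodd_one
  refine ⟨fun L hL => ⟨fun s η hη => DLPAD.tendsto_scaledLogMGF_K hν1 hL s hη,
    DLPAD.contDiff_K hν1 hL, ?_⟩, hone, heven_one, hodd_one, fun n hn => ?_, fun n hn => ?_⟩
  · rintro rfl n hn
    rw [DLPAD.criticalCumulant_zero hL hn]
    exact DLPAD.tendsto_cumulant_zero hL hn
  · simpa only [hscale n hn] using heven (one_le_two.trans hn)
  · simpa only [hscale n hn] using hodd (one_le_two.trans hn)
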